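/- Let $T>0$, $Q=(0,T)\times(0,1)$, and let $\sigma\in H^4(0,1)$ (identified with its continuous representative) satisfy $\sigma(x)\ge\sigma_0>0$ on $(0,1)$ for some constant $\sigma_0$. For $q_0,q_1,q_2\in L^\infty(Q)$ put $$Lv=v_t+(\sigma v_{xx})_{xx}+q_2v_{xx}+q_1v_x+q_0v$$ (in the sense of distributions on $Q$) and $$\mathcal V=\{v\in L^2(0,T;H^4\cap H^2_0(0,1)) : Lv\in L^2(Q)\}.$$ Let $r>0$ and let $\beta\in C^4([0,1])$ satisfy, for all $x\in(0,1)$, $$\beta(x)\ge r,\qquad \beta'(x)\ge r,\qquad \beta''(x)\le -r,\qquad |\sigma'(x)\beta'(x)|\le \frac r4\min_{z\in[0,1]}\sigma(z).$$ Let $T_0\in(0,T)$ and let $\phi_0\in C^1([0,T])$ satisfy $\phi_0(0)=\phi_0(T)=0$ and $0<\phi_0(t)\le\phi_0(T_0)$ for all $t\in(0,T)$. Define $\phi(t,x)=\beta(x)/\phi_0(t)$ for $(t,x)\in(0,T)\times[0,1]$, and let $m>0$. Then there exist $\lambda_0>0$ and a constant $C=C(T,\lambda_0,r,m)>0$ such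 that, whenever $\|q_i\|_{L^\infty(Q)}\le m$ for $i=0,1,2$, every $v\in\mathcal V$ satisfies $v_t\in L^2(Q)$ and $(\sigma v_{xx})_{xx}\in L^2(Q)$, and for all $\lambda\ge\lambda_0$ $$\int_0^T\!\!\int_0^1 e^{-2\lambda\phi}\Big(\frac{|v_t|^2+|(\sigma v_{xx})_{xx}|^2}{\lambda\phi}+\lambda^7\phi^7|v|^2+\lambda^5\phi^5|v_x|^2+\lambda^3\phi^3|v_{xx}|^2+\lambda\phi|v_{xxx}|^2\Big)\,dx\,dt$$ $$\le C\int_0^T\!\!\int_0^1 e^{-2\lambda\phi}|Lv|^2\,dx\,dt+C\int_0^T e^{-2\lambda\phi(t,0)}\Big(\lambda^3\phi_x(t,0)^3\sigma(0)^2|v_{xx}(t,0)|^2+\lambda\phi_x(t,0)\sigma(0)^2|v_{xxx}(t,0)|^2\Big)\,dt,$$ where the right-hand side is finite. -/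

import Mathlib

open MeasureTheory Set
open scoped ENNReal

noncomputable section

/-- `ψ` is a test function on the open set `U`, that is `ψ ∈ C_c^∞(U)`. -/
structure IsTestFun {E : Type*} [NormedAddCommGroup E] [NormedSpace ℝ E]
    (U : Set E) (ψ : E → ℝ) : Prop where
  smooth : ContDiff ℝ ((⊤ : ℕ∞) : WithTop ℕ∞) ψ
  compact : HasCompactSupport ψ
  supp : tsupport ψ ⊆ U

/-! ### Sobolev spaces on the interval `(0,1)` -/

/-- `g` is the weak derivative of `f` on `(0,1)`. -/
def HasWeakDeriv (f g : ℝ → ℝ) : Prop :=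
  ∀ ψ : ℝ → ℝ, IsTestFun (Ioo 0 1) ψ →
    ∫ x in Ioo (0 : ℝ) 1, f x * deriv ψ x = -∫ x in Ioo (0 : ℝ) 1, g x * ψ x

/-- `D 0` is an element of `H^k(0,1)` and `D j`, for `j ≤ k`, is its `j`-th weak derivative.
For `j < k` the function `D j` is the representative that is continuous on `[0,1]` (it exists
since `H¹(0,1) ⊂ C([0,1])`), so that `D j 0` and `D j 1` are the boundary traces. Up to values on
null sets (for `j = k`) and outside `[0,1]`, the functions `D 1, …, D k` are determined
by `D 0`. -/
structure IsSobolevJet (k : ℕ) (D : ℕ → ℝ → ℝ) : Prop where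
  memLp : ∀ j ≤ k, MemLp (D j) 2 (volume.restrict (Ioo (0 : ℝ) 1))
  weak : ∀ j < k, HasWeakDeriv (D j) (D (j + 1))
  cont : ∀ j < k, ContinuousOn (D j) (Icc 0 1)

/-- `f` is the continuous representative of an element of `H^k(0,1)`, `k ≥ 1`. -/
def MemSobolev (k : ℕ) (f : ℝ → ℝ) : Prop :=
  ∃ D : ℕ → ℝ → ℝ, D 0 = f ∧ IsSobolevJet k D

/-! ### Functions and distributions on `Q = (0,T) × (0,1)`; points are written `(t, x)` -/

/-- The space-time domain `Q = (0,T) × (0,1)`. -/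
def QDom (T : ℝ) : Set (ℝ × ℝ) := Ioo 0 T ×ˢ Ioo 0 1

/-- Partial derivative in time. -/
def dt (ψ : ℝ × ℝ → ℝ) (p : ℝ × ℝ) : ℝ := fderiv ℝ ψ p (1, 0)

/-- Partial derivative in space. -/
def dx (ψ : ℝ × ℝ → ℝ) (p : ℝ × ℝ) : ℝ := fderiv ℝ ψ p (0, 1)

/-- `g = ∂_t f` in the sense of distributions on `Q`. -/
def HasWeakDt (T : ℝ) (f g : ℝ × ℝ → ℝ) : Prop :=
  ∀ ψ : ℝ × ℝ → ℝ, IsTestFun (QDom T) ψ →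
    ∫ p in QDom T, f p * dt ψ p = -∫ p in QDom T, g p * ψ p

/-- `g = ∂_x ∂_x f` in the sense of distributions on `Q`. -/
def HasWeakDxx (T : ℝ) (f g : ℝ × ℝ → ℝ) : Prop :=
  ∀ ψ : ℝ × ℝ → ℝ, IsTestFun (QDom T) ψ →
    ∫ p in QDom T, f p * dx (dx ψ) p = ∫ p in QDom T, g p * ψ p

/-- `v = V 0` belongs to `L²(0,T; H⁴(0,1) ∩ H₀²(0,1))`, with spatial derivatives
`V j = ∂_x^j v`, `j ≤ 4`: for almost every `t` the function `v(t,·)` is in `H⁴(0,1)` and has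
vanishing traces `v = v_x = 0` at `x = 0` and `x = 1`. The condition that every `V j` is
(almost everywhere strongly) measurable and square integrable on `Q` says that
`t ↦ v(t,·) ∈ H⁴(0,1)` is strongly measurable with `∫₀ᵀ ‖v(t,·)‖²_{H⁴} dt < ∞`. -/
structure IsL2H4H02 (T : ℝ) (V : ℕ → ℝ × ℝ → ℝ) : Prop where
  memLp : ∀ j ≤ 4, MemLp (V j) 2 (volume.restrict (QDom T))
  jet : ∀ᵐ t ∂(volume.restrict (Ioo 0 T)), IsSobolevJet 4 (fun j x => V j (t, x))
  zero : ∀ᵐ t ∂(volume.restrict (Ioo 0 T)),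
    V 0 (t, 0) = 0 ∧ V 0 (t, 1) = 0 ∧ V 1 (t, 0) = 0 ∧ V 1 (t, 1) = 0

/-- `F = L v` in the sense of distributions on `Q`, where
`L v = v_t + (σ v_xx)_xx + q₂ v_xx + q₁ v_x + q₀ v` and `V j = ∂_x^j v`. -/
def IsLv (T : ℝ) (σ : ℝ → ℝ) (q₀ q₁ q₂ : ℝ × ℝ → ℝ) (V : ℕ → ℝ × ℝ → ℝ)
    (F : ℝ × ℝ → ℝ) : Prop :=
  ∀ ψ : ℝ × ℝ → ℝ, IsTestFun (QDom T) ψ →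
    ∫ p in QDom T, (-(V 0 p * dt ψ p) + σ p.2 * V 2 p * dx (dx ψ) p
        + (q₂ p * V 2 p + q₁ p * V 1 p + q₀ p * V 0 p) * ψ p)
      = ∫ p in QDom T, F p * ψ p

/-- `v = V 0` (with `V j = ∂_x^j v`) belongs to the space
`𝒱 = {v ∈ L²(0,T; H⁴ ∩ H₀²(0,1)) | L v ∈ L²(Q)}`, and `F = L v`. -/
structure MemSpaceV (T : ℝ) (σ : ℝ → ℝ) (q₀ q₁ q₂ : ℝ × ℝ → ℝ) (V : ℕ → ℝ × ℝ → ℝ)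
    (F : ℝ × ℝ → ℝ) : Prop where
  reg : IsL2H4H02 T V
  memLp : MemLp F 2 (volume.restrict (QDom T))
  eq : IsLv T σ q₀ q₁ q₂ V F

/-- `q ∈ L^∞(Q)` with `‖q‖_{L^∞(Q)} ≤ m`. -/
def LinftyBound (T m : ℝ) (q : ℝ × ℝ → ℝ) : Prop :=
  MemLp q ∞ (volume.restrict (QDom T)) ∧
    eLpNorm q ∞ (volume.restrict (QDom T)) ≤ ENNReal.ofReal m

/-! ### The coefficient and the weight -/

/-- `σ ∈ H⁴(0,1)` (continuous representative) is bounded below by a positive constant. -/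
structure IsDiffusion (σ : ℝ → ℝ) : Prop where
  mem : MemSobolev 4 σ
  pos : ∃ σ₀ > 0, ∀ x ∈ Ioo (0 : ℝ) 1, σ₀ ≤ σ x

/-- The conditions on the spatial part `β ∈ C⁴([0,1])` of the weight, with parameter `r > 0`. -/
structure IsSpaceWeight (σ : ℝ → ℝ) (r : ℝ) (β : ℝ → ℝ) : Prop where
  smooth : ContDiffOn ℝ 4 β (Icc 0 1)
  r_pos : 0 < r
  le_zero : ∀ x ∈ Ioo (0 : ℝ) 1, r ≤ β x
  le_one : ∀ x ∈ Ioo (0 : ℝ) 1, r ≤ derivWithin β (Icc 0 1) x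
  two_le : ∀ x ∈ Ioo (0 : ℝ) 1, iteratedDerivWithin 2 β (Icc 0 1) x ≤ -r
  mul_le : ∀ x ∈ Ioo (0 : ℝ) 1,
    |derivWithin σ (Icc 0 1) x * derivWithin β (Icc 0 1) x| ≤ r / 4 * sInf (σ '' Icc 0 1)

/-- The conditions on the temporal part `φ₀ ∈ C¹([0,T])` of the weight. -/
structure IsTimeWeight (T T₀ : ℝ) (φ₀ : ℝ → ℝ) : Prop where
  smooth : ContDiffOn ℝ 1 φ₀ (Icc 0 T)
  mem : T₀ ∈ Ioo 0 T
  zero_left : φ₀ 0 = 0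
  zero_right : φ₀ T = 0
  pos : ∀ t ∈ Ioo 0 T, 0 < φ₀ t
  le_max : ∀ t ∈ Ioo 0 T, φ₀ t ≤ φ₀ T₀

/-- The Carleman weight `φ(t,x) = β(x) / φ₀(t)`. -/
def weight (β φ₀ : ℝ → ℝ) (t x : ℝ) : ℝ := β x / φ₀ t

/-- The derivative `φ_x(t,x)` of the weight, one-sided at the end points of `[0,1]`. -/
def weightX (β φ₀ : ℝ → ℝ) (t x : ℝ) : ℝ :=
  derivWithin (fun y => weight β φ₀ t y) (Icc 0 1) x

/-! ### The three weighted integrals (valued in `[0,∞]`) -/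

/-- The left-hand side; `vt` stands for `v_t`, `S` for `(σ v_xx)_xx` and `V j` for `∂_x^j v`. -/
def carlemanLHS (T lam : ℝ) (β φ₀ : ℝ → ℝ) (V : ℕ → ℝ × ℝ → ℝ) (vt S : ℝ × ℝ → ℝ) : ℝ≥0∞ :=
  ∫⁻ p in QDom T, ENNReal.ofReal
    (Real.exp (-2 * lam * weight β φ₀ p.1 p.2) *
      ((|vt p| ^ 2 + |S p| ^ 2) / (lam * weight β φ₀ p.1 p.2)
        + lam ^ 7 * weight β φ₀ p.1 p.2 ^ 7 * |V 0 p| ^ 2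
        + lam ^ 5 * weight β φ₀ p.1 p.2 ^ 5 * |V 1 p| ^ 2
        + lam ^ 3 * weight β φ₀ p.1 p.2 ^ 3 * |V 2 p| ^ 2
        + lam * weight β φ₀ p.1 p.2 * |V 3 p| ^ 2))

/-- The weighted norm of the source `F = L v`. -/
def carlemanSource (T lam : ℝ) (β φ₀ : ℝ → ℝ) (F : ℝ × ℝ → ℝ) : ℝ≥0∞ :=
  ∫⁻ p in QDom T, ENNReal.ofReal
    (Real.exp (-2 * lam * weight β φ₀ p.1 p.2) * |F p| ^ 2)

/-- The boundary terms at `x = 0`. -/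
def carlemanBoundary (T lam : ℝ) (σ β φ₀ : ℝ → ℝ) (V : ℕ → ℝ × ℝ → ℝ) : ℝ≥0∞ :=
  ∫⁻ t in Ioo 0 T, ENNReal.ofReal
    (Real.exp (-2 * lam * weight β φ₀ t 0) *
      (lam ^ 3 * weightX β φ₀ t 0 ^ 3 * σ 0 ^ 2 * |V 2 (t, 0)| ^ 2
        + lam * weightX β φ₀ t 0 * σ 0 ^ 2 * |V 3 (t, 0)| ^ 2))

end

/-!
The inequality is proved by conjugation with the weight. Put `k(t) = λ / φ₀(t)`, so that
`λφ = kβ`, and `w = e^{-kβ} v`. On a time slice the operator `v ↦ (σ v'')''` turns into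
`w ↦ e^{-kβ} (σ (e^{kβ} w)'')''`, whose self-adjoint and skew-adjoint parts, applied to `w`, are
called `P₁` and `P₂` (`CarlemanData.symmPart`, `CarlemanData.skewPart`).

*On a slice*, the product `2 P₁ P₂` is the derivative of a boundary form plus a quadratic form in
`w, …, w'''`. After the scaling `z j = k^{-j} w^{(j)}` this form is `k ^ 7` times a form with
coefficients continuous in `x` and `ε = k⁻¹`, which for `ε = 0` is diagonal, and positive because
the hypotheses on `β` give `-4 β'' σ - β' σ' > 0`. By compactness it is positive definite for all
large `k`, the remainders being absorbed by `P₁ ^ 2 / 2` (`carleman_pointwise`). Since `w = w' = 0`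
at both ends, the boundary form at `x = 1` is nonnegative, as `β' > 0`, and at `x = 0` it is
bounded by the observed traces of `v''` and `v'''` (`CarlemanData.exists_slice_bound`).

*In time*, twice `e^{-kβ} P₁` is the operator `v ↦ e^{-2kβ} (σ v'')'' + (σ (e^{-2kβ} v)'')''`,
which is symmetric in `v` with the form `2 σ v'' (e^{-2kβ} v)''`. Hence the integral of `v_t`
against it only involves the derivative of that form in `k`, multiplied by `k' = O(k ^ 2)`
(`CarlemanData.integral_dt_mul_op`). As `v` has just a weak time derivative, while its space
derivatives have none, this is shown with symmetric difference quotients in time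
(`HasWeakDt.two_mul_integral_mul_eq`), first with a cutoff of the times near `0` and `T`, where `k`
tends to infinity. So the integral of `P₁ ^ 2 + 2 P₁ P₂` is at most that of
`(e^{-kβ} (v_t + (σ v'')''))²` plus terms of order `k ^ 6` in the scaled energy, and for large `k`
these and the terms of lower order in `L` are absorbed by the energy of order `k ^ 7`
(`CarlemanData.exists_weighted_bound`). The bounds for `v_t` and `(σ v'')''` then follow from the
one for `P₁` and from the equation (`density_le`).

That `v_t` and `(σ v'')''` are in `L²(Q)` is read off from the equation, because `σ ∈ H⁴(0,1)` and
`v(t,·) ∈ H⁴(0,1)` allow to expand `(σ v'')''` almost everywhere (`principalPart`).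

The constant is to be a function of `T`, `λ₀`, `r` and `m` alone, whereas `λ₀` may depend on all
the data; it is enough to choose `λ₀` larger than the constant that the proof produces.
-/

noncomputable section

/-! ### Absolutely continuous functions on `[0,1]` and their derivatives -/

/-- `f` is absolutely continuous on `[0,1]` and `f'` is its derivative at almost every point. -/
structure HasACDeriv (f f' : ℝ → ℝ) : Prop where
  ac : AbsolutelyContinuousOnInterval f 0 1
  ae_hasDerivAt : ∀ᵐ x ∂volume.restrict (Ioo (0 : ℝ) 1), HasDerivAt f (f' x) x

theorem AbsolutelyContinuousOnInterval.congr {f g : ℝ → ℝ} {a b : ℝ}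
    (hf : AbsolutelyContinuousOnInterval f a b) (h : EqOn f g (uIcc a b)) :
    AbsolutelyContinuousOnInterval g a b := by
  rw [absolutelyContinuousOnInterval_iff] at hf ⊢
  intro ε hε
  obtain ⟨δ, hδ, H⟩ := hf ε hε
  refine ⟨δ, hδ, fun E hE hs => ?_⟩
  have := H E hE hs
  convert this using 3 with i hi
  · exact (h (hE.1 i hi).1).symm
  · exact (h (hE.1 i hi).2).symm

namespace HasACDeriv

variable {f g f' g' : ℝ → ℝ}

theorem add (hf : HasACDeriv f f') (hg : HasACDeriv g g') :
    HasACDeriv (fun x => f x + g x) (fun x => f' x + g' x) :=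
  ⟨hf.ac.add hg.ac, by
    filter_upwards [hf.ae_hasDerivAt, hg.ae_hasDerivAt] with x h1 h2 using h1.add h2⟩

theorem sub (hf : HasACDeriv f f') (hg : HasACDeriv g g') :
    HasACDeriv (fun x => f x - g x) (fun x => f' x - g' x) :=
  ⟨hf.ac.sub hg.ac, by
    filter_upwards [hf.ae_hasDerivAt, hg.ae_hasDerivAt] with x h1 h2 using h1.sub h2⟩

theorem mul (hf : HasACDeriv f f') (hg : HasACDeriv g g') :
    HasACDeriv (fun x => f x * g x) (fun x => f' x * g x + f x * g' x) :=
  ⟨hf.ac.mul hg.ac, by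
    filter_upwards [hf.ae_hasDerivAt, hg.ae_hasDerivAt] with x h1 h2 using h1.mul h2⟩

theorem const_mul (c : ℝ) (hf : HasACDeriv f f') :
    HasACDeriv (fun x => c * f x) (fun x => c * f' x) :=
  ⟨hf.ac.const_mul c, by filter_upwards [hf.ae_hasDerivAt] with x h1 using h1.const_mul c⟩

theorem continuousOn (hf : HasACDeriv f f') : ContinuousOn f (Icc 0 1) := by
  have := hf.ac.continuousOn
  rwa [uIcc_of_le zero_le_one] at this

theorem deriv_ae_eq (hf : HasACDeriv f f') :
    deriv f =ᵐ[volume.restrict (Ioo (0 : ℝ) 1)] f' := by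
  filter_upwards [hf.ae_hasDerivAt] with x hx using hx.deriv

theorem integrableOn (hf : HasACDeriv f f') : IntegrableOn f' (Ioo 0 1) := by
  have h := hf.ac.intervalIntegrable_deriv
  rw [intervalIntegrable_iff_integrableOn_Ioo_of_le zero_le_one] at h
  exact h.congr hf.deriv_ae_eq

theorem integral_eq (hf : HasACDeriv f f') : ∫ x in Ioo (0 : ℝ) 1, f' x = f 1 - f 0 := by
  rw [← hf.ac.integral_deriv_eq_sub, intervalIntegral.integral_of_le zero_le_one,
    integral_Ioc_eq_integral_Ioo]
  exact (integral_congr_ae hf.deriv_ae_eq).symm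

/-- Functions that are continuously differentiable up to the boundary. -/
theorem of_hasDerivAt (hf : ContinuousOn f (Icc 0 1)) (hf' : ContinuousOn f' (Icc 0 1))
    (h : ∀ x ∈ Ioo (0 : ℝ) 1, HasDerivAt f (f' x) x) : HasACDeriv f f' := by
  refine ⟨?_, ?_⟩
  · obtain ⟨C, hC⟩ := isCompact_Icc.exists_bound_of_continuousOn hf'
    have hd : DifferentiableOn ℝ f (interior (Icc 0 1)) := by
      rw [interior_Icc]
      exact fun x hx => (h x hx).differentiableAt.differentiableWithinAt
    have hL : LipschitzOnWith C.toNNReal f (uIcc 0 1) := by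
      rw [uIcc_of_le zero_le_one]
      refine LipschitzOnWith.of_dist_le_mul fun x hx y hy => ?_
      have key : ∀ x ∈ Icc (0 : ℝ) 1, ∀ y ∈ Icc (0 : ℝ) 1, x ≤ y → dist (f x) (f y)
          ≤ C.toNNReal * dist x y := by
        intro x hx y hy hxy
        rcases hxy.eq_or_lt with rfl | hlt
        · simp
        obtain ⟨c, hc, hce⟩ := exists_hasDerivAt_eq_slope f f' hlt
          (hf.mono (Icc_subset_Icc hx.1 hy.2))
          (fun z hz => h z ⟨hx.1.trans_lt hz.1, hz.2.trans_le hy.2⟩)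
        have hb := hC c ⟨hx.1.trans hc.1.le, hc.2.le.trans hy.2⟩
        have hne : y - x ≠ 0 := by linarith
        rw [eq_div_iff hne] at hce
        rw [dist_comm, dist_comm x y, Real.dist_eq, Real.dist_eq, ← hce, abs_mul]
        gcongr
        exact hb.trans (Real.le_coe_toNNReal C)
      rcases le_total x y with hxy | hxy
      · exact key x hx y hy hxy
      · rw [dist_comm, dist_comm x y]; exact key y hy x hx hxy
    exact hL.absolutelyContinuousOnInterval
  · filter_upwards [ae_restrict_mem measurableSet_Ioo] with x hx using h x hx

end HasACDeriv

theorem hasACDeriv_of_eq_integral {f f' : ℝ → ℝ} (hf' : IntegrableOn f' (Ioo 0 1))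
    (h : ∀ x ∈ Icc (0 : ℝ) 1, f x = f 0 + ∫ y in (0 : ℝ)..x, f' y) : HasACDeriv f f' := by
  have hi : IntervalIntegrable f' volume 0 1 := by
    rwa [intervalIntegrable_iff_integrableOn_Ioo_of_le zero_le_one]
  refine ⟨?_, ?_⟩
  · have h1 : AbsolutelyContinuousOnInterval (fun x => f 0 + ∫ y in (0 : ℝ)..x, f' y) 0 1 := by
      have h0 : AbsolutelyContinuousOnInterval (fun _ : ℝ => f 0) 0 1 :=
        (LipschitzWith.const (f 0)).lipschitzOnWith.absolutelyContinuousOnInterval (K := 0)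
      exact h0.add (hi.absolutelyContinuousOnInterval_intervalIntegral (by simp))
    refine h1.congr fun x hx => ?_
    rw [uIcc_of_le zero_le_one] at hx
    exact (h x hx).symm
  · rw [ae_restrict_iff' measurableSet_Ioo]
    filter_upwards [hi.ae_hasDerivAt_integral] with x hx hxI
    have h2 := (hx (by rw [uIcc_of_le zero_le_one]; exact Ioo_subset_Icc_self hxI) 0
      (by simp)).const_add (f 0)
    refine h2.congr_of_eventuallyEq ?_
    filter_upwards [Ioo_mem_nhds hxI.1 hxI.2] with y hy using h y (Ioo_subset_Icc_self hy)

/-! ### Sobolev jets consist of absolutely continuous functions -/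

theorem IsTestFun.hasACDeriv {ψ : ℝ → ℝ} (h : IsTestFun (Ioo 0 1) ψ) :
    HasACDeriv ψ (deriv ψ) :=
  .of_hasDerivAt h.smooth.continuous.continuousOn
    (h.smooth.continuous_deriv (by simp)).continuousOn
    fun x _ => (h.smooth.differentiable (by simp) x).hasDerivAt

theorem IsTestFun.eq_zero {E : Type*} [NormedAddCommGroup E] [NormedSpace ℝ E] {U : Set E}
    {ψ : E → ℝ} (h : IsTestFun U ψ) {x : E} (hx : x ∉ U) : ψ x = 0 :=
  image_eq_zero_of_notMem_tsupport fun h' => hx (h.supp h')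

/-- A test function on `(0,1)` of zero mean is the derivative of a test function. -/
theorem IsTestFun.exists_primitive {η : ℝ → ℝ} (h : IsTestFun (Ioo 0 1) η)
    (h0 : ∫ x, η x = 0) : ∃ ψ, IsTestFun (Ioo 0 1) ψ ∧ deriv ψ = η := by
  have hc := h.smooth.continuous
  have hd : ∀ x, HasDerivAt (fun x => ∫ y in (0 : ℝ)..x, η y) (η x) x := fun x =>
    intervalIntegral.integral_hasDerivAt_right (hc.intervalIntegrable _ _)
      hc.stronglyMeasurable.stronglyMeasurableAtFilter hc.continuousAt
  have hde : deriv (fun x => ∫ y in (0 : ℝ)..x, η y) = η := funext fun x => (hd x).deriv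
  -- the primitive vanishes off any interval that contains the support of `η`
  obtain ⟨a, b, ha, hb, hab⟩ : ∃ a b : ℝ, 0 < a ∧ b < 1 ∧ tsupport η ⊆ Icc a b := by
    have hK : IsCompact (tsupport η) := h.compact
    rcases (tsupport η).eq_empty_or_nonempty with he | hne
    · exact ⟨1, 0, one_pos, one_pos, by simp [he]⟩
    · obtain ⟨a, ha, ha'⟩ := hK.exists_isLeast hne
      obtain ⟨b, hb, hb'⟩ := hK.exists_isGreatest hne
      exact ⟨a, b, (h.supp ha).1, (h.supp hb).2, fun x hx => ⟨ha' hx, hb' hx⟩⟩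
  have hz : ∀ x, x ∉ Icc a b → η x = 0 := fun x hx =>
    image_eq_zero_of_notMem_tsupport fun h' => hx (hab h')
  have hψ : ∀ x, x ∉ Icc a b → ∫ y in (0 : ℝ)..x, η y = 0 := by
    intro x hx
    rw [mem_Icc, not_and_or, not_le, not_le] at hx
    rcases hx with hx | hx
    · rw [intervalIntegral.integral_congr (g := fun _ => (0 : ℝ))]
      · simp
      · intro y hy
        refine hz y fun hy' => ?_
        have := hy.2
        rcases le_total 0 x with h1 | h1
        · rw [max_eq_right h1] at this; linarith [hy'.1]
        · rw [max_eq_left h1] at this; linarith [hy'.1]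
    · rcases lt_or_ge x 0 with hx0 | hx0
      · rw [intervalIntegral.integral_congr (g := fun _ => (0 : ℝ))]
        · simp
        · intro y hy
          refine hz y fun hy' => ?_
          have := hy.2
          rw [max_eq_left hx0.le] at this; linarith [hy'.1]
      · rw [intervalIntegral.integral_of_le hx0, ← h0]
        refine setIntegral_eq_integral_of_forall_compl_eq_zero fun y hy => hz y fun hy' => hy ?_
        exact ⟨by linarith [hy'.1], by linarith [hy'.2]⟩
  have hts : tsupport (fun x => ∫ y in (0 : ℝ)..x, η y) ⊆ Icc a b :=
    closure_minimal (fun x hx => by_contra fun h' => hx (hψ x h')) isClosed_Icc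
  refine ⟨fun x => ∫ y in (0 : ℝ)..x, η y, ⟨?_, ?_, ?_⟩, hde⟩
  · have h1 : ContDiff ℝ (((⊤ : ℕ∞) : WithTop ℕ∞)) (fun x => ∫ y in (0 : ℝ)..x, η y) := by
      rw [contDiff_infty_iff_deriv]
      exact ⟨fun x => (hd x).differentiableAt, by rw [hde]; exact h.smooth⟩
    exact h1
  · exact HasCompactSupport.of_support_subset_isCompact isCompact_Icc
      ((subset_tsupport _).trans hts)
  · exact hts.trans fun x hx => ⟨ha.trans_le hx.1, hx.2.trans_lt hb⟩

/-- The lemma of du Bois-Reymond: a function whose weak derivative vanishes is constant. -/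
theorem ae_eq_const_of_weakDeriv_zero {u : ℝ → ℝ} (hu : IntegrableOn u (Ioo 0 1))
    (h : ∀ ψ : ℝ → ℝ, IsTestFun (Ioo 0 1) ψ → ∫ x in Ioo (0 : ℝ) 1, u x * deriv ψ x = 0) :
    ∃ c : ℝ, ∀ᵐ x ∂volume.restrict (Ioo (0 : ℝ) 1), u x = c := by
  let B : ContDiffBump (1 / 2 : ℝ) := ⟨1 / 8, 1 / 4, by norm_num, by norm_num⟩
  let η₀ : ℝ → ℝ := B.normed volume
  have hη₀ : IsTestFun (Ioo 0 1) η₀ := by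
    refine ⟨B.contDiff_normed, B.hasCompactSupport_normed, ?_⟩
    rw [B.tsupport_normed_eq, Real.closedBall_eq_Icc]
    intro x hx
    have h1 : (1 / 2 : ℝ) - 1 / 4 ≤ x := hx.1
    have h2 : x ≤ (1 / 2 : ℝ) + 1 / 4 := hx.2
    exact ⟨by linarith, by linarith⟩
  have hint : ∫ x, η₀ x = 1 := B.integral_normed
  have hmul : ∀ η : ℝ → ℝ, IsTestFun (Ioo 0 1) η →
      IntegrableOn (fun x => u x * η x) (Ioo 0 1) := by
    intro η hη
    obtain ⟨C, hC⟩ := hη.compact.exists_bound_of_continuous hη.smooth.continuous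
    exact hu.mul_bdd (c := C) hη.smooth.continuous.aestronglyMeasurable
      (Filter.Eventually.of_forall hC)
  let c : ℝ := ∫ x in Ioo (0 : ℝ) 1, u x * η₀ x
  refine ⟨c, ?_⟩
  have key : ∀ η : ℝ → ℝ, IsTestFun (Ioo 0 1) η →
      ∫ x in Ioo (0 : ℝ) 1, u x * η x = c * ∫ x, η x := by
    intro η hη
    let m : ℝ := ∫ x, η x
    have hi1 : Integrable η := hη.smooth.continuous.integrable_of_hasCompactSupport hη.compact
    have hi0 : Integrable η₀ := hη₀.smooth.continuous.integrable_of_hasCompactSupport hη₀.compact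
    have ht : IsTestFun (Ioo 0 1) (fun x => η x - m * η₀ x) := by
      refine ⟨hη.smooth.sub (contDiff_const.mul hη₀.smooth),
        hη.compact.sub hη₀.compact.mul_left, ?_⟩
      refine (tsupport_sub _ _).trans (union_subset hη.supp ?_)
      exact (tsupport_mul_subset_right).trans hη₀.supp
    obtain ⟨ψ, hψ, hd⟩ := ht.exists_primitive (by
      rw [integral_sub hi1 (hi0.const_mul m), integral_const_mul, hint]; simp [m])
    have h1 := h ψ hψ
    rw [hd] at h1
    have h2 : ∫ x in Ioo (0 : ℝ) 1, u x * (η x - m * η₀ x)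
        = (∫ x in Ioo (0 : ℝ) 1, u x * η x) - m * c := by
      rw [← integral_const_mul, ← integral_sub (hmul η hη) ((hmul η₀ hη₀).const_mul m)]
      exact integral_congr_ae (Filter.Eventually.of_forall fun x => by ring)
    rw [h2] at h1
    rw [mul_comm c]
    linarith
  have hloc : LocallyIntegrableOn (fun x => u x - c) (Ioo 0 1) :=
    (hu.sub (integrable_const c)).locallyIntegrableOn
  have := isOpen_Ioo.ae_eq_zero_of_integral_contDiff_smul_eq_zero hloc (fun η h1 h2 h3 => by
    have hη : IsTestFun (Ioo 0 1) η := ⟨h1, h2, h3⟩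
    have hi1 : Integrable η := hη.smooth.continuous.integrable_of_hasCompactSupport hη.compact
    rw [← setIntegral_eq_integral_of_forall_compl_eq_zero (s := Ioo 0 1)
      (fun x hx => by rw [hη.eq_zero hx, zero_smul])]
    have e : ∫ x in Ioo (0 : ℝ) 1, η x • (u x - c)
        = (∫ x in Ioo (0 : ℝ) 1, u x * η x) - c * ∫ x in Ioo (0 : ℝ) 1, η x := by
      rw [← integral_const_mul, ← integral_sub (hmul η hη) (hi1.integrableOn.const_mul c)]
      exact integral_congr_ae (Filter.Eventually.of_forall fun x => by simp; ring)
    rw [e, key η hη, setIntegral_eq_integral_of_forall_compl_eq_zero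
      (fun x hx => hη.eq_zero hx)]
    ring)
  rw [ae_restrict_iff' measurableSet_Ioo]
  filter_upwards [this] with x hx hxI
  linarith [hx hxI]

/-- A continuous function with an integrable weak derivative is absolutely continuous. -/
theorem HasWeakDeriv.hasACDeriv {f g : ℝ → ℝ} (h : HasWeakDeriv f g)
    (hf : ContinuousOn f (Icc 0 1)) (hg : IntegrableOn g (Ioo 0 1)) : HasACDeriv f g := by
  let G : ℝ → ℝ := fun x => ∫ y in (0 : ℝ)..x, g y
  have hG : HasACDeriv G g := by
    refine hasACDeriv_of_eq_integral hg fun x _ => ?_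
    simp [G]
  have hfi : IntegrableOn f (Ioo 0 1) :=
    (hf.integrableOn_compact isCompact_Icc).mono_set Ioo_subset_Icc_self
  have hGi : IntegrableOn G (Ioo 0 1) :=
    (hG.continuousOn.integrableOn_compact isCompact_Icc).mono_set Ioo_subset_Icc_self
  have hmul : ∀ (u : ℝ → ℝ), IntegrableOn u (Ioo 0 1) → ∀ η : ℝ → ℝ, Continuous η →
      HasCompactSupport η → IntegrableOn (fun x => u x * η x) (Ioo 0 1) := by
    intro u hu η h1 h2
    obtain ⟨C, hC⟩ := h2.exists_bound_of_continuous h1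
    exact hu.mul_bdd (c := C) h1.aestronglyMeasurable (Filter.Eventually.of_forall hC)
  obtain ⟨c, hc⟩ := ae_eq_const_of_weakDeriv_zero (hfi.sub hGi) (fun ψ hψ => by
    have hψc := hψ.smooth.continuous_deriv (by simp)
    have e1 := h ψ hψ
    have e2 := (hG.mul hψ.hasACDeriv).integral_eq
    rw [hψ.eq_zero (by simp), hψ.eq_zero (by simp), integral_add (hmul g hg ψ
      hψ.smooth.continuous hψ.compact) (hmul G hGi _ hψc hψ.compact.deriv)] at e2
    have e3 : ∫ x in Ioo (0 : ℝ) 1, (f - G) x * deriv ψ x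
        = (∫ x in Ioo (0 : ℝ) 1, f x * deriv ψ x) - ∫ x in Ioo (0 : ℝ) 1, G x * deriv ψ x := by
      rw [← integral_sub (hmul f hfi _ hψc hψ.compact.deriv) (hmul G hGi _ hψc hψ.compact.deriv)]
      exact integral_congr_ae (Filter.Eventually.of_forall fun x => by simp; ring)
    rw [e3, e1]
    linarith)
  have hEq : EqOn (fun x => f x - G x) (fun _ => c) (Icc 0 1) := by
    have h1 : EqOn (fun x => f x - G x) (fun _ => c) (Ioo 0 1) := by
      refine Measure.eqOn_open_of_ae_eq hc isOpen_Ioo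
        ((hf.sub hG.continuousOn).mono Ioo_subset_Icc_self) continuousOn_const
    have h2 := h1.of_subset_closure (hf.sub hG.continuousOn) continuousOn_const
      Ioo_subset_Icc_self (by rw [closure_Ioo (by norm_num)])
    exact h2
  refine hasACDeriv_of_eq_integral hg fun x hx => ?_
  have h1 : f x - G x = c := hEq hx
  have h2 : f 0 - G 0 = c := hEq (by simp)
  have h3 : G 0 = 0 := by simp [G]
  have h4 : G x = ∫ y in (0 : ℝ)..x, g y := rfl
  linarith

theorem IsSobolevJet.hasACDeriv {k : ℕ} {D : ℕ → ℝ → ℝ} (h : IsSobolevJet k D) {j : ℕ}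
    (hj : j < k) : HasACDeriv (D j) (D (j + 1)) :=
  (h.weak j hj).hasACDeriv (h.cont j hj) ((h.memLp (j + 1) hj).integrable one_le_two)

theorem HasACDeriv.hasDerivAt {f f' : ℝ → ℝ} (h : HasACDeriv f f')
    (hc : ContinuousOn f' (Icc 0 1)) {x : ℝ} (hx : x ∈ Ioo (0 : ℝ) 1) :
    HasDerivAt f (f' x) x := by
  have hi : ∀ y ∈ Icc (0 : ℝ) 1, f y = f 0 + ∫ z in (0 : ℝ)..y, f' z := by
    intro y hy
    have h1 := (h.ac.mono (c := 0) (d := y) (by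
      rw [uIcc_of_le hy.1, uIcc_of_le zero_le_one]
      exact Icc_subset_Icc_right hy.2)).integral_deriv_eq_sub
    have h2 : ∫ z in (0 : ℝ)..y, deriv f z = ∫ z in (0 : ℝ)..y, f' z := by
      rw [intervalIntegral.integral_of_le hy.1, intervalIntegral.integral_of_le hy.1,
        integral_Ioc_eq_integral_Ioo, integral_Ioc_eq_integral_Ioo]
      exact integral_congr_ae (ae_restrict_of_ae_restrict_of_subset
        (Ioo_subset_Ioo_right hy.2) h.deriv_ae_eq)
    linarith
  have hca : ContinuousAt f' x := hc.continuousAt (Icc_mem_nhds hx.1 hx.2)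
  have hd : HasDerivAt (fun y => ∫ z in (0 : ℝ)..y, f' z) (f' x) x := by
    refine intervalIntegral.integral_hasDerivAt_right ?_ ?_ hca
    · refine (hc.mono ?_).intervalIntegrable
      rw [uIcc_of_le hx.1.le]
      exact Icc_subset_Icc_right hx.2.le
    · exact (hc.mono Ioo_subset_Icc_self).stronglyMeasurableAtFilter isOpen_Ioo x hx
  refine (hd.const_add (f 0)).congr_of_eventuallyEq ?_
  filter_upwards [Ioo_mem_nhds hx.1 hx.2] with y hy using hi y (Ioo_subset_Icc_self hy)

/-! ### Translations in time on `L²(ℝ²)` -/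

theorem measurePreserving_timeShift (h : ℝ) :
    MeasurePreserving (fun p : ℝ × ℝ => p + (h, 0)) volume volume :=
  measurePreserving_add_right volume (h, (0 : ℝ))

/-- The translation by `h` in time, as an operator on `L²(ℝ²)`. -/
def timeShift (h : ℝ) (f : Lp ℝ 2 (volume : Measure (ℝ × ℝ))) :
    Lp ℝ 2 (volume : Measure (ℝ × ℝ)) :=
  Lp.compMeasurePreserving _ (measurePreserving_timeShift h) f

theorem continuous_timeShift (f : Lp ℝ 2 (volume : Measure (ℝ × ℝ))) :
    Continuous fun h => timeShift h f := by
  let G : C(ℝ × (ℝ × ℝ), ℝ × ℝ) := ⟨fun q => q.2 + (q.1, 0), by fun_prop⟩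
  have hG : ∀ h, MeasurePreserving (G.curry h) (volume : Measure (ℝ × ℝ)) volume :=
    measurePreserving_timeShift
  exact Continuous.compMeasurePreservingLp (f := fun _ : ℝ => f) (g := fun h => G.curry h)
    continuous_const G.curry.continuous hG (by simp)

theorem coeFn_timeShift (h : ℝ) {f : ℝ × ℝ → ℝ} (hf : MemLp f 2) :
    timeShift h (hf.toLp f) =ᵐ[volume] fun p => f (p + (h, 0)) := by
  have h1 := Lp.coeFn_compMeasurePreserving (hf.toLp f) (measurePreserving_timeShift h)
  have h2 := (measurePreserving_timeShift h).quasiMeasurePreserving.ae_eq_comp hf.coeFn_toLp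
  exact h1.trans h2

theorem MeasureTheory.MemLp.comp_timeShift {f : ℝ × ℝ → ℝ} (hf : MemLp f 2) (h : ℝ) :
    MemLp (fun p => f (p + (h, 0))) 2 :=
  hf.comp_measurePreserving (measurePreserving_timeShift h)

theorem integral_timeShift (h : ℝ) (f : ℝ × ℝ → ℝ) :
    ∫ p : ℝ × ℝ, f (p + (h, 0)) = ∫ p, f p :=
  integral_add_right_eq_self f (h, (0 : ℝ))

theorem inner_timeShift (h : ℝ) {f g : ℝ × ℝ → ℝ} (hf : MemLp f 2) (hg : MemLp g 2) :
    inner ℝ (timeShift h (hf.toLp f)) (hg.toLp g) = ∫ p : ℝ × ℝ, f (p + (h, 0)) * g p := by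
  rw [L2.inner_def]
  refine integral_congr_ae ?_
  filter_upwards [coeFn_timeShift h hf, hg.coeFn_toLp] with p h1 h2
  simp [h1, h2, mul_comm]

theorem continuous_integral_timeShift {f g : ℝ × ℝ → ℝ} (hf : MemLp f 2) (hg : MemLp g 2) :
    Continuous fun h : ℝ => ∫ p : ℝ × ℝ, f (p + (h, 0)) * g p := by
  simp_rw [← inner_timeShift _ hf hg]
  exact (continuous_timeShift _).inner continuous_const

theorem timeShift_zero (f : Lp ℝ 2 (volume : Measure (ℝ × ℝ))) : timeShift 0 f = f := by
  have h := coeFn_timeShift 0 (Lp.memLp f)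
  rw [Lp.toLp_coeFn] at h
  exact Lp.ext (h.trans (Filter.Eventually.of_forall fun p => by
    simp [show ((0 : ℝ), (0 : ℝ)) = 0 from rfl]))

/-! ### The weak time derivative and difference quotients -/

theorem isOpen_QDom (T : ℝ) : IsOpen (QDom T) := isOpen_Ioo.prod isOpen_Ioo

theorem measurableSet_QDom (T : ℝ) : MeasurableSet (QDom T) := (isOpen_QDom T).measurableSet

theorem volume_QDom_lt_top (T : ℝ) : volume (QDom T) < ∞ := by
  rw [QDom, Measure.volume_eq_prod, Measure.prod_prod]
  exact ENNReal.mul_lt_top (by simp) (by simp)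

instance isFiniteMeasure_QDom (T : ℝ) : IsFiniteMeasure (volume.restrict (QDom T)) :=
  ⟨by rw [Measure.restrict_apply_univ]; exact volume_QDom_lt_top T⟩

theorem MeasureTheory.MemLp.indicator_QDom {T : ℝ} {f : ℝ × ℝ → ℝ}
    (hf : MemLp f 2 (volume.restrict (QDom T))) : MemLp ((QDom T).indicator f) 2 :=
  (memLp_indicator_iff_restrict (measurableSet_QDom T)).2 hf

theorem setIntegral_QDom_eq {T : ℝ} (f g : ℝ × ℝ → ℝ) :
    ∫ p in QDom T, f p * g p = ∫ p, (QDom T).indicator f p * g p := by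
  rw [← integral_indicator (measurableSet_QDom T)]
  congr 1
  ext p
  by_cases hp : p ∈ QDom T <;> simp [hp]

/-- The part of `Q` at distance more than `δ` from its bottom and top in time. -/
def QStrip (T δ : ℝ) : Set (ℝ × ℝ) := Ioo δ (T - δ) ×ˢ Ioo 0 1

theorem IsTestFun.comp_timeShift {T δ s : ℝ} {ψ : ℝ × ℝ → ℝ} (h : IsTestFun (QStrip T δ) ψ)
    (hs : |s| ≤ δ) : IsTestFun (QDom T) fun p => ψ (p + (-s, 0)) := by
  have hcont : Continuous fun p : ℝ × ℝ => p + (-s, 0) := by fun_prop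
  refine ⟨h.smooth.comp (contDiff_id.add contDiff_const), ?_, ?_⟩
  · exact h.compact.comp_homeomorph (Homeomorph.addRight ((-s, 0) : ℝ × ℝ))
  · intro p hp
    have h1 : p + (-s, 0) ∈ tsupport ψ := tsupport_comp_subset_preimage ψ hcont hp
    have h2 := h.supp h1
    obtain ⟨h3, h4⟩ := abs_le.1 hs
    simp only [QStrip, mem_prod, mem_Ioo, Prod.fst_add, Prod.snd_add] at h2
    simp only [QDom, mem_prod, mem_Ioo]
    refine ⟨⟨?_, ?_⟩, ?_, ?_⟩ <;> linarith [h2.1.1, h2.1.2, h2.2.1, h2.2.2]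

/-- Differences in time of a function are integrals of its weak time derivative, tested against
a smooth function. -/
theorem HasWeakDt.integral_sub_of_testFun {T δ : ℝ} {v g ψ : ℝ × ℝ → ℝ} (hv : HasWeakDt T v g)
    (hvL : MemLp v 2 (volume.restrict (QDom T))) (hgL : MemLp g 2 (volume.restrict (QDom T)))
    (hψ : IsTestFun (QStrip T δ) ψ) {h : ℝ} (hh : |h| < δ) :
    (∫ p : ℝ × ℝ, (QDom T).indicator v (p + (h, 0)) * ψ p)
        - ∫ p, (QDom T).indicator v p * ψ p
      = ∫ s in (0 : ℝ)..h, ∫ p : ℝ × ℝ, (QDom T).indicator g (p + (s, 0)) * ψ p := by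
  have hψL : MemLp ψ 2 := hψ.smooth.continuous.memLp_of_hasCompactSupport hψ.compact
  have hshift : ∀ (f : ℝ × ℝ → ℝ) (s : ℝ), ∫ p : ℝ × ℝ, f (p + (s, 0)) * ψ p
      = ∫ p : ℝ × ℝ, f p * ψ (p + (-s, 0)) := by
    intro f s
    rw [← integral_timeShift s fun p => f p * ψ (p + (-s, 0))]
    congr 1
    ext p
    congr 2
    ext <;> simp
  have hvi : Integrable ((QDom T).indicator v) :=
    (integrable_indicator_iff (measurableSet_QDom T)).2 (hvL.integrable one_le_two)
  have hdt : Continuous (dt ψ) := by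
    have := hψ.smooth.continuous_fderiv (by simp)
    exact this.clm_apply continuous_const
  have hdtc : HasCompactSupport (dt ψ) := by
    refine (hψ.compact.fderiv (𝕜 := ℝ)).comp_left (g := fun L : (ℝ × ℝ) →L[ℝ] ℝ => L (1, 0)) ?_
    simp
  obtain ⟨C, hC⟩ := hdtc.exists_bound_of_continuous hdt
  have hder : ∀ (p : ℝ × ℝ) (s : ℝ), HasDerivAt (fun s => ψ (p + (-s, 0)))
      (-dt ψ (p + (-s, 0))) s := by
    intro p s
    have h1 : HasFDerivAt ψ (fderiv ℝ ψ (p + (-s, 0))) (p + (-s, 0)) :=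
      (hψ.smooth.differentiable (by simp) _).hasFDerivAt
    have h2 : HasDerivAt (fun s : ℝ => p + (-s, (0 : ℝ))) (-1, 0) s :=
      (((hasDerivAt_id s).neg).prodMk (hasDerivAt_const s (0 : ℝ))).const_add p
    have h3 := h1.comp_hasDerivAt s h2
    have h4 : -dt ψ (p + (-s, 0)) = fderiv ℝ ψ (p + (-s, 0)) (-1, 0) := by
      rw [show ((-1 : ℝ), (0 : ℝ)) = -(1, 0) by simp, map_neg]; rfl
    rw [h4]
    exact h3
  have hF : ∀ s ∈ uIcc 0 h, HasDerivAt
      (fun s => ∫ p : ℝ × ℝ, (QDom T).indicator v p * ψ (p + (-s, 0)))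
      (∫ p : ℝ × ℝ, (QDom T).indicator g (p + (s, 0)) * ψ p) s := by
    intro s hs
    have hs' : |s| ≤ δ := by
      have := abs_sub_left_of_mem_uIcc hs
      simp only [sub_zero] at this
      linarith
    have hcψ : ∀ s : ℝ, Continuous fun p : ℝ × ℝ => ψ (p + (-s, 0)) := fun s =>
      hψ.smooth.continuous.comp (by fun_prop)
    have hbdd : ∃ C', ∀ p, ‖ψ p‖ ≤ C' := hψ.compact.exists_bound_of_continuous hψ.smooth.continuous
    obtain ⟨C', hC'⟩ := hbdd
    have key := hasDerivAt_integral_of_dominated_loc_of_deriv_le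
      (F := fun s p => (QDom T).indicator v p * ψ (p + (-s, 0)))
      (F' := fun s p => (QDom T).indicator v p * (-dt ψ (p + (-s, 0))))
      (x₀ := s) (s := univ) (bound := fun p => ‖(QDom T).indicator v p‖ * C)
      (μ := (volume : Measure (ℝ × ℝ))) Filter.univ_mem
      (Filter.Eventually.of_forall fun s => hvi.aestronglyMeasurable.mul
        (hcψ s).aestronglyMeasurable)
      (hvi.mul_bdd (c := C') (hcψ s).aestronglyMeasurable
        (Filter.Eventually.of_forall fun p => hC' _))
      (hvi.aestronglyMeasurable.mul
        (hdt.comp (by fun_prop : Continuous fun p : ℝ × ℝ => p + (-s, 0))).neg.aestronglyMeasurable)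
      (Filter.Eventually.of_forall fun p s _ => by
        rw [norm_mul, norm_neg]
        exact mul_le_mul_of_nonneg_left (hC _) (norm_nonneg _))
      (hvi.norm.mul_const C)
      (Filter.Eventually.of_forall fun p s _ => (hder p s).const_mul _)
    have hgoal := key.2
    rw [hshift]
    have ht := hψ.comp_timeShift hs'
    have h1 := hv _ ht
    have h2 : ∀ p, dt (fun p => ψ (p + (-s, 0))) p = dt ψ (p + (-s, 0)) := by
      intro p
      simp only [dt]
      rw [fderiv_comp_add_right]
    simp_rw [h2] at h1
    rw [setIntegral_QDom_eq, setIntegral_QDom_eq] at h1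
    simp_rw [mul_neg] at hgoal
    rwa [integral_neg, h1, neg_neg] at hgoal
  have hcont : Continuous fun s : ℝ => ∫ p : ℝ × ℝ, (QDom T).indicator g (p + (s, 0)) * ψ p :=
    continuous_integral_timeShift hgL.indicator_QDom hψL
  rw [intervalIntegral.integral_eq_sub_of_hasDerivAt hF (hcont.intervalIntegrable _ _), hshift]
  congr 2
  ext p
  rw [show p + (-(0 : ℝ), (0 : ℝ)) = p by ext <;> simp]

/-- Differences in time of a function are integrals of its weak time derivative. -/
theorem HasWeakDt.integral_sub {T δ : ℝ} {v g N : ℝ × ℝ → ℝ} (hv : HasWeakDt T v g)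
    (hvL : MemLp v 2 (volume.restrict (QDom T))) (hgL : MemLp g 2 (volume.restrict (QDom T)))
    (hN : MemLp N 2) (hN0 : ∀ p ∉ QStrip T δ, N p = 0) {h : ℝ} (hh : |h| < δ) :
    (∫ p : ℝ × ℝ, (QDom T).indicator v (p + (h, 0)) * N p)
        - ∫ p, (QDom T).indicator v p * N p
      = ∫ s in (0 : ℝ)..h, ∫ p : ℝ × ℝ, (QDom T).indicator g (p + (s, 0)) * N p := by
  have hv' := hvL.indicator_QDom
  have hg' := hgL.indicator_QDom
  set V := hv'.toLp
  set G := hg'.toLp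
  -- the Bochner integral of the translates makes sense in `L²`
  let u : Lp ℝ 2 (volume : Measure (ℝ × ℝ)) :=
    timeShift h V - V - ∫ s in (0 : ℝ)..h, timeShift s G
  have hinner : ∀ {ψ : ℝ × ℝ → ℝ} (hψ : MemLp ψ 2), inner ℝ u (hψ.toLp ψ)
      = (∫ p : ℝ × ℝ, (QDom T).indicator v (p + (h, (0 : ℝ))) * ψ p)
        - (∫ p, (QDom T).indicator v p * ψ p)
        - ∫ s in (0 : ℝ)..h, ∫ p : ℝ × ℝ, (QDom T).indicator g (p + (s, (0 : ℝ))) * ψ p := by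
    intro ψ hψ
    have h0 := inner_timeShift 0 hv' hψ
    rw [timeShift_zero] at h0
    simp only [show ((0 : ℝ), (0 : ℝ)) = 0 from rfl, add_zero] at h0
    rw [inner_sub_left, inner_sub_left, inner_timeShift h hv' hψ, h0]
    congr 1
    rw [real_inner_comm, ← innerSL_apply_apply ℝ,
      ← ContinuousLinearMap.intervalIntegral_comp_comm _
      ((continuous_timeShift G).intervalIntegrable _ _)]
    congr 1
    ext s
    rw [innerSL_apply_apply, real_inner_comm, inner_timeShift s hg' hψ]
  have hopen : IsOpen (QStrip T δ) := isOpen_Ioo.prod isOpen_Ioo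
  have hzero := hopen.ae_eq_zero_of_integral_contDiff_smul_eq_zero
    (((Lp.memLp u).locallyIntegrable one_le_two).locallyIntegrableOn _)
    (fun ψ h1 h2 h3 => by
      have hψ : IsTestFun (QStrip T δ) ψ := ⟨h1, h2, h3⟩
      have hψL : MemLp ψ 2 := hψ.smooth.continuous.memLp_of_hasCompactSupport hψ.compact
      have e := hinner hψL
      rw [hv.integral_sub_of_testFun hvL hgL hψ hh, sub_self, L2.inner_def] at e
      rw [← e]
      refine integral_congr_ae ?_
      filter_upwards [hψL.coeFn_toLp] with p hp
      simp [hp])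
  have e := hinner hN
  have e0 : inner ℝ u (hN.toLp N) = 0 := by
    rw [L2.inner_def]
    refine integral_eq_zero_of_ae ?_
    filter_upwards [hzero, hN.coeFn_toLp] with p h1 h2
    by_cases hp : p ∈ QStrip T δ
    · simp [h1 hp]
    · simp [h2, hN0 p hp]
  rw [e0] at e
  linarith

theorem HasWeakDt.hasDerivAt_integral_timeShift {T δ : ℝ} {v g N : ℝ × ℝ → ℝ}
    (hv : HasWeakDt T v g)
    (hvL : MemLp v 2 (volume.restrict (QDom T))) (hgL : MemLp g 2 (volume.restrict (QDom T)))
    (hN : MemLp N 2) (hN0 : ∀ p ∉ QStrip T δ, N p = 0) (hδ : 0 < δ) :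
    HasDerivAt (fun h : ℝ => ∫ p : ℝ × ℝ, (QDom T).indicator v (p + (h, 0)) * N p)
      (∫ p, (QDom T).indicator g p * N p) 0 := by
  have hc : Continuous fun s : ℝ => ∫ p : ℝ × ℝ, (QDom T).indicator g (p + (s, 0)) * N p :=
    continuous_integral_timeShift hgL.indicator_QDom hN
  have h1 := (intervalIntegral.integral_hasDerivAt_right (hc.intervalIntegrable 0 0)
    hc.stronglyMeasurable.stronglyMeasurableAtFilter hc.continuousAt).const_add
      (∫ p, (QDom T).indicator v p * N p)
  simp only [show ((0 : ℝ), (0 : ℝ)) = 0 from rfl, add_zero] at h1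
  refine h1.congr_of_eventuallyEq ?_
  filter_upwards [Metric.ball_mem_nhds (0 : ℝ) hδ] with h hh
  rw [Metric.mem_ball, dist_zero_right, Real.norm_eq_abs] at hh
  have := hv.integral_sub hvL hgL hN hN0 hh
  linarith

open Filter Topology in
/-- Only the coefficient `K` is differentiated: the translates of `f` converge in `L²`. -/
theorem tendsto_integral_diffQuot {f g K K' : ℝ × ℝ → ℝ} {M : ℝ} (hf : MemLp f 2)
    (hg : MemLp g 2) (hKm : AEStronglyMeasurable K volume)
    (hK' : ∀ t x, HasDerivAt (fun s => K (s, x)) (K' (t, x)) t)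
    (hM : ∀ q, |K' q| ≤ M) {h : ℕ → ℝ} (h0 : ∀ n, h n ≠ 0) (hlim : Tendsto h atTop (𝓝 0)) :
    Tendsto (fun n => ∫ q : ℝ × ℝ, f (q + (h n, 0)) * ((K (q + (h n, 0)) - K q) / h n * g q))
      atTop (𝓝 (∫ q, K' q * f q * g q)) := by
  set D : ℕ → ℝ × ℝ → ℝ := fun n q => (K (q + (h n, 0)) - K q) / h n with hD
  have hDm : ∀ n, AEStronglyMeasurable (D n) volume := fun n =>
    ((hKm.comp_measurePreserving (measurePreserving_timeShift (h n))).sub hKm).mul_const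
      (h n)⁻¹ |>.congr (Eventually.of_forall fun q => by simp [hD, div_eq_mul_inv])
  have hDb : ∀ n q, ‖D n q‖ ≤ M := by
    intro n q
    obtain ⟨t, x⟩ := q
    have h1 := Convex.norm_image_sub_le_of_norm_hasDerivWithin_le
      (f := fun s => K (s, x)) (f' := fun s => K' (s, x)) (C := M) (s := univ) (x := t)
      (y := t + h n) (fun s _ => (hK' s x).hasDerivWithinAt) (fun s _ => hM _) convex_univ
      (mem_univ _) (mem_univ _)
    simp only [add_sub_cancel_left] at h1
    simp only [hD, Prod.mk_add_mk, add_zero, norm_div]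
    rw [div_le_iff₀ (norm_pos_iff.2 (h0 n))]
    exact h1
  have hM0 : 0 ≤ M := (norm_nonneg _).trans (hDb 0 0)
  have hW : ∀ n, MemLp (fun q => D n q * g q) 2 := fun n =>
    MemLp.of_le_mul hg ((hDm n).mul hg.1) (Eventually.of_forall fun q => by
      rw [norm_mul]; exact mul_le_mul_of_nonneg_right (hDb n q) (norm_nonneg _))
  set P := hf.toLp f
  have hWn : ∀ n, ‖(hW n).toLp _‖ ≤ M * ‖hg.toLp g‖ := by
    intro n
    refine Lp.norm_le_mul_norm_of_ae_le_mul ?_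
    filter_upwards [(hW n).coeFn_toLp, hg.coeFn_toLp] with q h1 h2
    rw [h1, h2, norm_mul]
    exact mul_le_mul_of_nonneg_right (hDb n q) (norm_nonneg _)
  have e : ∀ n, ∫ q : ℝ × ℝ, f (q + (h n, 0)) * (D n q * g q)
      = inner ℝ (timeShift (h n) P - P) ((hW n).toLp _) + ∫ q, f q * (D n q * g q) := by
    intro n
    have e0 := inner_timeShift 0 hf (hW n)
    rw [timeShift_zero] at e0
    simp only [show ((0 : ℝ), (0 : ℝ)) = 0 from rfl, add_zero] at e0
    rw [inner_sub_left, inner_timeShift (h n) hf (hW n), e0]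
    ring
  refine Tendsto.congr (fun n => (e n).symm) ?_
  rw [← zero_add (∫ q, K' q * f q * g q)]
  refine Tendsto.add ?_ ?_
  · have h1 : Tendsto (fun n => ‖timeShift (h n) P - P‖ * (M * ‖hg.toLp g‖)) atTop (𝓝 0) := by
      have h2 := ((continuous_timeShift P).tendsto 0).comp hlim
      rw [timeShift_zero] at h2
      have h3 := ((h2.sub_const P).norm).mul_const (M * ‖hg.toLp g‖)
      simpa using h3
    refine squeeze_zero_norm (fun n => ?_) h1
    exact (norm_inner_le_norm _ _).trans (mul_le_mul_of_nonneg_left (hWn n) (norm_nonneg _))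
  · refine tendsto_integral_of_dominated_convergence (fun q => M * ‖f q * g q‖)
      (fun n => hf.1.mul (hW n).1) ((hf.integrable_mul hg).norm.const_mul M)
      (fun n => Eventually.of_forall fun q => ?_) (Eventually.of_forall fun q => ?_)
    · rw [show f q * (D n q * g q) = D n q * (f q * g q) by ring, norm_mul]
      exact mul_le_mul_of_nonneg_right (hDb n q) (norm_nonneg _)
    · obtain ⟨t, x⟩ := q
      have h1 : Tendsto (fun n => D n (t, x)) atTop (𝓝 (K' (t, x))) := by
        have h2 := (hasDerivAt_iff_tendsto_slope_zero.1 (hK' t x)).comp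
          (tendsto_nhdsWithin_iff.2 ⟨hlim, Eventually.of_forall fun n => h0 n⟩)
        refine h2.congr fun n => ?_
        simp [hD, div_eq_inv_mul]
      have h3 := (h1.mul_const (g (t, x))).const_mul (f (t, x))
      rwa [show f (t, x) * (K' (t, x) * g (t, x)) = K' (t, x) * f (t, x) * g (t, x) by ring] at h3

open Filter Topology in
/-- The energy identity: if `v` has the weak time derivative `g`, and pairing `v(s,·)` in space
with `N(t,·)` gives a symmetric bilinear form, with coefficients depending on `t`, in functions
`p i (s,·)` and `p i (t,·)`, then twice the integral of `g N` is the form with coefficients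
differentiated in time, up to the sign. Only `v` is differentiated in time, in the weak sense; no
regularity in time of the `p i` is needed. The proof pairs `v(t+h,·) - v(t-h,·)` with `N(t,·)`. -/
theorem HasWeakDt.two_mul_integral_mul_eq {ι : Type*} [Fintype ι] {T δ M : ℝ}
    {v g N : ℝ × ℝ → ℝ} {p : ι → ℝ × ℝ → ℝ} {K K' : ι → ι → ℝ × ℝ → ℝ} {G : Set ℝ}
    (hv : HasWeakDt T v g) (hvL : MemLp v 2 (volume.restrict (QDom T)))
    (hgL : MemLp g 2 (volume.restrict (QDom T))) (hN : MemLp N 2 (volume.restrict (QDom T)))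
    (hp : ∀ i, MemLp (p i) 2 (volume.restrict (QDom T))) (hδ : 0 < δ)
    (hN0 : ∀ t ∉ Ioo δ (T - δ), ∀ x, N (t, x) = 0)
    (hKm : ∀ i j, AEStronglyMeasurable (K i j) volume) (hKsymm : ∀ i j, K i j = K j i)
    (hK0 : ∀ i j, ∀ t ∉ Ioo δ (T - δ), ∀ x, K i j (t, x) = 0)
    (hKb : ∀ i j q, |K i j q| ≤ M)
    (hK' : ∀ i j t x, HasDerivAt (fun s => K i j (s, x)) (K' i j (t, x)) t)
    (hM : ∀ i j q, |K' i j q| ≤ M) (hG : ∀ᵐ t ∂volume.restrict (Ioo 0 T), t ∈ G)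
    (hpair : ∀ s ∈ G, ∀ t ∈ G, ∫ x in Ioo (0 : ℝ) 1, v (s, x) * N (t, x)
      = ∑ i, ∑ j, ∫ x in Ioo (0 : ℝ) 1, p i (s, x) * (K i j (t, x) * p j (t, x))) :
    2 * ∫ q in QDom T, g q * N q = -∑ i, ∑ j, ∫ q in QDom T, K' i j q * p i q * p j q := by
  have hQ := measurableSet_QDom T
  have hv' := hvL.indicator_QDom
  have hN' := hN.indicator_QDom
  have hp' := fun i => (hp i).indicator_QDom
  set v' := (QDom T).indicator v with hv'd
  set N' := (QDom T).indicator N with hN'd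
  set p' := fun i => (QDom T).indicator (p i) with hp'd
  have hKp : ∀ i j, MemLp (fun q => K i j q * p' j q) 2 := fun i j =>
    MemLp.of_le_mul (hp' j) ((hKm i j).mul (hp' j).1) (Eventually.of_forall fun q => by
      rw [norm_mul]; exact mul_le_mul_of_nonneg_right (hKb i j q) (norm_nonneg _))
  -- pairing the translate of `v` with `N`, slice by slice
  have hAB : ∀ h : ℝ, |h| < δ → ∫ q : ℝ × ℝ, v' (q + (h, 0)) * N' q
      = ∑ i, ∑ j, ∫ q : ℝ × ℝ, p' i (q + (h, 0)) * (K i j q * p' j q) := by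
    intro h hh
    obtain ⟨hh1, hh2⟩ := abs_lt.1 hh
    have hi1 : Integrable fun q : ℝ × ℝ => v' (q + (h, 0)) * N' q :=
      (hv'.comp_timeShift h).integrable_mul hN'
    have hi2 : ∀ i j, Integrable fun q : ℝ × ℝ => p' i (q + (h, 0)) * (K i j q * p' j q) :=
      fun i j => ((hp' i).comp_timeShift h).integrable_mul (hKp i j)
    have hfub : ∀ F : ℝ × ℝ → ℝ, Integrable F →
        ∫ q, F q = ∫ t : ℝ, ∫ x : ℝ, F (t, x) := fun F hF => by
      rw [Measure.volume_eq_prod] at hF ⊢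
      exact integral_prod F hF
    have hleft : ∀ F : ℝ × ℝ → ℝ, Integrable F → Integrable fun t : ℝ => ∫ x : ℝ, F (t, x) :=
      fun F hF => by
        rw [Measure.volume_eq_prod] at hF
        exact hF.integral_prod_left
    rw [hfub _ hi1]
    simp_rw [fun i j => hfub _ (hi2 i j)]
    simp_rw [← integral_finsetSum Finset.univ fun j _ => hleft _ (hi2 _ j)]
    rw [← integral_finsetSum Finset.univ fun i _ =>
      integrable_finsetSum Finset.univ fun j _ => hleft _ (hi2 i j)]
    have hG1 : ∀ᵐ t : ℝ, t ∈ Ioo 0 T → t ∈ G := (ae_restrict_iff' measurableSet_Ioo).1 hG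
    have hG2 : ∀ᵐ t : ℝ, t + h ∈ Ioo 0 T → t + h ∈ G :=
      (measurePreserving_add_right volume h).quasiMeasurePreserving.ae hG1
    refine integral_congr_ae ?_
    filter_upwards [hG1, hG2] with t h1 h2
    by_cases ht : t ∈ Ioo δ (T - δ)
    · have ht1 : t ∈ Ioo 0 T := ⟨by linarith [ht.1], by linarith [ht.2]⟩
      have ht2 : t + h ∈ Ioo 0 T := ⟨by linarith [ht.1], by linarith [ht.2]⟩
      have hx : ∀ (F : ℝ × ℝ → ℝ) (s x : ℝ), s ∈ Ioo 0 T →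
          (QDom T).indicator F (s, x) = (Ioo 0 1).indicator (fun x => F (s, x)) x := by
        intro F s x hs
        by_cases hx : x ∈ Ioo (0 : ℝ) 1
        · rw [indicator_of_mem hx, indicator_of_mem (show (s, x) ∈ QDom T from ⟨hs, hx⟩)]
        · rw [indicator_of_notMem hx, indicator_of_notMem fun h' : (s, x) ∈ QDom T => hx h'.2]
      have hp2 := hpair _ (h2 ht2) _ (h1 ht1)
      simp_rw [← integral_indicator (measurableSet_Ioo (a := (0 : ℝ)) (b := 1))] at hp2
      simp only [hv'd, hN'd, hp'd, Prod.mk_add_mk, add_zero, hx _ _ _ ht1, hx _ _ _ ht2]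
      convert hp2 using 1
      · refine integral_congr_ae (Eventually.of_forall fun x => ?_)
        by_cases hx : x ∈ Ioo (0 : ℝ) 1 <;> simp [hx]
      · refine Finset.sum_congr rfl fun i _ => Finset.sum_congr rfl fun j _ =>
          integral_congr_ae (Eventually.of_forall fun x => ?_)
        by_cases hx : x ∈ Ioo (0 : ℝ) 1 <;> simp [hx]
    · have e1 : ∀ x, N' (t, x) = 0 := by
        intro x
        exact indicator_apply_eq_zero.2 fun _ => hN0 t ht x
      simp [e1, hK0 _ _ t ht]
  have hA := hv.hasDerivAt_integral_timeShift hvL hgL hN' (δ := δ) (fun q hq => by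
    by_cases hqQ : q ∈ QDom T
    · rw [hN'd, indicator_of_mem hqQ]
      exact hN0 q.1 (fun h' => hq ⟨h', hqQ.2⟩) q.2
    · rw [hN'd, indicator_of_notMem hqQ]) hδ
  -- the symmetry of `K` turns the translates by `-h` into translates by `h`
  have hdiff : ∀ h : ℝ, |h| < δ → (∫ q : ℝ × ℝ, v' (q + (h, 0)) * N' q)
      - ∫ q : ℝ × ℝ, v' (q + (-h, 0)) * N' q
      = -∑ i, ∑ j, ∫ q : ℝ × ℝ, p' i (q + (h, 0)) * ((K i j (q + (h, 0)) - K i j q) * p' j q) := by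
    intro h hh
    have hshift : ∀ i j, ∫ q : ℝ × ℝ, p' i (q + (-h, 0)) * (K i j q * p' j q)
        = ∫ q : ℝ × ℝ, p' j (q + (h, 0)) * (K j i (q + (h, 0)) * p' i q) := by
      intro i j
      rw [← integral_timeShift h fun q => p' i (q + (-h, 0)) * (K i j q * p' j q)]
      congr 1
      ext q
      rw [show q + (h, 0) + (-h, 0) = q by ext <;> simp, hKsymm i j]
      ring
    have hKp2 : ∀ i j, MemLp (fun q : ℝ × ℝ => K i j (q + (h, 0)) * p' j q) 2 := fun i j =>
      MemLp.of_le_mul (hp' j) (((hKm i j).comp_measurePreserving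
        (measurePreserving_timeShift h)).mul (hp' j).1) (Eventually.of_forall fun q => by
        rw [norm_mul]; exact mul_le_mul_of_nonneg_right (hKb i j _) (norm_nonneg _))
    rw [hAB h hh, hAB (-h) (by rwa [abs_neg])]
    simp_rw [hshift]
    rw [Finset.sum_comm (f := fun i j => ∫ q : ℝ × ℝ,
      p' j (q + (h, 0)) * (K j i (q + (h, 0)) * p' i q)), ← Finset.sum_sub_distrib,
      ← Finset.sum_neg_distrib]
    refine Finset.sum_congr rfl fun i _ => ?_
    rw [← Finset.sum_sub_distrib, ← Finset.sum_neg_distrib]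
    refine Finset.sum_congr rfl fun j _ => ?_
    have hi1 : Integrable fun q : ℝ × ℝ => p' i (q + (h, 0)) * (K i j q * p' j q) :=
      ((hp' i).comp_timeShift h).integrable_mul (hKp i j)
    have hi2 : Integrable fun q : ℝ × ℝ => p' i (q + (h, 0)) * (K i j (q + (h, 0)) * p' j q) :=
      ((hp' i).comp_timeShift h).integrable_mul (hKp2 i j)
    rw [← MeasureTheory.integral_sub hi1 hi2, ← integral_neg]
    congr 1
    ext q
    ring
  let h : ℕ → ℝ := fun n => δ / 2 * (1 / ((n : ℝ) + 1))
  have hpos : ∀ n, 0 < h n := fun n => by positivity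
  have hlim : Tendsto h atTop (𝓝 0) := by
    have := (tendsto_one_div_add_atTop_nhds_zero_nat (𝕜 := ℝ)).const_mul (δ / 2)
    simpa [h] using this
  have hlt : ∀ n, |h n| < δ := fun n => by
    rw [abs_of_pos (hpos n)]
    have h1 : 1 / ((n : ℝ) + 1) ≤ 1 := by
      rw [div_le_one (by positivity)]
      linarith [n.cast_nonneg (α := ℝ)]
    have : h n ≤ δ / 2 * 1 := mul_le_mul_of_nonneg_left h1 (by positivity)
    linarith
  have hR : Tendsto (fun n => -∑ i, ∑ j, ∫ q : ℝ × ℝ, p' i (q + (h n, 0))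
      * ((K i j (q + (h n, 0)) - K i j q) / h n * p' j q)) atTop
      (𝓝 (-∑ i, ∑ j, ∫ q, K' i j q * p' i q * p' j q)) :=
    (tendsto_finsetSum _ fun i _ => tendsto_finsetSum _ fun j _ =>
      tendsto_integral_diffQuot (hp' i) (hp' j) (hKm i j) (hK' i j) (hM i j)
        (fun n => (hpos n).ne') hlim).neg
  have hL : Tendsto (fun n => (h n)⁻¹ * ((∫ q : ℝ × ℝ, v' (q + (h n, 0)) * N' q)
      - ∫ q : ℝ × ℝ, v' (q + (-h n, 0)) * N' q)) atTop
      (𝓝 (2 * ∫ q, (QDom T).indicator g q * N' q)) := by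
    have h1 := (hasDerivAt_iff_tendsto_slope_zero.1 hA).comp
      (tendsto_nhdsWithin_iff.2 ⟨hlim, Eventually.of_forall fun n => (hpos n).ne'⟩)
    have h2 := (hasDerivAt_iff_tendsto_slope_zero.1 hA).comp
      (tendsto_nhdsWithin_iff.2 ⟨by simpa using hlim.neg, Eventually.of_forall fun n =>
        neg_ne_zero.2 (hpos n).ne'⟩ : Tendsto (fun n => -h n) atTop (𝓝[≠] 0))
    have h3 := h1.add h2
    rw [← two_mul] at h3
    refine h3.congr fun n => ?_
    simp only [Function.comp_apply, zero_add, smul_eq_mul, inv_neg]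
    ring
  have hE := tendsto_nhds_unique hL (hR.congr fun n => by
    rw [hdiff (h n) (hlt n), mul_neg, Finset.mul_sum]
    congr 1
    refine Finset.sum_congr rfl fun i _ => ?_
    rw [Finset.mul_sum]
    refine Finset.sum_congr rfl fun j _ => ?_
    rw [← integral_const_mul]
    congr 1
    ext q
    have := (hpos n).ne'
    field_simp)
  have hQm : ∀ F G : ℝ × ℝ → ℝ, ∫ q, (QDom T).indicator F q * (QDom T).indicator G q
      = ∫ q in QDom T, F q * G q := by
    intro F G
    rw [← integral_indicator hQ]
    congr 1
    ext q
    by_cases hq : q ∈ QDom T <;> simp [hq]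
  rw [hN'd, hQm] at hE
  rw [hE]
  congr 1
  refine Finset.sum_congr rfl fun i _ => Finset.sum_congr rfl fun j _ => ?_
  rw [← integral_indicator hQ]
  congr 1
  ext q
  by_cases hq : q ∈ QDom T <;> simp [hp'd, hq]

/-! ### Quadratic forms with continuous coefficients -/

theorem sum_sq_le_norm_sq (z : Fin 4 → ℝ) : ∑ i, z i ^ 2 ≤ 4 * ‖z‖ ^ 2 := by
  have h : ∀ i, z i ^ 2 ≤ ‖z‖ ^ 2 := fun i => by
    rw [← sq_abs]; exact pow_le_pow_left₀ (abs_nonneg _) (norm_le_pi_norm z i) 2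
  calc ∑ i, z i ^ 2 ≤ ∑ _i : Fin 4, ‖z‖ ^ 2 := Finset.sum_le_sum fun i _ => h i
    _ = 4 * ‖z‖ ^ 2 := by simp

theorem norm_sq_le_sum_sq (z : Fin 4 → ℝ) : ‖z‖ ^ 2 ≤ ∑ i, z i ^ 2 := by
  have h0 : 0 ≤ ∑ i, z i ^ 2 := Finset.sum_nonneg fun i _ => sq_nonneg _
  rw [← Real.sqrt_le_sqrt_iff h0, Real.sqrt_sq (norm_nonneg _), pi_norm_le_iff_of_nonneg
    (Real.sqrt_nonneg _)]
  intro i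
  rw [Real.norm_eq_abs, ← Real.sqrt_sq_eq_abs]
  exact Real.sqrt_le_sqrt (Finset.single_le_sum (fun j _ => sq_nonneg (z j)) (Finset.mem_univ i))

/-- Quadratic forms with continuous coefficients are bounded on compact sets of parameters. -/
theorem exists_form_bound {Ψ : ℝ → ℝ → (Fin 4 → ℝ) → ℝ}
    (hc : Continuous fun q : ℝ × ℝ × (Fin 4 → ℝ) => Ψ q.1 q.2.1 q.2.2)
    (hh : ∀ x ε c z, Ψ x ε (c • z) = c ^ 2 * Ψ x ε z) :
    ∃ M, 0 < M ∧ ∀ x ∈ Icc (0 : ℝ) 1, ∀ ε ∈ Icc (0 : ℝ) 1, ∀ z,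
      |Ψ x ε z| ≤ M * ∑ i, z i ^ 2 := by
  obtain ⟨C, hC⟩ := ((isCompact_Icc (a := (0 : ℝ)) (b := 1)).prod
    ((isCompact_Icc (a := (0 : ℝ)) (b := 1)).prod
      (isCompact_sphere (0 : Fin 4 → ℝ) 1))).exists_bound_of_continuousOn hc.continuousOn
  refine ⟨|C| + 1, by positivity, fun x hx ε hε z => ?_⟩
  rcases eq_or_ne z 0 with rfl | hz
  · have := hh x ε 0 0
    simp at this
    simp [this]
  · have hn : ‖z‖ ≠ 0 := norm_ne_zero_iff.2 hz
    have h1 := hC (x, ε, ‖z‖⁻¹ • z) ⟨hx, hε, by simp [norm_smul, hn]⟩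
    have h2 := hh x ε ‖z‖ (‖z‖⁻¹ • z)
    rw [smul_inv_smul₀ hn] at h2
    rw [h2, abs_mul, abs_of_nonneg (sq_nonneg _), mul_comm]
    exact mul_le_mul ((h1.trans (le_abs_self C)).trans (by linarith)) (norm_sq_le_sum_sq z)
      (sq_nonneg _) (by positivity)

/-- A quadratic form that is positive definite for the parameter `ε = 0` is uniformly positive
definite for small `ε`. -/
theorem exists_form_lower_bound {Ψ : ℝ → ℝ → (Fin 4 → ℝ) → ℝ}
    (hc : Continuous fun q : ℝ × ℝ × (Fin 4 → ℝ) => Ψ q.1 q.2.1 q.2.2)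
    (hh : ∀ x ε c z, Ψ x ε (c • z) = c ^ 2 * Ψ x ε z)
    (hpos : ∀ x ∈ Icc (0 : ℝ) 1, ∀ z ≠ 0, 0 < Ψ x 0 z) :
    ∃ c, 0 < c ∧ ∃ ε₀, 0 < ε₀ ∧ ∀ x ∈ Icc (0 : ℝ) 1, ∀ ε ∈ Icc (0 : ℝ) ε₀, ∀ z,
      c * ∑ i, z i ^ 2 ≤ Ψ x ε z := by
  have hK : IsCompact (Icc (0 : ℝ) 1 ×ˢ Metric.sphere (0 : Fin 4 → ℝ) 1) :=
    isCompact_Icc.prod (isCompact_sphere _ _)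
  have hne : (Icc (0 : ℝ) 1 ×ˢ Metric.sphere (0 : Fin 4 → ℝ) 1).Nonempty :=
    (nonempty_Icc.2 zero_le_one).prod (NormedSpace.sphere_nonempty.2 zero_le_one)
  obtain ⟨q₀, hq₀, hmin⟩ := hK.exists_isMinOn hne
    (f := fun q => Ψ q.1 0 q.2) (by fun_prop)
  have hm : 0 < Ψ q₀.1 0 q₀.2 := hpos _ hq₀.1 _ fun h => by
    have := hq₀.2
    simp [h] at this
  set m := Ψ q₀.1 0 q₀.2
  have hU := (hK.prod (isCompact_Icc (a := (0 : ℝ)) (b := 1))).uniformContinuousOn_of_continuous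
    (f := fun q => Ψ q.1.1 q.2 q.1.2) (by fun_prop)
  obtain ⟨δ, hδ, H⟩ := Metric.uniformContinuousOn_iff.1 hU (m / 2) (by positivity)
  refine ⟨m / 8, by positivity, min (δ / 2) 1, by positivity, fun x hx ε hε z => ?_⟩
  rcases eq_or_ne z 0 with rfl | hz
  · have := hh x ε 0 0
    simp at this
    simp [this]
  · have hn : ‖z‖ ≠ 0 := norm_ne_zero_iff.2 hz
    have hs : ‖z‖⁻¹ • z ∈ Metric.sphere (0 : Fin 4 → ℝ) 1 := by simp [norm_smul, hn]
    have h1 := H ((x, ‖z‖⁻¹ • z), ε) ⟨⟨hx, hs⟩, hε.1, hε.2.trans (min_le_right _ _)⟩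
      ((x, ‖z‖⁻¹ • z), 0) ⟨⟨hx, hs⟩, by simp⟩ (by
        rw [Prod.dist_eq, dist_self, max_eq_right dist_nonneg, Real.dist_eq, sub_zero,
          abs_of_nonneg hε.1]
        exact (hε.2.trans (min_le_left _ _)).trans_lt (by linarith))
    have h3 : m ≤ Ψ x 0 (‖z‖⁻¹ • z) := hmin (show (x, ‖z‖⁻¹ • z) ∈ _ from ⟨hx, hs⟩)
    rw [Real.dist_eq] at h1
    have h4 : m / 2 ≤ Ψ x ε (‖z‖⁻¹ • z) := by linarith [(abs_lt.1 h1).1]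
    have h2 := hh x ε ‖z‖ (‖z‖⁻¹ • z)
    rw [smul_inv_smul₀ hn] at h2
    rw [h2]
    have h5 := mul_le_mul_of_nonneg_left h4 (sq_nonneg ‖z‖)
    have h6 := sum_sq_le_norm_sq z
    nlinarith

/-! ### The conjugated operator -/

/-- The derivatives up to order four of `w = e^{-kβ} v`, in terms of `u j = e^{-kβ} v^{(j)}` and
of the derivatives `a j = k β^{(j+1)}`. -/
def conjJet (a u : ℕ → ℝ) : ℕ → ℝ
  | 0 => u 0
  | 1 => u 1 - a 0 * u 0
  | 2 => u 2 - 2 * a 0 * u 1 + (a 0 ^ 2 - a 1) * u 0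
  | 3 => u 3 - 3 * a 0 * u 2 + (3 * a 0 ^ 2 - 3 * a 1) * u 1
      + (-a 0 ^ 3 + 3 * a 0 * a 1 - a 2) * u 0
  | 4 => u 4 - 4 * a 0 * u 3 + (6 * a 0 ^ 2 - 6 * a 1) * u 2
      + (-4 * a 0 ^ 3 + 12 * a 0 * a 1 - 4 * a 2) * u 1
      + (a 0 ^ 4 - 6 * a 0 ^ 2 * a 1 + 3 * a 1 ^ 2 + 4 * a 0 * a 2 - a 3) * u 0
  | _ => 0

/-- `e^{-kβ} (σ v'')''`, in terms of `u j = e^{-kβ} v^{(j)}` and `s j = σ^{(j)}`. -/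
def opX (s u : ℕ → ℝ) : ℝ := s 0 * u 4 + 2 * s 1 * u 3 + s 2 * u 2

/-- The `j`-th derivative, `j ≤ 2`, of `e^{2kβ} (e^{-2kβ} v)''`, multiplied by `e^{-kβ}`. -/
def conjSq (a u : ℕ → ℝ) : ℕ → ℝ
  | 0 => u 2 - 4 * a 0 * u 1 + (4 * a 0 ^ 2 - 2 * a 1) * u 0
  | 1 => u 3 - 4 * a 0 * u 2 + (4 * a 0 ^ 2 - 6 * a 1) * u 1 + (8 * a 0 * a 1 - 2 * a 2) * u 0
  | 2 => u 4 - 4 * a 0 * u 3 + (4 * a 0 ^ 2 - 10 * a 1) * u 2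
      + (16 * a 0 * a 1 - 8 * a 2) * u 1 + (8 * a 1 ^ 2 + 8 * a 0 * a 2 - 2 * a 3) * u 0
  | _ => 0

/-- `e^{kβ} (σ (e^{-2kβ} v)'')''`, the formal adjoint of the conjugated operator. -/
def opY (a s u : ℕ → ℝ) : ℝ :=
  s 0 * conjSq a u 2 + 2 * (s 1 - 2 * a 0 * s 0) * conjSq a u 1
    + (s 2 - 4 * a 0 * s 1 + (4 * a 0 ^ 2 - 2 * a 1) * s 0) * conjSq a u 0

/-- `σ v'' ∂_k (e^{-2kβ} v)''`, the derivative in `k`, for fixed `v`, of half of the quadratic form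
of the symmetric operator `v ↦ e^{-2kβ} (σ v'')'' + (σ (e^{-2kβ} v)'')''`. -/
def formH (k : ℝ) (b s u : ℕ → ℝ) : ℝ :=
  s 0 * u 2 * (-2 * b 0 * conjSq (fun j => k * b (j + 1)) u 0 - 4 * b 1 * u 1
    + (8 * k * b 1 ^ 2 - 2 * b 2) * u 0)

/-- The boundary form: the product of the principal parts of the self-adjoint and of the
skew-adjoint part of the conjugated operator is its derivative, plus a form of lower order. -/
def bdForm (a s w : ℕ → ℝ) : ℝ :=
  2 * a 0 * s 0 ^ 2 * w 3 ^ 2 + 6 * s 0 * (a 1 * s 0 + a 0 * s 1) * (w 3 * w 2)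
    + 10 * a 0 ^ 3 * s 0 ^ 2 * w 2 ^ 2 + 4 * a 0 ^ 3 * s 0 ^ 2 * (w 3 * w 1)
    + (30 * a 0 ^ 2 * a 1 * s 0 ^ 2 + 22 * a 0 ^ 3 * s 0 * s 1) * (w 2 * w 1)
    + (6 * a 0 ^ 2 * a 1 * s 0 ^ 2 + 2 * a 0 ^ 3 * s 0 * s 1) * (w 3 * w 0)
    + 10 * a 0 ^ 5 * s 0 ^ 2 * w 1 ^ 2
    + (22 * a 0 ^ 4 * a 1 * s 0 ^ 2 + 10 * a 0 ^ 5 * s 0 * s 1) * (w 1 * w 0)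
    + 4 * a 0 ^ 5 * s 0 ^ 2 * (w 2 * w 0) + 2 * a 0 ^ 7 * s 0 ^ 2 * w 0 ^ 2

/-- The derivative of `bdForm`. -/
def bdFormDeriv (a s w : ℕ → ℝ) : ℝ :=
  (2 * a 1 * s 0 ^ 2 + 4 * a 0 * s 0 * s 1) * w 3 ^ 2 + 4 * a 0 * s 0 ^ 2 * (w 3 * w 4)
    + (6 * s 1 * (a 1 * s 0 + a 0 * s 1) + 6 * s 0 * (a 2 * s 0 + 2 * a 1 * s 1 + a 0 * s 2))
      * (w 3 * w 2)
    + 6 * s 0 * (a 1 * s 0 + a 0 * s 1) * (w 4 * w 2 + w 3 * w 3)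
    + (30 * a 0 ^ 2 * a 1 * s 0 ^ 2 + 20 * a 0 ^ 3 * s 0 * s 1) * w 2 ^ 2
    + 20 * a 0 ^ 3 * s 0 ^ 2 * (w 2 * w 3)
    + (12 * a 0 ^ 2 * a 1 * s 0 ^ 2 + 8 * a 0 ^ 3 * s 0 * s 1) * (w 3 * w 1)
    + 4 * a 0 ^ 3 * s 0 ^ 2 * (w 4 * w 1 + w 3 * w 2)
    + (60 * a 0 * a 1 ^ 2 * s 0 ^ 2 + 30 * a 0 ^ 2 * a 2 * s 0 ^ 2 + 126 * a 0 ^ 2 * a 1 * s 0 * s 1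
      + 22 * a 0 ^ 3 * (s 1 ^ 2 + s 0 * s 2)) * (w 2 * w 1)
    + (30 * a 0 ^ 2 * a 1 * s 0 ^ 2 + 22 * a 0 ^ 3 * s 0 * s 1) * (w 3 * w 1 + w 2 * w 2)
    + (12 * a 0 * a 1 ^ 2 * s 0 ^ 2 + 6 * a 0 ^ 2 * a 2 * s 0 ^ 2 + 18 * a 0 ^ 2 * a 1 * s 0 * s 1
      + 2 * a 0 ^ 3 * (s 1 ^ 2 + s 0 * s 2)) * (w 3 * w 0)
    + (6 * a 0 ^ 2 * a 1 * s 0 ^ 2 + 2 * a 0 ^ 3 * s 0 * s 1) * (w 4 * w 0 + w 3 * w 1)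
    + (50 * a 0 ^ 4 * a 1 * s 0 ^ 2 + 20 * a 0 ^ 5 * s 0 * s 1) * w 1 ^ 2
    + 20 * a 0 ^ 5 * s 0 ^ 2 * (w 1 * w 2)
    + (88 * a 0 ^ 3 * a 1 ^ 2 * s 0 ^ 2 + 22 * a 0 ^ 4 * a 2 * s 0 ^ 2
      + 94 * a 0 ^ 4 * a 1 * s 0 * s 1
      + 10 * a 0 ^ 5 * (s 1 ^ 2 + s 0 * s 2)) * (w 1 * w 0)
    + (22 * a 0 ^ 4 * a 1 * s 0 ^ 2 + 10 * a 0 ^ 5 * s 0 * s 1) * (w 2 * w 0 + w 1 * w 1)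
    + (20 * a 0 ^ 4 * a 1 * s 0 ^ 2 + 8 * a 0 ^ 5 * s 0 * s 1) * (w 2 * w 0)
    + 4 * a 0 ^ 5 * s 0 ^ 2 * (w 3 * w 0 + w 2 * w 1)
    + (14 * a 0 ^ 6 * a 1 * s 0 ^ 2 + 4 * a 0 ^ 7 * s 0 * s 1) * w 0 ^ 2
    + 4 * a 0 ^ 7 * s 0 ^ 2 * (w 0 * w 1)

/-! ### Scaled forms

With `ε = k⁻¹` and `z j = k^{-j} w j`, all quantities are powers of `k` times forms in `z` whose
coefficients are polynomials in `ε` and in the derivatives of `β` and `σ`. -/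

/-- `u j = k^j * uForm j` for `j ≤ 3`. -/
def uForm (b : ℕ → ℝ) (ε : ℝ) (z : Fin 4 → ℝ) : ℕ → ℝ
  | 0 => z 0
  | 1 => z 1 + b 1 * z 0
  | 2 => z 2 + 2 * b 1 * z 1 + (b 1 ^ 2 + ε * b 2) * z 0
  | 3 => z 3 + 3 * b 1 * z 2 + 3 * (b 1 ^ 2 + ε * b 2) * z 1
      + (b 1 ^ 3 + 3 * ε * b 1 * b 2 + ε ^ 2 * b 3) * z 0
  | _ => 0

/-- The principal part of the skew-adjoint part of the conjugated operator. -/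
def skewMain (b s : ℕ → ℝ) (ε : ℝ) (z : Fin 4 → ℝ) : ℝ :=
  4 * b 1 * s 0 * z 3 + 4 * b 1 ^ 3 * s 0 * z 1
    + ε * (6 * (b 2 * s 0 + b 1 * s 1) * z 2
      + 2 * (3 * b 1 ^ 2 * b 2 * s 0 + b 1 ^ 3 * s 1) * z 0)

/-- The remainder in the skew-adjoint part of the conjugated operator. -/
def skewRest (b s : ℕ → ℝ) (ε : ℝ) (z : Fin 4 → ℝ) : ℝ :=
  (4 * b 3 * s 0 + 6 * b 2 * s 1 + 2 * b 1 * s 2) * z 1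
    + ε * (s 2 * b 2 + 2 * s 1 * b 3 + s 0 * b 4) * z 0

/-- The remainder in the self-adjoint part of the conjugated operator. -/
def symmRest (b s : ℕ → ℝ) (z : Fin 4 → ℝ) : ℝ :=
  s 2 * z 2 + (s 2 * b 1 ^ 2 + 6 * s 1 * b 1 * b 2 + 3 * s 0 * b 2 ^ 2 + 4 * s 0 * b 1 * b 3) * z 0

/-- The positive form to which the commutator reduces, up to terms of lower order. -/
def commMain (b s : ℕ → ℝ) (z : Fin 4 → ℝ) : ℝ :=
  2 * s 0 * (-4 * b 2 * s 0 - b 1 * s 1)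
    * (z 3 ^ 2 + 3 * b 1 ^ 2 * z 2 ^ 2 + 3 * b 1 ^ 4 * z 1 ^ 2 + b 1 ^ 6 * z 0 ^ 2)

/-- The terms of lower order left by the integrations by parts in the commutator. -/
def commRest (b s : ℕ → ℝ) (z : Fin 4 → ℝ) : ℝ :=
  (-6 * s 0 * (b 3 * s 0 + 2 * b 2 * s 1 + b 1 * s 2) + 6 * s 1 * (b 2 * s 0 + b 1 * s 1))
      * (z 3 * z 2)
    + (-(12 * b 1 * b 2 ^ 2 * s 0 ^ 2 + 6 * b 1 ^ 2 * b 3 * s 0 ^ 2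
        + 18 * b 1 ^ 2 * b 2 * s 0 * s 1 + 2 * b 1 ^ 3 * (s 1 ^ 2 + s 0 * s 2))
      + 4 * s 1 * (3 * b 1 ^ 2 * b 2 * s 0 + b 1 ^ 3 * s 1)) * (z 3 * z 0)
    + (-(60 * b 1 * b 2 ^ 2 * s 0 ^ 2 + 30 * b 1 ^ 2 * b 3 * s 0 ^ 2
        + 126 * b 1 ^ 2 * b 2 * s 0 * s 1 + 22 * b 1 ^ 3 * (s 1 ^ 2 + s 0 * s 2))
      + 36 * (2 * b 1 * b 2 * s 0 + b 1 ^ 2 * s 1) * (b 2 * s 0 + b 1 * s 1)) * (z 2 * z 1)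
    + (-(88 * b 1 ^ 3 * b 2 ^ 2 * s 0 ^ 2 + 22 * b 1 ^ 4 * b 3 * s 0 ^ 2
        + 94 * b 1 ^ 4 * b 2 * s 0 * s 1 + 10 * b 1 ^ 5 * (s 1 ^ 2 + s 0 * s 2))
      + 12 * (2 * b 1 * b 2 * s 0 + b 1 ^ 2 * s 1)
        * (3 * b 1 ^ 2 * b 2 * s 0 + b 1 ^ 3 * s 1)) * (z 1 * z 0)

/-- The form that bounds the commutator from below. -/
def carlemanForm (b s : ℕ → ℝ) (ε : ℝ) (z : Fin 4 → ℝ) : ℝ :=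
  2 * commMain b s z + 2 * ε * commRest b s z + 2 * ε * symmRest b s z * skewMain b s ε z
    - 2 * ε ^ 3 * skewRest b s ε z ^ 2

/-- `formH` in scaled form. -/
def formHScaled (b s : ℕ → ℝ) (ε : ℝ) (z : Fin 4 → ℝ) : ℝ :=
  s 0 * uForm b ε z 2 * (-2 * b 0 * (uForm b ε z 2 - 4 * b 1 * uForm b ε z 1
    + (4 * b 1 ^ 2 - 2 * ε * b 2) * uForm b ε z 0) - 4 * ε * b 1 * uForm b ε z 1
    + (8 * ε * b 1 ^ 2 - 2 * ε ^ 2 * b 2) * uForm b ε z 0)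

/-- The scaled derivatives `z j = k^{-j} w j`. -/
def scaledJet (k : ℝ) (b u : ℕ → ℝ) (j : Fin 4) : ℝ :=
  conjJet (fun j => k * b (j + 1)) u j / k ^ (j : ℕ)

section Algebra

variable {k : ℝ} (b s u : ℕ → ℝ)

theorem eq_pow_mul_uForm (hk : k ≠ 0) {j : ℕ} (hj : j < 4) :
    u j = k ^ j * uForm b k⁻¹ (scaledJet k b u) j := by
  interval_cases j <;> simp [uForm, scaledJet, conjJet] <;> field_simp <;> ring

theorem formH_eq (hk : k ≠ 0) :
    formH k b s u = k ^ 4 * formHScaled b s k⁻¹ (scaledJet k b u) := by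
  have h0 := eq_pow_mul_uForm b u hk (j := 0) (by norm_num)
  have h1 := eq_pow_mul_uForm b u hk (j := 1) (by norm_num)
  have h2 := eq_pow_mul_uForm b u hk (j := 2) (by norm_num)
  simp only [formH, conjSq, formHScaled]
  rw [h0, h1, h2]
  field_simp

theorem skew_eq (hk : k ≠ 0) :
    (opX s u - opY (fun j => k * b (j + 1)) s u) / 2
      = k ^ 4 * (skewMain b s k⁻¹ (scaledJet k b u)
        + k⁻¹ ^ 2 * skewRest b s k⁻¹ (scaledJet k b u)) := by
  simp [opX, opY, conjSq, skewMain, skewRest, scaledJet, conjJet]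
  field_simp
  ring

theorem symm_eq (hk : k ≠ 0) (a w : ℕ → ℝ) (ha : a = fun j => k * b (j + 1))
    (hw : w = conjJet a u) :
    (opX s u + opY a s u) / 2 = s 0 * w 4 + 2 * s 1 * w 3 + 6 * a 0 ^ 2 * s 0 * w 2
      + (12 * a 0 * a 1 * s 0 + 6 * a 0 ^ 2 * s 1) * w 1 + a 0 ^ 4 * s 0 * w 0
      + k ^ 2 * symmRest b s (scaledJet k b u) := by
  subst ha hw
  simp [opX, opY, conjSq, symmRest, scaledJet, conjJet]
  field_simp
  ring

/-- The product of the principal parts of the self-adjoint and of the skew-adjoint part is a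
derivative plus a diagonal form, up to lower order. The weight conditions enter only as the
positivity of that diagonal form. -/
theorem main_mul_eq (hk : k ≠ 0) (a w : ℕ → ℝ) (ha : a = fun j => k * b (j + 1))
    (hw : ∀ j : Fin 4, w j = k ^ (j : ℕ) * scaledJet k b u j) :
    (s 0 * w 4 + 2 * s 1 * w 3 + 6 * a 0 ^ 2 * s 0 * w 2
      + (12 * a 0 * a 1 * s 0 + 6 * a 0 ^ 2 * s 1) * w 1 + a 0 ^ 4 * s 0 * w 0)
      * (k ^ 4 * skewMain b s k⁻¹ (scaledJet k b u))
    = bdFormDeriv a s w + k ^ 7 * (commMain b s (scaledJet k b u)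
      + k⁻¹ * commRest b s (scaledJet k b u)) := by
  have h0 := hw 0
  have h1 := hw 1
  have h2 := hw 2
  have h3 := hw 3
  generalize scaledJet k b u = z at *
  simp at h0 h1 h2 h3
  subst ha
  simp only [bdFormDeriv, skewMain, commMain, commRest]
  rw [h0, h1, h2, h3]
  field_simp
  ring

/-- The pointwise Carleman inequality: up to a derivative, the cross term of the self-adjoint and
the skew-adjoint part of the conjugated operator dominates a positive form. -/
theorem carleman_pointwise (hk : 0 < k) (a : ℕ → ℝ) (ha : a = fun j => k * b (j + 1)) (P₁ P₂ : ℝ)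
    (hP₁ : P₁ = (opX s u + opY a s u) / 2) (hP₂ : P₂ = (opX s u - opY a s u) / 2) :
    P₁ ^ 2 / 2 + 2 * bdFormDeriv a s (conjJet a u)
        + k ^ 7 * carlemanForm b s k⁻¹ (scaledJet k b u) ≤ P₁ ^ 2 + 2 * P₁ * P₂ := by
  have hk0 := hk.ne'
  have hw : ∀ j : Fin 4, conjJet a u j = k ^ (j : ℕ) * scaledJet k b u j := by
    intro j
    subst ha
    rw [scaledJet]
    field_simp
  have e1 := symm_eq b s u hk0 a _ ha rfl
  have e2 := skew_eq b s u hk0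
  rw [← ha] at e2
  have e3 := main_mul_eq b s u hk0 a (conjJet a u) ha hw
  rw [← hP₁] at e1
  rw [← hP₂] at e2
  set z := scaledJet k b u
  set Q₁ := s 0 * conjJet a u 4 + 2 * s 1 * conjJet a u 3 + 6 * a 0 ^ 2 * s 0 * conjJet a u 2
      + (12 * a 0 * a 1 * s 0 + 6 * a 0 ^ 2 * s 1) * conjJet a u 1 + a 0 ^ 4 * s 0 * conjJet a u 0
  have e4 : k ^ 7 * carlemanForm b s k⁻¹ z
      = 2 * (k ^ 7 * (commMain b s z + k⁻¹ * commRest b s z))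
        + 2 * (k ^ 2 * symmRest b s z * (k ^ 4 * skewMain b s k⁻¹ z))
        - 2 * (k ^ 4 * (k⁻¹ ^ 2 * skewRest b s k⁻¹ z)) ^ 2 := by
    rw [carlemanForm]
    field_simp
  have e5 : P₂ = k ^ 4 * skewMain b s k⁻¹ z + k ^ 4 * (k⁻¹ ^ 2 * skewRest b s k⁻¹ z) := by
    rw [e2]; ring
  set S := k ^ 4 * skewMain b s k⁻¹ z
  set R := k ^ 4 * (k⁻¹ ^ 2 * skewRest b s k⁻¹ z)
  rw [e4, e5]
  have e6 : P₁ * S = bdFormDeriv a s (conjJet a u)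
      + k ^ 7 * (commMain b s z + k⁻¹ * commRest b s z) + k ^ 2 * symmRest b s z * S := by
    rw [e1, add_mul, e3]
  -- the remainder of the skew-adjoint part is absorbed by half of `P₁ ^ 2`
  nlinarith [sq_nonneg (P₁ + 2 * R)]

end Algebra

/-! ### The Carleman inequality on a time slice -/

/-- The derivatives `b j = β^{(j)}` and `s j = σ^{(j)}` on `[0,1]`, extended continuously to the
line, with the sign conditions that make the commutator positive. -/
structure CarlemanData (b s : ℕ → ℝ → ℝ) : Prop where
  cont_b : ∀ j, Continuous (b j)
  cont_s : ∀ j, Continuous (s j)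
  deriv_b : ∀ j < 4, ∀ x ∈ Ioo (0 : ℝ) 1, HasDerivAt (b j) (b (j + 1) x) x
  deriv_s : ∀ j < 2, ∀ x ∈ Ioo (0 : ℝ) 1, HasDerivAt (s j) (s (j + 1) x) x
  b_zero_pos : ∀ x ∈ Icc (0 : ℝ) 1, 0 < b 0 x
  b_one_pos : ∀ x ∈ Icc (0 : ℝ) 1, 0 < b 1 x
  s_pos : ∀ x ∈ Icc (0 : ℝ) 1, 0 < s 0 x
  comm_pos : ∀ x ∈ Icc (0 : ℝ) 1, 0 < -4 * b 2 x * s 0 x - b 1 x * s 1 x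

/-- The functions `a j = k β^{(j+1)}`, at a point. -/
def coefA (b : ℕ → ℝ → ℝ) (k x : ℝ) (j : ℕ) : ℝ := k * b (j + 1) x

/-- The weighted derivatives `e^{-kβ} v^{(j)}`, at a point. -/
def weightedJet (b : ℕ → ℝ → ℝ) (k : ℝ) (v : ℕ → ℝ → ℝ) (x : ℝ) (j : ℕ) : ℝ :=
  Real.exp (-k * b 0 x) * v j x

theorem HasACDeriv.of_eq {f f' g g' : ℝ → ℝ} (h : HasACDeriv f f') (hf : ∀ x, g x = f x)
    (hf' : ∀ x, g' x = f' x) : HasACDeriv g g' := by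
  obtain rfl : g = f := funext hf
  obtain rfl : g' = f' := funext hf'
  exact h

namespace CarlemanData

variable {b s v : ℕ → ℝ → ℝ} {k : ℝ}

theorem hasACDeriv_b (D : CarlemanData b s) {j : ℕ} (hj : j < 4) :
    HasACDeriv (b j) (b (j + 1)) :=
  .of_hasDerivAt (D.cont_b j).continuousOn (D.cont_b (j + 1)).continuousOn (D.deriv_b j hj)

theorem hasACDeriv_s (D : CarlemanData b s) {j : ℕ} (hj : j < 2) :
    HasACDeriv (s j) (s (j + 1)) :=
  .of_hasDerivAt (D.cont_s j).continuousOn (D.cont_s (j + 1)).continuousOn (D.deriv_s j hj)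

theorem hasACDeriv_coefA (D : CarlemanData b s) (k : ℝ) {j : ℕ} (hj : j < 3) :
    HasACDeriv (fun x => coefA b k x j) (fun x => coefA b k x (j + 1)) :=
  (D.hasACDeriv_b (by omega : j + 1 < 4)).const_mul k

theorem hasACDeriv_weightedJet (D : CarlemanData b s) (k : ℝ) {n : ℕ} (hv : IsSobolevJet n v)
    {j : ℕ} (hj : j < n) : HasACDeriv (fun x => weightedJet b k v x j)
      (fun x => weightedJet b k v x (j + 1) - coefA b k x 0 * weightedJet b k v x j) := by
  have hE : HasACDeriv (fun x => Real.exp (-k * b 0 x))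
      (fun x => Real.exp (-k * b 0 x) * (-k * b 1 x)) := by
    have h0 := D.cont_b 0
    have h1 := D.cont_b 1
    exact .of_hasDerivAt (by fun_prop) (by fun_prop)
      fun x hx => ((D.deriv_b 0 (by norm_num) x hx).const_mul (-k)).exp
  refine (hE.mul (hv.hasACDeriv hj)).of_eq (fun x => rfl) fun x => ?_
  simp only [weightedJet, coefA]
  ring

theorem hasACDeriv_conjJet (D : CarlemanData b s) (k : ℝ) (hv : IsSobolevJet 4 v) {j : ℕ}
    (hj : j < 4) :
    HasACDeriv (fun x => conjJet (coefA b k x) (weightedJet b k v x) j)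
      (fun x => conjJet (coefA b k x) (weightedJet b k v x) (j + 1)) := by
  have a0 := D.hasACDeriv_coefA k (j := 0) (by norm_num)
  have a1 := D.hasACDeriv_coefA k (j := 1) (by norm_num)
  have a2 := D.hasACDeriv_coefA k (j := 2) (by norm_num)
  have u0 := D.hasACDeriv_weightedJet k hv (j := 0) (by norm_num)
  have u1 := D.hasACDeriv_weightedJet k hv (j := 1) (by norm_num)
  have u2 := D.hasACDeriv_weightedJet k hv (j := 2) (by norm_num)
  have u3 := D.hasACDeriv_weightedJet k hv (j := 3) (by norm_num)
  interval_cases j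
  · exact u0
  · exact (u1.sub (a0.mul u0)).of_eq (fun x => by simp only [conjJet])
      fun x => by simp only [conjJet]; ring
  · exact ((u2.sub ((a0.mul u1).const_mul 2)).add (((a0.mul a0).sub a1).mul u0)).of_eq
      (fun x => by simp only [conjJet]; ring) fun x => by simp only [conjJet]; ring
  · exact (((u3.sub ((a0.mul u2).const_mul 3)).add
      ((((a0.mul a0).sub a1).const_mul 3).mul u1)).add
      (((((a0.mul a1).const_mul 3).sub (a0.mul (a0.mul a0))).sub a2).mul u0)).of_eq
      (fun x => by simp only [conjJet]; ring) fun x => by simp only [conjJet]; ring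

theorem hasACDeriv_bdForm (D : CarlemanData b s) (k : ℝ) {w : ℕ → ℝ → ℝ}
    (hw : ∀ j < 4, HasACDeriv (w j) (w (j + 1))) :
    HasACDeriv (fun x => bdForm (coefA b k x) (fun j => s j x) (fun j => w j x))
      (fun x => bdFormDeriv (coefA b k x) (fun j => s j x) (fun j => w j x)) := by
  have a0 := D.hasACDeriv_coefA k (j := 0) (by norm_num)
  have a1 := D.hasACDeriv_coefA k (j := 1) (by norm_num)
  have s0 := D.hasACDeriv_s (j := 0) (by norm_num)
  have s1 := D.hasACDeriv_s (j := 1) (by norm_num)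
  have w0 := hw 0 (by norm_num)
  have w1 := hw 1 (by norm_num)
  have w2 := hw 2 (by norm_num)
  have w3 := hw 3 (by norm_num)
  have ss := s0.mul s0
  have aa := a0.mul a0
  have a3 := aa.mul a0
  have a5 := a3.mul aa
  have p3 := (aa.mul a1).mul ss
  have q3 := a3.mul (s0.mul s1)
  have p5 := aa.mul p3
  have q5 := aa.mul q3
  have t1 := ((a0.mul ss).const_mul 2).mul (w3.mul w3)
  have t2 := ((s0.mul ((a1.mul s0).add (a0.mul s1))).const_mul 6).mul (w3.mul w2)
  have t3 := ((a3.mul ss).const_mul 10).mul (w2.mul w2)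
  have t4 := ((a3.mul ss).const_mul 4).mul (w3.mul w1)
  have t5 := ((p3.const_mul 30).add (q3.const_mul 22)).mul (w2.mul w1)
  have t6 := ((p3.const_mul 6).add (q3.const_mul 2)).mul (w3.mul w0)
  have t7 := ((a5.mul ss).const_mul 10).mul (w1.mul w1)
  have t8 := ((p5.const_mul 22).add (q5.const_mul 10)).mul (w1.mul w0)
  have t9 := ((a5.mul ss).const_mul 4).mul (w2.mul w0)
  have t10 := (((a5.mul aa).mul ss).const_mul 2).mul (w0.mul w0)
  exact (t1.add (t2.add (t3.add (t4.add (t5.add (t6.add (t7.add (t8.add (t9.add t10))))))))).of_eq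
    (fun x => by simp only [bdForm]; ring) fun x => by simp only [bdFormDeriv]; ring

/-- The spatial operator paired with a function with vanishing traces: integrating by parts twice,
all derivatives but two fall on the latter, and the result is symmetric. -/
theorem integral_mul_op (D : CarlemanData b s) (k : ℝ) {φ : ℕ → ℝ → ℝ} (hφ : IsSobolevJet 4 φ)
    (hv : IsSobolevJet 4 v) (h0 : φ 0 0 = 0) (h1 : φ 0 1 = 0) (h2 : φ 1 0 = 0) (h3 : φ 1 1 = 0)
    (hi : IntegrableOn (fun x => weightedJet b k φ x 0
      * (opX (fun j => s j x) (weightedJet b k v x)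
        + opY (coefA b k x) (fun j => s j x) (weightedJet b k v x))) (Ioo 0 1)) :
    ∫ x in Ioo (0 : ℝ) 1, weightedJet b k φ x 0
      * (opX (fun j => s j x) (weightedJet b k v x)
        + opY (coefA b k x) (fun j => s j x) (weightedJet b k v x))
    = ∫ x in Ioo (0 : ℝ) 1, s 0 x *
      (conjSq (coefA b k x) (weightedJet b k φ x) 0 * weightedJet b k v x 2
        + weightedJet b k φ x 2 * conjSq (coefA b k x) (weightedJet b k v x) 0) := by
  have a0 := D.hasACDeriv_coefA k (j := 0) (by norm_num)
  have a1 := D.hasACDeriv_coefA k (j := 1) (by norm_num)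
  have a2 := D.hasACDeriv_coefA k (j := 2) (by norm_num)
  have s0 := D.hasACDeriv_s (j := 0) (by norm_num)
  have s1 := D.hasACDeriv_s (j := 1) (by norm_num)
  have f0 := D.hasACDeriv_weightedJet k hφ (j := 0) (by norm_num)
  have f1 := D.hasACDeriv_weightedJet k hφ (j := 1) (by norm_num)
  have u0 := D.hasACDeriv_weightedJet k hv (j := 0) (by norm_num)
  have u1 := D.hasACDeriv_weightedJet k hv (j := 1) (by norm_num)
  have u2 := D.hasACDeriv_weightedJet k hv (j := 2) (by norm_num)
  have u3 := D.hasACDeriv_weightedJet k hv (j := 3) (by norm_num)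
  have g0 : HasACDeriv (fun x => conjSq (coefA b k x) (weightedJet b k v x) 0)
      (fun x => conjSq (coefA b k x) (weightedJet b k v x) 1
        - coefA b k x 0 * conjSq (coefA b k x) (weightedJet b k v x) 0) :=
    ((u2.sub ((a0.mul u1).const_mul 4)).add
      ((((a0.mul a0).const_mul 4).sub (a1.const_mul 2)).mul u0)).of_eq
      (fun x => by simp only [conjSq]; ring) fun x => by simp only [conjSq]; ring
  have g1 : HasACDeriv (fun x => conjSq (coefA b k x) (weightedJet b k v x) 1)
      (fun x => conjSq (coefA b k x) (weightedJet b k v x) 2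
        - coefA b k x 0 * conjSq (coefA b k x) (weightedJet b k v x) 1) :=
    (((u3.sub ((a0.mul u2).const_mul 4)).add
      ((((a0.mul a0).const_mul 4).sub (a1.const_mul 6)).mul u1)).add
      ((((a0.mul a1).const_mul 8).sub (a2.const_mul 2)).mul u0)).of_eq
      (fun x => by simp only [conjSq]; ring) fun x => by simp only [conjSq]; ring
  have t1 := (f0.mul ((s0.mul u3).add (s1.mul u2))).sub
    ((f1.sub ((a0.mul f0).const_mul 2)).mul (s0.mul u2))
  have t2 := (f0.mul ((s0.mul g1).add ((s1.sub ((a0.mul s0).const_mul 2)).mul g0))).sub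
    (f1.mul (s0.mul g0))
  have t3 := t1.add t2
  have e := t3.integral_eq
  have hz : ∀ x, φ 0 x = 0 → weightedJet b k φ x 0 = 0 := fun x hx => by
    rw [weightedJet, hx, mul_zero]
  have hz' : ∀ x, φ 1 x = 0 → weightedJet b k φ x 1 = 0 := fun x hx => by
    rw [weightedJet, hx, mul_zero]
  simp only [hz _ h0, hz _ h1, hz' _ h2, hz' _ h3, mul_zero, zero_mul, sub_zero, add_zero] at e
  have hI := t3.integrableOn
  rw [← sub_eq_zero]
  have hR : IntegrableOn (fun x => s 0 x *
      (conjSq (coefA b k x) (weightedJet b k φ x) 0 * weightedJet b k v x 2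
        + weightedJet b k φ x 2 * conjSq (coefA b k x) (weightedJet b k v x) 0)) (Ioo 0 1) := by
    refine (hi.sub hI).congr (Filter.Eventually.of_forall fun x => ?_)
    simp only [opX, opY, zero_add, Pi.sub_apply]
    simp only [conjSq]
    ring
  rw [← integral_sub hi hR]
  refine Eq.trans ?_ e
  refine integral_congr_ae (Filter.Eventually.of_forall fun x => ?_)
  simp only [opX, opY, zero_add]
  simp only [conjSq]
  ring

/-- The boundary form at the right end point is nonnegative for large `k`. -/
theorem bdForm_one_nonneg {b₁ b₂ s₀ s₁ k : ℝ} (hk : 0 < k) (hb : 0 < b₁) (hs : 0 < s₀)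
    (h : |b₂ * s₀ + b₁ * s₁| ≤ k * (b₁ ^ 2 * s₀)) {a σ w : ℕ → ℝ} (ha0 : a 0 = k * b₁)
    (ha1 : a 1 = k * b₂) (hs0 : σ 0 = s₀) (hs1 : σ 1 = s₁) (hw0 : w 0 = 0) (hw1 : w 1 = 0) :
    0 ≤ bdForm a σ w := by
  have e : bdForm a σ w = k * s₀ * (2 * b₁ * s₀ * w 3 ^ 2
      + 6 * ((b₂ * s₀ + b₁ * s₁) * (w 3 * w 2)) + 10 * k ^ 2 * b₁ ^ 3 * s₀ * w 2 ^ 2) := by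
    rw [bdForm, ha0, ha1, hs0, hs1, hw0, hw1]
    ring
  rw [e]
  refine mul_nonneg (by positivity) ?_
  have h1 : -(k * (b₁ ^ 2 * s₀) * (|w 3| * |w 2|)) ≤ (b₂ * s₀ + b₁ * s₁) * (w 3 * w 2) := by
    have := neg_abs_le ((b₂ * s₀ + b₁ * s₁) * (w 3 * w 2))
    rw [abs_mul, abs_mul (w 3)] at this
    nlinarith [mul_le_mul_of_nonneg_right h (mul_nonneg (abs_nonneg (w 3)) (abs_nonneg (w 2)))]
  have h2 : 0 ≤ b₁ * s₀ * (2 * |w 3| ^ 2 - 6 * |w 3| * (k * b₁ * |w 2|)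
      + 10 * (k * b₁ * |w 2|) ^ 2) := by
    refine mul_nonneg (by positivity) ?_
    nlinarith [sq_nonneg (|w 3| - (3 / 2) * (k * b₁ * |w 2|)), sq_nonneg (k * b₁ * |w 2|)]
  have h3 : |w 3| ^ 2 = w 3 ^ 2 := sq_abs _
  have h4 : |w 2| ^ 2 = w 2 ^ 2 := sq_abs _
  have e2 : b₁ * s₀ * (2 * |w 3| ^ 2 - 6 * |w 3| * (k * b₁ * |w 2|)
      + 10 * (k * b₁ * |w 2|) ^ 2) = 2 * b₁ * s₀ * w 3 ^ 2
      - 6 * (k * (b₁ ^ 2 * s₀) * (|w 3| * |w 2|)) + 10 * k ^ 2 * b₁ ^ 3 * s₀ * w 2 ^ 2 := by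
    rw [← h3, ← h4]; ring
  rw [e2] at h2
  linarith

/-- The boundary form at the left end point is controlled by the observed traces. -/
theorem bdForm_zero_le (b₁ b₂ s₀ s₁ : ℝ) : ∃ C, 0 < C ∧ ∀ k : ℝ, 1 ≤ k → ∀ a σ w u : ℕ → ℝ,
    a 0 = k * b₁ → a 1 = k * b₂ → σ 0 = s₀ → σ 1 = s₁ → w = conjJet a u → u 0 = 0 → u 1 = 0 →
    bdForm a σ w ≤ C * (k ^ 3 * u 2 ^ 2 + k * u 3 ^ 2) := by
  set A := |b₂ * s₀ + b₁ * s₁| * |6 * s₀|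
  refine ⟨(2 * |b₁| * s₀ ^ 2 + A) * (2 + 18 * b₁ ^ 2) + A + 10 * |b₁| ^ 3 * s₀ ^ 2 + 1,
    by positivity, ?_⟩
  intro k hk a σ w u ha0 ha1 hs0 hs1 hw hu0 hu1
  have hw0 : w 0 = 0 := by rw [hw]; simp [conjJet, hu0]
  have hw1 : w 1 = 0 := by rw [hw]; simp [conjJet, hu0, hu1]
  have hw2 : w 2 = u 2 := by rw [hw]; simp [conjJet, hu0, hu1]
  have hw3 : w 3 = u 3 - 3 * b₁ * (k * u 2) := by
    rw [hw]; simp [conjJet, hu0, hu1, ha0]; ring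
  have hk0 : 0 < k := by linarith
  have e : bdForm a σ w = k * (2 * b₁ * s₀ ^ 2 * w 3 ^ 2
      + (b₂ * s₀ + b₁ * s₁) * (6 * s₀) * (w 3 * w 2) + 10 * b₁ ^ 3 * s₀ ^ 2 * (k * w 2) ^ 2) := by
    rw [bdForm, ha0, ha1, hs0, hs1, hw0, hw1]
    ring
  have e2 : k ^ 3 * u 2 ^ 2 + k * u 3 ^ 2 = k * ((k * u 2) ^ 2 + u 3 ^ 2) := by ring
  rw [e, e2, mul_left_comm _ k ((k * u 2) ^ 2 + u 3 ^ 2)]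
  refine mul_le_mul_of_nonneg_left ?_ hk0.le
  set q := k * u 2
  have h3 : w 3 ^ 2 ≤ (2 + 18 * b₁ ^ 2) * (q ^ 2 + u 3 ^ 2) := by
    rw [hw3]
    nlinarith [sq_nonneg (u 3 + 3 * b₁ * q), sq_nonneg q, sq_nonneg (b₁ * u 3)]
  have h2 : u 2 ^ 2 ≤ q ^ 2 := by
    have : 1 ≤ k ^ 2 := by nlinarith
    have e3 : q ^ 2 = k ^ 2 * u 2 ^ 2 := by ring
    nlinarith [sq_nonneg (u 2)]
  have h4 : (b₂ * s₀ + b₁ * s₁) * (6 * s₀) * (w 3 * w 2) ≤ A * (w 3 ^ 2 + q ^ 2) := by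
    refine (le_abs_self _).trans ?_
    rw [abs_mul, abs_mul (_ + _)]
    refine mul_le_mul_of_nonneg_left ?_ (by positivity)
    rw [hw2, abs_mul]
    nlinarith [sq_nonneg (|w 3| - |u 2|), sq_abs (w 3), sq_abs (u 2), sq_nonneg (w 3)]
  have hA : 0 ≤ A := by positivity
  have h5 : 2 * b₁ * s₀ ^ 2 * w 3 ^ 2 ≤ 2 * |b₁| * s₀ ^ 2 * w 3 ^ 2 := by
    gcongr; exact le_abs_self _
  have h6 : 10 * b₁ ^ 3 * s₀ ^ 2 * (k * w 2) ^ 2 ≤ 10 * |b₁| ^ 3 * s₀ ^ 2 * q ^ 2 := by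
    rw [hw2, ← abs_pow]; gcongr; exact le_abs_self _
  have h7 : (2 * |b₁| * s₀ ^ 2 + A) * w 3 ^ 2
      ≤ (2 * |b₁| * s₀ ^ 2 + A) * ((2 + 18 * b₁ ^ 2) * (q ^ 2 + u 3 ^ 2)) :=
    mul_le_mul_of_nonneg_left h3 (by positivity)
  have h8 : 0 ≤ (A + 10 * |b₁| ^ 3 * s₀ ^ 2) * u 3 ^ 2 := by positivity
  nlinarith [sq_nonneg q, sq_nonneg (u 3)]

/-- For `ε = 0` the form is `2 * commMain`, which is diagonal with positive coefficients. -/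
theorem exists_carlemanForm_bound (D : CarlemanData b s) :
    ∃ c, 0 < c ∧ ∃ ε₀, 0 < ε₀ ∧ ∀ x ∈ Icc (0 : ℝ) 1, ∀ ε ∈ Icc (0 : ℝ) ε₀, ∀ z,
      c * ∑ i, z i ^ 2 ≤ carlemanForm (fun j => b j x) (fun j => s j x) ε z := by
  have hb := D.cont_b
  have hs := D.cont_s
  refine exists_form_lower_bound
    (Ψ := fun x ε z => carlemanForm (fun j => b j x) (fun j => s j x) ε z) ?_ ?_ ?_
  · simp only [carlemanForm, commMain, commRest, symmRest, skewMain, skewRest]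
    fun_prop
  · intro x ε c z
    simp only [carlemanForm, commMain, commRest, symmRest, skewMain, skewRest, Pi.smul_apply,
      smul_eq_mul]
    ring
  · intro x hx z hz
    have h1 := D.b_one_pos x hx
    have h2 := D.s_pos x hx
    have h3 := D.comm_pos x hx
    simp only [carlemanForm, commMain]
    have hq : 0 < z 3 ^ 2 + 3 * b 1 x ^ 2 * z 2 ^ 2 + 3 * b 1 x ^ 4 * z 1 ^ 2
        + b 1 x ^ 6 * z 0 ^ 2 := by
      have hex : ∃ i, z i ≠ 0 := by
        by_contra! h
        exact hz (funext h)
      obtain ⟨i, hi⟩ := hex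
      fin_cases i
      · have : 0 < z 0 ^ 2 := by positivity
        positivity
      · have : 0 < z 1 ^ 2 := by positivity
        positivity
      · have : 0 < z 2 ^ 2 := by positivity
        positivity
      · have : 0 < z 3 ^ 2 := by positivity
        positivity
    have : 0 < 2 * s 0 x * (-4 * b 2 x * s 0 x - b 1 x * s 1 x)
        * (z 3 ^ 2 + 3 * b 1 x ^ 2 * z 2 ^ 2 + 3 * b 1 x ^ 4 * z 1 ^ 2 + b 1 x ^ 6 * z 0 ^ 2) := by
      positivity
    nlinarith

/-- Bounds for the scaled forms, uniform in `x` and `ε`. -/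
theorem exists_forms_bound (D : CarlemanData b s) :
    ∃ M, 0 < M ∧ ∀ x ∈ Icc (0 : ℝ) 1, ∀ ε ∈ Icc (0 : ℝ) 1, ∀ z : Fin 4 → ℝ,
      (∀ j < 4, uForm (fun j => b j x) ε z j ^ 2 ≤ M * ∑ i, z i ^ 2) ∧
      (skewMain (fun j => b j x) (fun j => s j x) ε z
        + ε ^ 2 * skewRest (fun j => b j x) (fun j => s j x) ε z) ^ 2 ≤ M * ∑ i, z i ^ 2 ∧
      |formHScaled (fun j => b j x) (fun j => s j x) ε z| ≤ M * ∑ i, z i ^ 2 := by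
  have hb := D.cont_b
  have hs := D.cont_s
  have hu : ∀ j < 4, ∃ M, 0 < M ∧ ∀ x ∈ Icc (0 : ℝ) 1, ∀ ε ∈ Icc (0 : ℝ) 1,
      ∀ z : Fin 4 → ℝ, |uForm (fun j => b j x) ε z j ^ 2| ≤ M * ∑ i, z i ^ 2 := by
    intro j hj
    refine exists_form_bound (Ψ := fun x ε z => uForm (fun j => b j x) ε z j ^ 2) ?_ ?_
    · interval_cases j <;> simp only [uForm] <;> fun_prop
    · intro x ε c z
      interval_cases j <;> simp only [uForm, Pi.smul_apply, smul_eq_mul] <;> ring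
  obtain ⟨M0, hM0, h0⟩ := hu 0 (by norm_num)
  obtain ⟨M1, hM1, h1⟩ := hu 1 (by norm_num)
  obtain ⟨M2, hM2, h2⟩ := hu 2 (by norm_num)
  obtain ⟨M3, hM3, h3⟩ := hu 3 (by norm_num)
  obtain ⟨M4, hM4, h4⟩ := exists_form_bound
    (Ψ := fun x ε z => (skewMain (fun j => b j x) (fun j => s j x) ε z
        + ε ^ 2 * skewRest (fun j => b j x) (fun j => s j x) ε z) ^ 2)
    (by simp only [skewMain, skewRest]; fun_prop)
    (fun x ε c z => by simp only [skewMain, skewRest, Pi.smul_apply, smul_eq_mul]; ring)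
  obtain ⟨M5, hM5, h5⟩ := exists_form_bound
    (Ψ := fun x ε z => formHScaled (fun j => b j x) (fun j => s j x) ε z)
    (by simp only [formHScaled, uForm]; fun_prop)
    (fun x ε c z => by simp only [formHScaled, uForm, Pi.smul_apply, smul_eq_mul]; ring)
  refine ⟨M0 + M1 + M2 + M3 + M4 + M5, by positivity, fun x hx ε hε z => ?_⟩
  have hz : 0 ≤ ∑ i, z i ^ 2 := Finset.sum_nonneg fun i _ => sq_nonneg _
  refine ⟨fun j hj => ?_, ?_, ?_⟩
  · interval_cases j
    · refine (le_abs_self _).trans ((h0 x hx ε hε z).trans ?_); gcongr; linarith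
    · refine (le_abs_self _).trans ((h1 x hx ε hε z).trans ?_); gcongr; linarith
    · refine (le_abs_self _).trans ((h2 x hx ε hε z).trans ?_); gcongr; linarith
    · refine (le_abs_self _).trans ((h3 x hx ε hε z).trans ?_); gcongr; linarith
  · refine (le_abs_self _).trans ((h4 x hx ε hε z).trans ?_); gcongr; linarith
  · refine (h5 x hx ε hε z).trans ?_; gcongr; linarith

/-- The self-adjoint part of the conjugated operator `w ↦ e^{-kβ} (σ (e^{kβ} w)'')''`, applied to
`w = e^{-kβ} v`. -/
def symmPart (b s : ℕ → ℝ → ℝ) (k : ℝ) (v : ℕ → ℝ → ℝ) (x : ℝ) : ℝ :=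
  (opX (fun j => s j x) (weightedJet b k v x)
    + opY (coefA b k x) (fun j => s j x) (weightedJet b k v x)) / 2

/-- The skew-adjoint part of the conjugated operator `w ↦ e^{-kβ} (σ (e^{kβ} w)'')''`, applied to
`w = e^{-kβ} v`. -/
def skewPart (b s : ℕ → ℝ → ℝ) (k : ℝ) (v : ℕ → ℝ → ℝ) (x : ℝ) : ℝ :=
  (opX (fun j => s j x) (weightedJet b k v x)
    - opY (coefA b k x) (fun j => s j x) (weightedJet b k v x)) / 2

/-- The weighted energy density `∑ k^{-2j} |w^{(j)}|²` of `w = e^{-kβ} v`. -/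
def energy (b : ℕ → ℝ → ℝ) (k : ℝ) (v : ℕ → ℝ → ℝ) (x : ℝ) : ℝ :=
  ∑ i, scaledJet k (fun j => b j x) (weightedJet b k v x) i ^ 2

/-- The Carleman inequality on a time slice: the pointwise inequality is integrated, the boundary
form at `x = 1` has the good sign and the one at `x = 0` is observed. -/
theorem exists_slice_bound (D : CarlemanData b s) :
    ∃ c, 0 < c ∧ ∃ k₀, 1 ≤ k₀ ∧ ∃ C, 0 < C ∧ ∀ k, k₀ ≤ k → ∀ v, IsSobolevJet 4 v →
      v 0 0 = 0 → v 0 1 = 0 → v 1 0 = 0 → v 1 1 = 0 →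
      IntegrableOn (fun x => symmPart b s k v x ^ 2 / 2 + c * (k ^ 7 * energy b k v x))
        (Ioo 0 1) →
      IntegrableOn (fun x => symmPart b s k v x ^ 2 + 2 * symmPart b s k v x * skewPart b s k v x)
        (Ioo 0 1) →
      ∫ x in Ioo (0 : ℝ) 1, (symmPart b s k v x ^ 2 / 2 + c * (k ^ 7 * energy b k v x))
      ≤ (∫ x in Ioo (0 : ℝ) 1,
          (symmPart b s k v x ^ 2 + 2 * symmPart b s k v x * skewPart b s k v x))
        + C * (k ^ 3 * weightedJet b k v 0 2 ^ 2 + k * weightedJet b k v 0 3 ^ 2) := by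
  obtain ⟨c, hc, ε₀, hε₀, hform⟩ := D.exists_carlemanForm_bound
  have m0 : (0 : ℝ) ∈ Icc (0 : ℝ) 1 := by simp
  have m1 : (1 : ℝ) ∈ Icc (0 : ℝ) 1 := by simp
  have hb1 := D.b_one_pos 1 m1
  have hs1 := D.s_pos 1 m1
  set B := |b 2 1 * s 0 1 + b 1 1 * s 1 1| / (b 1 1 ^ 2 * s 0 1) with hB
  obtain ⟨C, hC, hzero⟩ := bdForm_zero_le (b 1 0) (b 2 0) (s 0 0) (s 1 0)
  -- `ε₀⁻¹ ≤ k` makes the form positive, `B ≤ k` gives the sign of the boundary form at `x = 1`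
  refine ⟨c, hc, max 1 (max ε₀⁻¹ B), le_max_left _ _, 2 * C, by positivity, ?_⟩
  intro k hk v hv h00 h01 h10 h11 hi1 hi2
  have hk1 : 1 ≤ k := (le_max_left _ _).trans hk
  have hkε : ε₀⁻¹ ≤ k := ((le_max_left _ _).trans (le_max_right _ _)).trans hk
  have hkB : B ≤ k := ((le_max_right _ _).trans (le_max_right _ _)).trans hk
  have hk0 : 0 < k := by linarith
  have hε : k⁻¹ ∈ Icc (0 : ℝ) ε₀ := ⟨by positivity, inv_le_of_inv_le₀ hε₀ hkε⟩
  have hΦ := D.hasACDeriv_bdForm k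
    (w := fun j x => conjJet (coefA b k x) (weightedJet b k v x) j)
    (fun j hj => D.hasACDeriv_conjJet k hv hj)
  have hpt : ∀ x ∈ Ioo (0 : ℝ) 1, symmPart b s k v x ^ 2 / 2 + c * (k ^ 7 * energy b k v x)
      ≤ symmPart b s k v x ^ 2 + 2 * symmPart b s k v x * skewPart b s k v x
        - 2 * bdFormDeriv (coefA b k x) (fun j => s j x)
          (fun j => conjJet (coefA b k x) (weightedJet b k v x) j) := by
    intro x hx
    have h1 := carleman_pointwise (fun j => b j x) (fun j => s j x) (weightedJet b k v x) hk0
      (coefA b k x) rfl _ _ rfl rfl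
    have h2 := hform x (Ioo_subset_Icc_self hx) _ hε
      (scaledJet k (fun j => b j x) (weightedJet b k v x))
    have h3 := mul_le_mul_of_nonneg_left h2 (by positivity : 0 ≤ k ^ 7)
    simp only [symmPart, skewPart, energy]
    linarith
  have hmono := setIntegral_mono_on hi1 (hi2.sub (hΦ.integrableOn.const_mul 2)) measurableSet_Ioo
    hpt
  simp only [Pi.sub_apply] at hmono
  rw [integral_sub hi2 (hΦ.integrableOn.const_mul 2), integral_const_mul, hΦ.integral_eq] at hmono
  have hz : ∀ j y, v j y = 0 → weightedJet b k v y j = 0 := fun j y hy => by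
    rw [weightedJet, hy, mul_zero]
  have e1 : 0 ≤ bdForm (coefA b k 1) (fun j => s j 1)
      (fun j => conjJet (coefA b k 1) (weightedJet b k v 1) j) := by
    refine bdForm_one_nonneg hk0 hb1 hs1 ?_ rfl rfl rfl rfl ?_ ?_
    · rw [hB, div_le_iff₀ (by positivity)] at hkB
      exact hkB
    · simp [conjJet, hz 0 1 h01]
    · simp [conjJet, hz 0 1 h01, hz 1 1 h11]
  have e2 := hzero k hk1 (coefA b k 0) (fun j => s j 0)
    (fun j => conjJet (coefA b k 0) (weightedJet b k v 0) j) (weightedJet b k v 0) rfl rfl rfl rfl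
    rfl (hz 0 0 h00) (hz 1 0 h10)
  linarith

end CarlemanData

/-! ### The coefficients and the weight -/

theorem le_on_Icc_of_Ioo {f : ℝ → ℝ} {c : ℝ} (hf : Continuous f)
    (h : ∀ x ∈ Ioo (0 : ℝ) 1, c ≤ f x) : ∀ x ∈ Icc (0 : ℝ) 1, c ≤ f x := by
  have h1 : closure (Ioo (0 : ℝ) 1) ⊆ {x | c ≤ f x} :=
    closure_minimal h (isClosed_le continuous_const hf)
  rwa [closure_Ioo (by norm_num)] at h1

theorem IccExtend_eventuallyEq {f : ℝ → ℝ} {x : ℝ} (hx : x ∈ Ioo (0 : ℝ) 1) :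
    IccExtend zero_le_one ((Icc (0 : ℝ) 1).domRestrict f) =ᶠ[nhds x] f := by
  filter_upwards [Ioo_mem_nhds hx.1 hx.2] with y hy
  rw [IccExtend_of_mem _ _ (Ioo_subset_Icc_self hy), domRestrict_apply]

/-- The derivatives of `β` and the continuous representatives of those of `σ` are extended from
`[0,1]` by constants. The derivative of `σ` in the weight condition is the classical one, as
`σ' ∈ H³(0,1)` is continuous. -/
theorem exists_carlemanData {σ β : ℝ → ℝ} {r : ℝ} (hσ : IsDiffusion σ)
    (hβ : IsSpaceWeight σ r β) : ∃ b s : ℕ → ℝ → ℝ, CarlemanData b s ∧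
      (∀ x ∈ Icc (0 : ℝ) 1, b 0 x = β x) ∧ b 1 0 = derivWithin β (Icc 0 1) 0 ∧
      ∀ x ∈ Icc (0 : ℝ) 1, s 0 x = σ x := by
  obtain ⟨D, rfl, hD⟩ := hσ.mem
  obtain ⟨σ₀, hσ₀, hpos⟩ := hσ.pos
  let b : ℕ → ℝ → ℝ := fun j => if j ≤ 4 then
    IccExtend zero_le_one ((Icc (0 : ℝ) 1).domRestrict (iteratedDerivWithin j β (Icc 0 1))) else 0
  let s : ℕ → ℝ → ℝ := fun j => if j < 3 then
    IccExtend zero_le_one ((Icc (0 : ℝ) 1).domRestrict (D j)) else 0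
  have hu : UniqueDiffOn ℝ (Icc (0 : ℝ) 1) := uniqueDiffOn_Icc_zero_one
  have hbv : ∀ j ≤ 4, ∀ x ∈ Icc (0 : ℝ) 1, b j x = iteratedDerivWithin j β (Icc 0 1) x := by
    intro j hj x hx
    simp only [b, if_pos hj]
    rw [IccExtend_of_mem _ _ hx, domRestrict_apply]
  have hsv : ∀ j < 3, ∀ x ∈ Icc (0 : ℝ) 1, s j x = D j x := by
    intro j hj x hx
    simp only [s, if_pos hj]
    rw [IccExtend_of_mem _ _ hx, domRestrict_apply]
  have hbc : ∀ j, Continuous (b j) := by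
    intro j
    by_cases hj : j ≤ 4
    · simp only [b, if_pos hj]
      exact (hβ.smooth.continuousOn_iteratedDerivWithin (by exact_mod_cast hj)
        hu).domRestrict.Icc_extend'
    · simp only [b, if_neg hj]; exact continuous_const
  have hsc : ∀ j, Continuous (s j) := by
    intro j
    by_cases hj : j < 3
    · simp only [s, if_pos hj]
      exact (hD.cont j (by omega)).domRestrict.Icc_extend'
    · simp only [s, if_neg hj]; exact continuous_const
  have hDd : ∀ j < 3, ∀ x ∈ Ioo (0 : ℝ) 1, HasDerivAt (D j) (D (j + 1) x) x := fun j hj x hx =>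
    (hD.hasACDeriv (by omega)).hasDerivAt (hD.cont (j + 1) (by omega)) hx
  have hb0 := le_on_Icc_of_Ioo (hbc 0) (c := r) fun x hx => by
    rw [hbv 0 (by norm_num) x (Ioo_subset_Icc_self hx), iteratedDerivWithin_zero]
    exact hβ.le_zero x hx
  have hb1 := le_on_Icc_of_Ioo (hbc 1) (c := r) fun x hx => by
    rw [hbv 1 (by norm_num) x (Ioo_subset_Icc_self hx), iteratedDerivWithin_one]
    exact hβ.le_one x hx
  have hs0 := le_on_Icc_of_Ioo (hsc 0) (c := σ₀) fun x hx => by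
    rw [hsv 0 (by norm_num) x (Ioo_subset_Icc_self hx)]
    exact hpos x hx
  have hr := hβ.r_pos
  have hcomm := le_on_Icc_of_Ioo (f := fun x => -4 * b 2 x * s 0 x - b 1 x * s 1 x)
    (c := r * σ₀) (by have := hbc 1; have := hbc 2; have := hsc 0; have := hsc 1; fun_prop)
    fun x hx => by
      have hxI := Ioo_subset_Icc_self hx
      have h2 : b 2 x ≤ -r := by rw [hbv 2 (by norm_num) x hxI]; exact hβ.two_le x hx
      have h1 := hβ.mul_le x hx
      have hinf : sInf (D 0 '' Icc 0 1) ≤ s 0 x := by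
        rw [hsv 0 (by norm_num) x hxI]
        exact csInf_le (isCompact_Icc.image_of_continuousOn (hD.cont 0 (by norm_num))).bddBelow
          (mem_image_of_mem _ hxI)
      have hd : derivWithin (D 0) (Icc 0 1) x = s 1 x := by
        rw [hsv 1 (by norm_num) x hxI]
        exact (hDd 0 (by norm_num) x hx).hasDerivWithinAt.derivWithin (hu x hxI)
      have hd2 : derivWithin β (Icc 0 1) x = b 1 x := by
        rw [hbv 1 (by norm_num) x hxI, iteratedDerivWithin_one]
      rw [hd, hd2] at h1
      have h3 := hs0 x hxI
      have h4 := (abs_le.1 h1).2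
      have h5 : r / 4 * sInf (D 0 '' Icc 0 1) ≤ r / 4 * s 0 x :=
        mul_le_mul_of_nonneg_left hinf (by positivity)
      have h6 : r * s 0 x ≤ -b 2 x * s 0 x := mul_le_mul_of_nonneg_right (by linarith)
        (by linarith)
      have h7 : r * σ₀ ≤ r * s 0 x := mul_le_mul_of_nonneg_left h3 hr.le
      nlinarith
  refine ⟨b, s, ⟨hbc, hsc, ?_, ?_, fun x hx => hr.trans_le (hb0 x hx),
    fun x hx => hr.trans_le (hb1 x hx), fun x hx => hσ₀.trans_le (hs0 x hx),
    fun x hx => (mul_pos hr hσ₀).trans_le (hcomm x hx)⟩, ?_, ?_, ?_⟩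
  · intro j hj x hx
    have hxI := Ioo_subset_Icc_self hx
    rw [hbv (j + 1) (by omega) x hxI]
    simp only [b, if_pos hj.le]
    refine HasDerivAt.congr_of_eventuallyEq ?_ (IccExtend_eventuallyEq hx)
    have hdiff := hβ.smooth.differentiableOn_iteratedDerivWithin (m := j)
      (by exact_mod_cast hj) hu x hxI
    rw [iteratedDerivWithin_succ]
    exact hdiff.hasDerivWithinAt.hasDerivAt (Icc_mem_nhds hx.1 hx.2)
  · intro j hj x hx
    have hxI := Ioo_subset_Icc_self hx
    rw [hsv (j + 1) (by omega) x hxI]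
    simp only [s, if_pos (by omega : j < 3)]
    exact (hDd j (by omega) x hx).congr_of_eventuallyEq (IccExtend_eventuallyEq hx)
  · intro x hx
    rw [hbv 0 (by norm_num) x hx, iteratedDerivWithin_zero]
  · rw [hbv 1 (by norm_num) 0 (by simp), iteratedDerivWithin_one]
  · exact hsv 0 (by norm_num)

/-- A large parameter `k` that depends on time, tends to infinity at the ends of `(0,T)` and has a
derivative `k'` of order `k ^ 2`; the instance of interest is `k = λ / φ₀`. -/
structure TimeRate (T M : ℝ) (k k' : ℝ → ℝ) : Prop where
  one_le : ∀ t ∈ Ioo 0 T, 1 ≤ k t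
  hasDerivAt : ∀ t ∈ Ioo 0 T, HasDerivAt k (k' t) t
  deriv_le : ∀ t ∈ Ioo 0 T, |k' t| ≤ M * k t ^ 2
  cont_deriv : ContinuousOn k' (Ioo 0 T)
  proper : ∀ R, ∃ δ > 0, ∀ t ∈ Ioo 0 T, t ∉ Ioo δ (T - δ) → R < k t

theorem TimeRate.continuousOn {T M : ℝ} {k k' : ℝ → ℝ} (hk : TimeRate T M k k') :
    ContinuousOn k (Ioo 0 T) := fun t ht =>
  (hk.hasDerivAt t ht).continuousAt.continuousWithinAt

/-- The functions `λ / φ₀` have a uniform constant `M` for `λ` large. -/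
theorem IsTimeWeight.exists_timeRate {T T₀ : ℝ} {φ₀ : ℝ → ℝ} (h : IsTimeWeight T T₀ φ₀) :
    ∃ M, 0 < M ∧ ∀ lam, 1 ≤ lam → φ₀ T₀ ≤ lam → ∃ k', TimeRate T M (fun t => lam / φ₀ t) k' := by
  have hT : 0 < T := h.mem.1.trans h.mem.2
  have hu : UniqueDiffOn ℝ (Icc 0 T) := uniqueDiffOn_Icc hT
  have hc : ContinuousOn (derivWithin φ₀ (Icc 0 T)) (Icc 0 T) :=
    h.smooth.continuousOn_derivWithin hu (by norm_num)
  obtain ⟨M, hM⟩ := isCompact_Icc.exists_bound_of_continuousOn hc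
  refine ⟨|M| + 1, by positivity, fun lam hl hlφ => ?_⟩
  have hd : ∀ t ∈ Ioo 0 T, HasDerivAt φ₀ (derivWithin φ₀ (Icc 0 T) t) t := fun t ht =>
    (h.smooth.differentiableOn (by norm_num) t (Ioo_subset_Icc_self ht)).hasDerivWithinAt.hasDerivAt
      (Icc_mem_nhds ht.1 ht.2)
  have hl0 : 0 < lam := by linarith
  refine ⟨fun t => -lam * derivWithin φ₀ (Icc 0 T) t / φ₀ t ^ 2, ?_, ?_, ?_, ?_, ?_⟩
  · intro t ht
    rw [le_div_iff₀ (h.pos t ht)]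
    linarith [h.le_max t ht]
  · intro t ht
    have h1 := (hasDerivAt_const t lam).div (hd t ht) (h.pos t ht).ne'
    rw [zero_mul, zero_sub, ← neg_mul] at h1
    exact h1
  · intro t ht
    have hp := h.pos t ht
    rw [abs_div, abs_mul, abs_neg, abs_of_pos hl0, abs_of_pos (pow_pos hp 2), div_pow,
      ← mul_div_assoc, div_le_div_iff_of_pos_right (pow_pos hp 2)]
    have h1 : |derivWithin φ₀ (Icc 0 T) t| ≤ |M| + 1 :=
      (hM t (Ioo_subset_Icc_self ht)).trans ((le_abs_self M).trans (by linarith))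
    nlinarith [mul_le_mul_of_nonneg_left h1 hl0.le, abs_nonneg M,
      mul_le_mul_of_nonneg_right hl (by positivity : 0 ≤ (|M| + 1) * lam)]
  · have h1 := h.smooth.continuousOn.mono (Ioo_subset_Icc_self (a := 0) (b := T))
    exact (continuousOn_const.mul (hc.mono Ioo_subset_Icc_self)).div (h1.pow 2)
      fun t ht => (pow_pos (h.pos t ht) 2).ne'
  · intro R
    have hη : 0 < lam / (|R| + 1) := by positivity
    have h0 := h.smooth.continuousOn 0 (left_mem_Icc.2 hT.le)
    have h1 := h.smooth.continuousOn T (right_mem_Icc.2 hT.le)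
    obtain ⟨δ₀, hδ₀, H0⟩ := Metric.continuousWithinAt_iff.1 h0 _ hη
    obtain ⟨δ₁, hδ₁, H1⟩ := Metric.continuousWithinAt_iff.1 h1 _ hη
    refine ⟨min δ₀ δ₁ / 2, by positivity, fun t ht hn => ?_⟩
    have hp := h.pos t ht
    have hlt : φ₀ t < lam / (|R| + 1) := by
      rw [mem_Ioo, not_and_or, not_lt, not_lt] at hn
      have hm0 := min_le_left δ₀ δ₁
      have hm1 := min_le_right δ₀ δ₁
      have hm : 0 < min δ₀ δ₁ := lt_min hδ₀ hδ₁
      rcases hn with hn | hn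
      · have := H0 (Ioo_subset_Icc_self ht) (by
          rw [Real.dist_eq, sub_zero, abs_of_pos ht.1]; linarith)
        rw [h.zero_left, dist_zero_right, Real.norm_eq_abs, abs_of_pos hp] at this
        exact this
      · have := H1 (Ioo_subset_Icc_self ht) (by
          rw [Real.dist_eq, abs_sub_comm, abs_of_pos (by linarith [ht.2])]; linarith)
        rw [h.zero_right, dist_zero_right, Real.norm_eq_abs, abs_of_pos hp] at this
        exact this
    have hR : |R| + 1 < lam / φ₀ t := by
      rw [lt_div_iff₀ (by positivity)] at hlt ⊢
      linarith
    linarith [le_abs_self R]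

/-! ### Rapidly decaying functions on `Q` -/

/-- All products of `f` with powers of `k(t)` are square integrable on `Q`. -/
def RapidL2 (T : ℝ) (k : ℝ → ℝ) (f : ℝ × ℝ → ℝ) : Prop :=
  ∀ n : ℕ, MemLp (fun q => k q.1 ^ n * f q) 2 (volume.restrict (QDom T))

/-- `c` is a multiplier of the rapidly decaying functions. -/
def IsCoef (T : ℝ) (k : ℝ → ℝ) (c : ℝ × ℝ → ℝ) : Prop :=
  ∀ f, RapidL2 T k f → RapidL2 T k fun q => c q * f q

section Rapid

variable {T M : ℝ} {k k' : ℝ → ℝ} {f g c d : ℝ × ℝ → ℝ}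

theorem RapidL2.congr (hf : RapidL2 T k f) (h : ∀ q, g q = f q) : RapidL2 T k g := by
  obtain rfl : g = f := funext h
  exact hf

theorem RapidL2.add (hf : RapidL2 T k f) (hg : RapidL2 T k g) : RapidL2 T k fun q => f q + g q :=
  fun n => ((hf n).add (hg n)).ae_eq (Filter.Eventually.of_forall fun q => by simp; ring)

theorem RapidL2.sub (hf : RapidL2 T k f) (hg : RapidL2 T k g) : RapidL2 T k fun q => f q - g q :=
  fun n => ((hf n).sub (hg n)).ae_eq (Filter.Eventually.of_forall fun q => by simp; ring)

theorem RapidL2.memLp (hf : RapidL2 T k f) : MemLp f 2 (volume.restrict (QDom T)) := by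
  simpa using hf 0

theorem RapidL2.integrable_pow_mul (hf : RapidL2 T k f) (hg : RapidL2 T k g) (n : ℕ) :
    IntegrableOn (fun q => k q.1 ^ n * (f q * g q)) (QDom T) := by
  have h := (hf n).integrable_mul hg.memLp
  exact h.congr (Filter.Eventually.of_forall fun q => by simp; ring)

theorem RapidL2.integrable_mul (hf : RapidL2 T k f) (hg : RapidL2 T k g) :
    IntegrableOn (fun q => f q * g q) (QDom T) :=
  hf.memLp.integrable_mul hg.memLp

theorem IsCoef.add (hc : IsCoef T k c) (hd : IsCoef T k d) : IsCoef T k fun q => c q + d q :=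
  fun f hf => ((hc f hf).add (hd f hf)).congr fun q => by ring

theorem IsCoef.sub (hc : IsCoef T k c) (hd : IsCoef T k d) : IsCoef T k fun q => c q - d q :=
  fun f hf => ((hc f hf).sub (hd f hf)).congr fun q => by ring

theorem IsCoef.mul (hc : IsCoef T k c) (hd : IsCoef T k d) : IsCoef T k fun q => c q * d q :=
  fun f hf => (hc _ (hd f hf)).congr fun q => by ring

theorem IsCoef.const (a : ℝ) : IsCoef T k fun _ => a :=
  fun f hf n => ((hf n).const_mul a).ae_eq (Filter.Eventually.of_forall fun q => by simp; ring)

theorem IsCoef.neg (hc : IsCoef T k c) : IsCoef T k fun q => -c q :=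
  fun f hf => ((IsCoef.const (-1)) _ (hc f hf)).congr fun q => by ring

theorem IsCoef.pow (hc : IsCoef T k c) (m : ℕ) : IsCoef T k fun q => c q ^ m := by
  induction m with
  | zero => simpa using IsCoef.const (T := T) (k := k) 1
  | succ m ih => exact fun f hf => (ih.mul hc f hf).congr fun q => by ring

theorem IsCoef.rate : IsCoef T k fun q => k q.1 :=
  fun f hf n => (hf (n + 1)).ae_eq (Filter.Eventually.of_forall fun q => by simp; ring)

theorem IsCoef.of_bound {A : ℝ} (hm : AEStronglyMeasurable c (volume.restrict (QDom T)))
    (hb : ∀ q ∈ QDom T, |c q| ≤ A) : IsCoef T k c := fun f hf n => by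
  refine MemLp.of_le_mul (c := A) (hf n) ?_ ?_
  · exact (hm.mul (hf n).1).congr (Filter.Eventually.of_forall fun q => by simp; ring)
  · filter_upwards [ae_restrict_mem (measurableSet_QDom T)] with q hq
    rw [show k q.1 ^ n * (c q * f q) = c q * (k q.1 ^ n * f q) by ring, norm_mul]
    exact mul_le_mul_of_nonneg_right (hb q hq) (norm_nonneg _)

theorem IsCoef.space {a : ℝ → ℝ} (ha : Continuous a) : IsCoef T k fun q => a q.2 := by
  obtain ⟨A, hA⟩ := isCompact_Icc.exists_bound_of_continuousOn (ha.continuousOn (s := Icc 0 1))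
  exact IsCoef.of_bound (ha.comp continuous_snd).aestronglyMeasurable
    fun q hq => hA q.2 (Ioo_subset_Icc_self hq.2)

theorem TimeRate.aestronglyMeasurable (hk : TimeRate T M k k') :
    AEStronglyMeasurable (fun q : ℝ × ℝ => k q.1) (volume.restrict (QDom T)) :=
  (hk.continuousOn.comp continuousOn_fst fun _ hq => hq.1).aestronglyMeasurable
    (measurableSet_QDom T)

theorem TimeRate.aestronglyMeasurable_deriv (hk : TimeRate T M k k') :
    AEStronglyMeasurable (fun q : ℝ × ℝ => k' q.1) (volume.restrict (QDom T)) :=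
  (hk.cont_deriv.comp continuousOn_fst fun _ hq => hq.1).aestronglyMeasurable
    (measurableSet_QDom T)

theorem IsCoef.rateDeriv (hk : TimeRate T M k k') : IsCoef T k fun q => k' q.1 := by
  intro f hf n
  refine MemLp.of_le_mul (c := M) (hf (n + 2)) ?_ ?_
  · exact (hk.aestronglyMeasurable_deriv.mul (hf n).1).congr
      (Filter.Eventually.of_forall fun q => by simp; ring)
  · filter_upwards [ae_restrict_mem (measurableSet_QDom T)] with q hq
    rw [show k q.1 ^ n * (k' q.1 * f q) = k' q.1 * (k q.1 ^ n * f q) by ring, norm_mul,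
      show k q.1 ^ (n + 2) * f q = k q.1 ^ 2 * (k q.1 ^ n * f q) by ring, norm_mul (k q.1 ^ 2),
      ← mul_assoc, Real.norm_eq_abs (k' q.1), norm_pow, Real.norm_eq_abs (k q.1), sq_abs]
    exact mul_le_mul_of_nonneg_right (hk.deriv_le _ hq.1) (norm_nonneg _)

theorem pow_mul_exp_neg_le {k c : ℝ} (hk : 0 ≤ k) (hc : 0 < c) (n : ℕ) :
    k ^ n * Real.exp (-k * c) ≤ n.factorial / c ^ n := by
  have h2 := Real.pow_div_factorial_le_exp (k * c) (by positivity) n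
  rw [mul_pow, div_le_iff₀ (by positivity)] at h2
  rw [le_div_iff₀ (by positivity)]
  calc k ^ n * Real.exp (-k * c) * c ^ n = k ^ n * c ^ n * Real.exp (-(k * c)) := by
        rw [neg_mul]; ring
    _ ≤ Real.exp (k * c) * n.factorial * Real.exp (-(k * c)) := by gcongr
    _ = n.factorial := by rw [mul_right_comm, ← Real.exp_add]; simp

/-- Multiplication by the weight makes square integrable functions rapidly decaying. -/
theorem RapidL2.exp_mul {b : ℝ → ℝ} (hk : TimeRate T M k k') (hb : Continuous b)
    (hpos : ∀ x ∈ Icc (0 : ℝ) 1, 0 < b x) (hf : MemLp f 2 (volume.restrict (QDom T))) :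
    RapidL2 T k fun q => Real.exp (-k q.1 * b q.2) * f q := by
  obtain ⟨x₀, hx₀, hmin⟩ := isCompact_Icc.exists_isMinOn (nonempty_Icc.2 zero_le_one)
    (hb.continuousOn (s := Icc 0 1))
  have hr := hpos x₀ hx₀
  have hkm := hk.aestronglyMeasurable
  intro n
  have hem : AEStronglyMeasurable (fun q : ℝ × ℝ => Real.exp (-k q.1 * b q.2))
      (volume.restrict (QDom T)) :=
    Real.continuous_exp.comp_aestronglyMeasurable
      (hkm.neg.mul (hb.comp continuous_snd).aestronglyMeasurable)
  refine MemLp.of_le_mul (c := n.factorial / b x₀ ^ n) hf ((hkm.pow n).mul (hem.mul hf.1)) ?_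
  filter_upwards [ae_restrict_mem (measurableSet_QDom T)] with q hq
  have hk1 := hk.one_le _ hq.1
  rw [← mul_assoc, norm_mul]
  refine mul_le_mul_of_nonneg_right ?_ (norm_nonneg _)
  have hk0 : 0 ≤ k q.1 := by linarith
  rw [Real.norm_eq_abs, abs_of_nonneg (by positivity)]
  have h1 : b x₀ ≤ b q.2 := hmin (Ioo_subset_Icc_self hq.2)
  have h2 : Real.exp (-k q.1 * b q.2) ≤ Real.exp (-k q.1 * b x₀) :=
    Real.exp_le_exp.2 (by nlinarith)
  exact (mul_le_mul_of_nonneg_left h2 (by positivity)).trans (pow_mul_exp_neg_le hk0 hr n)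

end Rapid

/-! ### Slices of functions on `Q` -/

/-- The function `x ↦ V j (t, x)` and its derivatives. -/
def slice (V : ℕ → ℝ × ℝ → ℝ) (t : ℝ) (j : ℕ) (x : ℝ) : ℝ := V j (t, x)

theorem restrict_QDom (T : ℝ) : (volume : Measure (ℝ × ℝ)).restrict (QDom T)
    = (volume.restrict (Ioo 0 T)).prod (volume.restrict (Ioo (0 : ℝ) 1)) := by
  rw [Measure.prod_restrict, ← Measure.volume_eq_prod, QDom]

theorem integral_QDom {T : ℝ} {f : ℝ × ℝ → ℝ} (hf : IntegrableOn f (QDom T)) :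
    ∫ q in QDom T, f q = ∫ t in Ioo 0 T, ∫ x in Ioo (0 : ℝ) 1, f (t, x) := by
  rw [IntegrableOn, restrict_QDom] at hf
  rw [restrict_QDom, integral_prod _ hf]

theorem ae_integrableOn_slice {T : ℝ} {f : ℝ × ℝ → ℝ} (hf : IntegrableOn f (QDom T)) :
    ∀ᵐ t ∂volume.restrict (Ioo 0 T), IntegrableOn (fun x => f (t, x)) (Ioo 0 1) := by
  rw [IntegrableOn, restrict_QDom] at hf
  exact hf.prod_right_ae

theorem integrableOn_integral_slice {T : ℝ} {f : ℝ × ℝ → ℝ} (hf : IntegrableOn f (QDom T)) :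
    IntegrableOn (fun t => ∫ x in Ioo (0 : ℝ) 1, f (t, x)) (Ioo 0 T) := by
  rw [IntegrableOn, restrict_QDom] at hf
  exact hf.integral_prod_left

section Rapid

variable {T M : ℝ} {k k' : ℝ → ℝ} {b s : ℕ → ℝ → ℝ} {V : ℕ → ℝ × ℝ → ℝ}

theorem CarlemanData.rapid_weightedJet (D : CarlemanData b s) (hk : TimeRate T M k k')
    (hV : IsL2H4H02 T V) {j : ℕ} (hj : j ≤ 4) :
    RapidL2 T k fun q => weightedJet b (k q.1) (slice V q.1) q.2 j :=
  RapidL2.exp_mul hk (D.cont_b 0) D.b_zero_pos (hV.memLp j hj)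

theorem CarlemanData.isCoef_coefA (D : CarlemanData b s) (j : ℕ) :
    IsCoef T k fun q => coefA b (k q.1) q.2 j :=
  IsCoef.rate.mul (IsCoef.space (D.cont_b (j + 1)))

theorem CarlemanData.rapid_opX (D : CarlemanData b s) (hk : TimeRate T M k k')
    (hV : IsL2H4H02 T V) :
    RapidL2 T k fun q => opX (fun j => s j q.2) (weightedJet b (k q.1) (slice V q.1) q.2) := by
  have u := fun j (hj : j ≤ 4) => D.rapid_weightedJet hk hV hj
  have c := fun j => IsCoef.space (T := T) (k := k) (D.cont_s j)
  exact ((c 0 _ (u 4 le_rfl)).add (((IsCoef.const 2).mul (c 1)) _ (u 3 (by norm_num)))).add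
    (c 2 _ (u 2 (by norm_num)))

theorem CarlemanData.rapid_conjSq (D : CarlemanData b s) (hk : TimeRate T M k k')
    (hV : IsL2H4H02 T V) {j : ℕ} (hj : j ≤ 2) :
    RapidL2 T k fun q =>
      conjSq (coefA b (k q.1) q.2) (weightedJet b (k q.1) (slice V q.1) q.2) j := by
  have u := fun j (hj : j ≤ 4) => D.rapid_weightedJet hk hV hj
  have u0 := u 0 (by norm_num)
  have u1 := u 1 (by norm_num)
  have u2 := u 2 (by norm_num)
  have u3 := u 3 (by norm_num)
  have u4 := u 4 (by norm_num)
  have a0 := D.isCoef_coefA (T := T) (k := k) 0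
  have a1 := D.isCoef_coefA (T := T) (k := k) 1
  have a2 := D.isCoef_coefA (T := T) (k := k) 2
  have a3 := D.isCoef_coefA (T := T) (k := k) 3
  have c := fun r => IsCoef.const (T := T) (k := k) r
  interval_cases j
  · exact (u2.sub (((c 4).mul a0) _ u1)).add (((((c 4).mul (a0.pow 2)).sub ((c 2).mul a1))) _ u0)
  · exact ((u3.sub (((c 4).mul a0) _ u2)).add
      (((((c 4).mul (a0.pow 2)).sub ((c 6).mul a1))) _ u1)).add
      (((((c 8).mul a0).mul a1).sub ((c 2).mul a2)) _ u0)
  · exact (((u4.sub (((c 4).mul a0) _ u3)).add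
      (((((c 4).mul (a0.pow 2)).sub ((c 10).mul a1))) _ u2)).add
      (((((c 16).mul a0).mul a1).sub ((c 8).mul a2)) _ u1)).add
      (((((c 8).mul (a1.pow 2)).add (((c 8).mul a0).mul a2)).sub ((c 2).mul a3)) _ u0)

theorem CarlemanData.rapid_opY (D : CarlemanData b s) (hk : TimeRate T M k k')
    (hV : IsL2H4H02 T V) :
    RapidL2 T k fun q => opY (coefA b (k q.1) q.2) (fun j => s j q.2)
      (weightedJet b (k q.1) (slice V q.1) q.2) := by
  have g := fun j (hj : j ≤ 2) => D.rapid_conjSq hk hV hj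
  have c := fun j => IsCoef.space (T := T) (k := k) (D.cont_s j)
  have a0 := D.isCoef_coefA (T := T) (k := k) 0
  have a1 := D.isCoef_coefA (T := T) (k := k) 1
  have r := fun r => IsCoef.const (T := T) (k := k) r
  exact ((c 0 _ (g 2 le_rfl)).add
    (((r 2).mul ((c 1).sub (((r 2).mul a0).mul (c 0)))) _ (g 1 (by norm_num)))).add
    ((((c 2).sub (((r 4).mul a0).mul (c 1))).add
      ((((r 4).mul (a0.pow 2)).sub ((r 2).mul a1)).mul (c 0))) _ (g 0 (by norm_num)))

theorem CarlemanData.integrableOn_formH (D : CarlemanData b s) (hk : TimeRate T M k k')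
    (hV : IsL2H4H02 T V) :
    IntegrableOn (fun q => k' q.1 * formH (k q.1) (fun j => b j q.2) (fun j => s j q.2)
      (weightedJet b (k q.1) (slice V q.1) q.2)) (QDom T) := by
  have u0 := D.rapid_weightedJet hk hV (j := 0) (by norm_num)
  have u1 := D.rapid_weightedJet hk hV (j := 1) (by norm_num)
  have u2 := D.rapid_weightedJet hk hV (j := 2) (by norm_num)
  have g0 := D.rapid_conjSq hk hV (j := 0) (by norm_num)
  have c := fun j => IsCoef.space (T := T) (k := k) (D.cont_s j)
  have d := fun j => IsCoef.space (T := T) (k := k) (D.cont_b j)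
  have r := fun r => IsCoef.const (T := T) (k := k) r
  have h1 := ((((r (-2)).mul (d 0)) _ g0).sub (((r 4).mul (d 1)) _ u1)).add
    (((((r 8).mul IsCoef.rate).mul ((d 1).pow 2)).sub ((r 2).mul (d 2))) _ u0)
  have h2 := ((IsCoef.rateDeriv hk).mul (c 0)) _ u2
  refine (h2.integrable_mul h1).congr (Filter.Eventually.of_forall fun q => ?_)
  simp only [formH, mul_assoc]
  rfl

end Rapid

/-! ### The energy identity for the weighted equation -/

section Cutoff

open Filter Topology

/-- A cutoff of the values of `k` below `n + 1`. -/
def rateCutoff (n : ℕ) (k : ℝ) : ℝ := Real.smoothTransition (2 - k / (n + 1))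

theorem rateCutoff_eq_one {n : ℕ} {k : ℝ} (h : k ≤ n + 1) : rateCutoff n k = 1 := by
  refine Real.smoothTransition.one_of_one_le ?_
  have : k / ((n : ℝ) + 1) ≤ 1 := (div_le_one (by positivity)).2 h
  linarith

theorem rateCutoff_eq_zero {n : ℕ} {k : ℝ} (h : 2 * (n + 1) ≤ k) : rateCutoff n k = 0 := by
  refine Real.smoothTransition.zero_of_nonpos ?_
  have : 2 ≤ k / ((n : ℝ) + 1) := (le_div_iff₀ (by positivity)).2 h
  linarith

theorem abs_rateCutoff_le (n : ℕ) (k : ℝ) : |rateCutoff n k| ≤ 1 := by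
  rw [rateCutoff, abs_of_nonneg (Real.smoothTransition.nonneg _)]
  exact Real.smoothTransition.le_one _

theorem contDiff_rateCutoff (n : ℕ) : ContDiff ℝ 1 (rateCutoff n) :=
  Real.smoothTransition.contDiff.comp (contDiff_const.sub (contDiff_id.div_const _))

theorem exists_deriv_rateCutoff_bound :
    ∃ B, 0 ≤ B ∧ ∀ (n : ℕ) k, |deriv (rateCutoff n) k| ≤ B / (n + 1) := by
  have hc : Continuous (deriv Real.smoothTransition) :=
    (Real.smoothTransition.contDiff (n := 1)).continuous_deriv (by norm_num)
  obtain ⟨B, hB⟩ := (isCompact_Icc (a := (0 : ℝ)) (b := 1)).exists_bound_of_continuousOn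
    hc.continuousOn
  have hB0 : 0 ≤ B := (norm_nonneg _).trans (hB 0 (by simp))
  have hall : ∀ y, |deriv Real.smoothTransition y| ≤ B := by
    intro y
    by_cases hy : y ∈ Icc (0 : ℝ) 1
    · exact hB y hy
    · have hz : deriv Real.smoothTransition y = 0 := by
        rw [mem_Icc, not_and_or, not_le, not_le] at hy
        rcases hy with hy | hy
        · have : Real.smoothTransition =ᶠ[𝓝 y] fun _ => 0 := by
            filter_upwards [gt_mem_nhds hy] with z hz
            exact Real.smoothTransition.zero_of_nonpos hz.le
          rw [this.deriv_eq, deriv_const]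
        · have : Real.smoothTransition =ᶠ[𝓝 y] fun _ => 1 := by
            filter_upwards [lt_mem_nhds hy] with z hz
            exact Real.smoothTransition.one_of_one_le hz.le
          rw [this.deriv_eq, deriv_const]
      rw [hz, abs_zero]
      exact hB0
  refine ⟨B, hB0, fun n k => ?_⟩
  have hd : HasDerivAt (rateCutoff n)
      (deriv Real.smoothTransition (2 - k / (n + 1)) * (-(1 / ((n : ℝ) + 1)))) k := by
    have h1 : HasDerivAt (fun k : ℝ => 2 - k / ((n : ℝ) + 1)) (-(1 / ((n : ℝ) + 1))) k :=
      ((hasDerivAt_id k).div_const _).const_sub 2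
    exact ((Real.smoothTransition.contDiff (n := 1)).differentiable
      (by norm_num) _).hasDerivAt.comp k h1
  rw [hd.deriv, abs_mul, abs_neg, abs_of_pos (by positivity : 0 < 1 / ((n : ℝ) + 1)),
    mul_one_div]
  exact div_le_div_of_nonneg_right (hall _) (by positivity)

/-- The coefficients, without the factor `σ e^{-2kβ}`, of the symmetric form
`∫ σ ((e^{-2kβ} u)'' v'' + u'' (e^{-2kβ} v)'')` in the derivatives of `u` and `v`. They are
quadratic polynomials in `k`, of which this is the coefficient of `k ^ n`. -/
def formCoef (b₁ b₂ : ℝ) : ℕ → Fin 3 → Fin 3 → ℝ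
  | 0 => ![![0, 0, 0], ![0, 0, 0], ![0, 0, 2]]
  | 1 => ![![0, 0, -2 * b₂], ![0, 0, -4 * b₁], ![-2 * b₂, -4 * b₁, 0]]
  | 2 => ![![0, 0, 4 * b₁ ^ 2], ![0, 0, 0], ![4 * b₁ ^ 2, 0, 0]]
  | _ => 0

theorem formCoef_symm (b₁ b₂ : ℝ) (n : ℕ) (i j : Fin 3) :
    formCoef b₁ b₂ n i j = formCoef b₁ b₂ n j i := by
  match n with
  | 0 | 1 | 2 => fin_cases i <;> fin_cases j <;> rfl
  | n + 3 => rfl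

theorem continuous_formCoef {f g : ℝ → ℝ} (hf : Continuous f) (hg : Continuous g) (n : ℕ)
    (i j : Fin 3) : Continuous fun x => formCoef (f x) (g x) n i j := by
  match n with
  | 0 | 1 | 2 => fin_cases i <;> fin_cases j <;> simp [formCoef] <;> fun_prop
  | n + 3 => exact continuous_const

/-- The polynomial in `k` with the coefficients `formCoef`. -/
def formPoly (b : ℕ → ℝ → ℝ) (k x : ℝ) (i j : Fin 3) : ℝ :=
  formCoef (b 1 x) (b 2 x) 0 i j + formCoef (b 1 x) (b 2 x) 1 i j * k
    + formCoef (b 1 x) (b 2 x) 2 i j * k ^ 2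

/-- The derivative of `formPoly` in `k`. -/
def formPolyDeriv (b : ℕ → ℝ → ℝ) (k x : ℝ) (i j : Fin 3) : ℝ :=
  formCoef (b 1 x) (b 2 x) 1 i j + 2 * formCoef (b 1 x) (b 2 x) 2 i j * k

/-- The coefficients of the symmetric form, cut off for large values of `k`. -/
def cutCoef (b s : ℕ → ℝ → ℝ) (n : ℕ) (i j : Fin 3) (k x : ℝ) : ℝ :=
  rateCutoff n k * (s 0 x * Real.exp (-2 * k * b 0 x) * formPoly b k x i j)

/-- The derivative of `cutCoef` in `k`. -/
def cutCoefDeriv (b s : ℕ → ℝ → ℝ) (n : ℕ) (i j : Fin 3) (k x : ℝ) : ℝ :=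
  deriv (rateCutoff n) k * (s 0 x * Real.exp (-2 * k * b 0 x) * formPoly b k x i j)
    + rateCutoff n k * (s 0 x * Real.exp (-2 * k * b 0 x)
      * (-2 * b 0 x * formPoly b k x i j + formPolyDeriv b k x i j))

variable {b s : ℕ → ℝ → ℝ}

theorem hasDerivAt_cutCoef (n : ℕ) (i j : Fin 3) (k x : ℝ) :
    HasDerivAt (fun k => cutCoef b s n i j k x) (cutCoefDeriv b s n i j k x) k := by
  have h1 : HasDerivAt (rateCutoff n) (deriv (rateCutoff n) k) k :=
    ((contDiff_rateCutoff n).differentiable (by norm_num) k).hasDerivAt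
  have h2 : HasDerivAt (fun k => Real.exp (-2 * k * b 0 x))
      (Real.exp (-2 * k * b 0 x) * (-2 * 1 * b 0 x)) k :=
    (((hasDerivAt_id k).const_mul (-2)).mul_const (b 0 x)).exp
  have h3 : HasDerivAt (fun k => formPoly b k x i j) (formPolyDeriv b k x i j) k := by
    have := (((hasDerivAt_id k).const_mul (formCoef (b 1 x) (b 2 x) 1 i j)).const_add
      (formCoef (b 1 x) (b 2 x) 0 i j)).add
      (((hasDerivAt_id k).pow 2).const_mul (formCoef (b 1 x) (b 2 x) 2 i j))
    refine this.congr_deriv ?_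
    simp [formPolyDeriv]
    ring
  refine (h1.mul ((h2.const_mul (s 0 x)).mul h3)).congr_deriv ?_
  simp only [cutCoefDeriv, Pi.mul_apply]
  ring

theorem CarlemanData.continuous_formPoly (D : CarlemanData b s) (i j : Fin 3) :
    Continuous fun q : ℝ × ℝ => formPoly b q.1 q.2 i j := by
  have h := fun n => (continuous_formCoef (D.cont_b 1) (D.cont_b 2) n i j).comp
    (continuous_snd (X := ℝ))
  have h0 := h 0
  have h1 := h 1
  have h2 := h 2
  simp only [Function.comp_def] at h0 h1 h2
  simp only [formPoly]
  fun_prop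

theorem CarlemanData.continuous_cutCoef (D : CarlemanData b s) (n : ℕ) (i j : Fin 3) :
    Continuous fun q : ℝ × ℝ => cutCoef b s n i j q.1 q.2 := by
  have h0 := D.continuous_formPoly i j
  have h1 := (contDiff_rateCutoff n).continuous
  have h2 := D.cont_b 0
  have h3 := D.cont_s 0
  simp only [cutCoef]
  fun_prop

theorem CarlemanData.continuous_cutCoefDeriv (D : CarlemanData b s) (n : ℕ) (i j : Fin 3) :
    Continuous fun q : ℝ × ℝ => cutCoefDeriv b s n i j q.1 q.2 := by
  have h0 := D.continuous_formPoly i j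
  have h1 := (contDiff_rateCutoff n).continuous
  have h1' := (contDiff_rateCutoff n).continuous_deriv (by norm_num)
  have h2 := D.cont_b 0
  have h3 := D.cont_s 0
  have h4 := (continuous_formCoef (D.cont_b 1) (D.cont_b 2) 1 i j).comp
    (continuous_snd (X := ℝ))
  have h5 := (continuous_formCoef (D.cont_b 1) (D.cont_b 2) 2 i j).comp
    (continuous_snd (X := ℝ))
  simp only [Function.comp_def] at h4 h5
  simp only [cutCoefDeriv, formPolyDeriv]
  fun_prop

theorem deriv_rateCutoff_eq_zero {n : ℕ} {k : ℝ} (h : 2 * (n + 1) < k) :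
    deriv (rateCutoff n) k = 0 := by
  have : rateCutoff n =ᶠ[𝓝 k] fun _ => 0 := by
    filter_upwards [lt_mem_nhds h] with z hz using rateCutoff_eq_zero hz.le
  rw [this.deriv_eq, deriv_const]

theorem CarlemanData.exists_cutCoef_bound (D : CarlemanData b s) (n : ℕ) :
    ∃ A, 0 ≤ A ∧ ∀ i j, ∀ k, 0 ≤ k → ∀ x ∈ Icc (0 : ℝ) 1, |cutCoef b s n i j k x| ≤ A ∧
      |k ^ 2 * cutCoefDeriv b s n i j k x| ≤ A := by
  have hone : ∀ i j, ∃ A, 0 ≤ A ∧ ∀ k, 0 ≤ k → ∀ x ∈ Icc (0 : ℝ) 1,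
      |cutCoef b s n i j k x| ≤ A ∧ |k ^ 2 * cutCoefDeriv b s n i j k x| ≤ A := by
    intro i j
    have hK : IsCompact (Icc (0 : ℝ) (2 * (n + 1)) ×ˢ Icc (0 : ℝ) 1) :=
      isCompact_Icc.prod isCompact_Icc
    obtain ⟨A₁, h1⟩ := hK.exists_bound_of_continuousOn (D.continuous_cutCoef n i j).continuousOn
    obtain ⟨A₂, h2⟩ := hK.exists_bound_of_continuousOn
      ((continuous_fst.pow 2).mul (D.continuous_cutCoefDeriv n i j)).continuousOn
    refine ⟨|A₁| + |A₂|, by positivity, fun k hk x hx => ?_⟩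
    rcases le_or_gt k (2 * (n + 1)) with hle | hgt
    · have e1 := h1 (k, x) ⟨⟨hk, hle⟩, hx⟩
      have e2 := h2 (k, x) ⟨⟨hk, hle⟩, hx⟩
      simp only [Real.norm_eq_abs, Pi.mul_apply, Pi.pow_apply] at e1 e2
      constructor
      · linarith [le_abs_self A₁, abs_nonneg A₂]
      · linarith [le_abs_self A₂, abs_nonneg A₁]
    · have e1 : cutCoef b s n i j k x = 0 := by
        rw [cutCoef, rateCutoff_eq_zero hgt.le, zero_mul]
      have e2 : cutCoefDeriv b s n i j k x = 0 := by
        rw [cutCoefDeriv, rateCutoff_eq_zero hgt.le, deriv_rateCutoff_eq_zero hgt, zero_mul,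
          zero_mul, add_zero]
      rw [e1, e2, mul_zero, abs_zero]
      exact ⟨by positivity, by positivity⟩
  choose A hA0 hA using hone
  refine ⟨∑ i, ∑ j, A i j, Finset.sum_nonneg fun i _ => Finset.sum_nonneg fun j _ => hA0 i j,
    fun i j k hk x hx => ?_⟩
  have hle : A i j ≤ ∑ i, ∑ j, A i j :=
    (Finset.single_le_sum (f := fun j => A i j) (fun j _ => hA0 i j) (Finset.mem_univ j)).trans
      (Finset.single_le_sum (f := fun i => ∑ j, A i j)
        (fun i _ => Finset.sum_nonneg fun j _ => hA0 i j) (Finset.mem_univ i))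
  exact ⟨(hA i j k hk x hx).1.trans hle, (hA i j k hk x hx).2.trans hle⟩

theorem sum_formPoly (k x : ℝ) (φ v : ℕ → ℝ → ℝ) (y y' : ℝ) (c : ℝ) :
    ∑ i : Fin 3, ∑ j : Fin 3, φ i y * (c * formPoly b k x i j * v j y')
      = c * (v 2 y' * (φ 2 y - 4 * (k * b 1 x) * φ 1 y
          + (4 * (k * b 1 x) ^ 2 - 2 * (k * b 2 x)) * φ 0 y)
        + φ 2 y * (v 2 y' - 4 * (k * b 1 x) * v 1 y'
          + (4 * (k * b 1 x) ^ 2 - 2 * (k * b 2 x)) * v 0 y')) := by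
  simp [Fin.sum_univ_three, formPoly, formCoef]
  ring

theorem sum_formPolyDeriv (k x : ℝ) (v : ℕ → ℝ) (c : ℝ) :
    ∑ i : Fin 3, ∑ j : Fin 3, c * formPolyDeriv b k x i j * v i * v j
      = c * (2 * v 2 * (-4 * b 1 x * v 1 + (8 * k * b 1 x ^ 2 - 2 * b 2 x) * v 0)) := by
  simp [Fin.sum_univ_three, formPolyDeriv, formCoef]
  ring

end Cutoff

section Identity

open Filter Topology

variable {T M : ℝ} {k k' : ℝ → ℝ} {b s : ℕ → ℝ → ℝ} {V : ℕ → ℝ × ℝ → ℝ} {vt : ℝ × ℝ → ℝ}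

theorem aestronglyMeasurable_indicator_comp_rate (hk : TimeRate T M k k') {F : ℝ → ℝ → ℝ}
    (hF : Continuous fun q : ℝ × ℝ => F q.1 q.2) :
    AEStronglyMeasurable ((QDom T).indicator fun q => F (k q.1) q.2) volume := by
  rw [aestronglyMeasurable_indicator_iff (measurableSet_QDom T)]
  exact hF.comp_aestronglyMeasurable
    (hk.aestronglyMeasurable.prodMk continuous_snd.aestronglyMeasurable)

/-- The energy identity with the cutoff of large values of `k`, that is of times near the ends
of `(0,T)`. -/
theorem CarlemanData.integral_cutoff (D : CarlemanData b s) (hk : TimeRate T M k k')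
    (hV : IsL2H4H02 T V) (hvt : MemLp vt 2 (volume.restrict (QDom T)))
    (hdt : HasWeakDt T (V 0) vt) (n : ℕ) :
    2 * ∫ q in QDom T, vt q * (rateCutoff n (k q.1) * (Real.exp (-k q.1 * b 0 q.2)
      * (opX (fun j => s j q.2) (weightedJet b (k q.1) (slice V q.1) q.2)
        + opY (coefA b (k q.1) q.2) (fun j => s j q.2)
          (weightedJet b (k q.1) (slice V q.1) q.2))))
    = -∑ i : Fin 3, ∑ j : Fin 3, ∫ q in QDom T,
      k' q.1 * cutCoefDeriv b s n i j (k q.1) q.2 * V i q * V j q := by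
  set P : ℝ × ℝ → ℝ := fun q => opX (fun j => s j q.2) (weightedJet b (k q.1) (slice V q.1) q.2)
        + opY (coefA b (k q.1) q.2) (fun j => s j q.2)
          (weightedJet b (k q.1) (slice V q.1) q.2) with hP
  have hPr : RapidL2 T k P := (D.rapid_opX hk hV).add (D.rapid_opY hk hV)
  obtain ⟨δ, hδ, hprop⟩ := hk.proper (2 * (n + 1))
  obtain ⟨A, hA0, hA⟩ := D.exists_cutCoef_bound n
  let N : ℝ × ℝ → ℝ := (QDom T).indicator fun q =>
    rateCutoff n (k q.1) * (Real.exp (-k q.1 * b 0 q.2) * P q)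
  let K : Fin 3 → Fin 3 → ℝ × ℝ → ℝ := fun i j =>
    (QDom T).indicator fun q => cutCoef b s n i j (k q.1) q.2
  let K' : Fin 3 → Fin 3 → ℝ × ℝ → ℝ := fun i j =>
    (QDom T).indicator fun q => k' q.1 * cutCoefDeriv b s n i j (k q.1) q.2
  let G : Set ℝ := {t | t ∈ Ioo 0 T ∧ IsSobolevJet 4 (slice V t) ∧
    (V 0 (t, 0) = 0 ∧ V 0 (t, 1) = 0 ∧ V 1 (t, 0) = 0 ∧ V 1 (t, 1) = 0) ∧
    IntegrableOn (fun x => P (t, x)) (Ioo 0 1)}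
  have hKpos : ∀ t ∈ Ioo 0 T, 0 ≤ k t := fun t ht => by linarith [hk.one_le t ht]
  have hNL : MemLp N 2 (volume.restrict (QDom T)) := by
    have h1 : IsCoef T k fun q => rateCutoff n (k q.1) :=
      IsCoef.of_bound (((contDiff_rateCutoff n).continuous).comp_aestronglyMeasurable
        hk.aestronglyMeasurable) fun q _ => abs_rateCutoff_le n _
    have h2 : RapidL2 T k fun q => Real.exp (-k q.1 * b 0 q.2) * P q :=
      RapidL2.exp_mul hk (D.cont_b 0) D.b_zero_pos hPr.memLp
    refine (h1 _ h2).memLp.ae_eq ?_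
    filter_upwards [ae_restrict_mem (measurableSet_QDom T)] with q hq
    simp only [N, indicator_of_mem hq]
  have hbig : ∀ t ∈ Ioo 0 T, t ∉ Ioo δ (T - δ) → 2 * ((n : ℝ) + 1) ≤ k t := fun t ht hn =>
    (hprop t ht hn).le
  have hK0 : ∀ i j, ∀ t ∉ Ioo δ (T - δ), ∀ x, K i j (t, x) = 0 := by
    intro i j t ht x
    refine indicator_apply_eq_zero.2 fun hq => ?_
    rw [cutCoef, rateCutoff_eq_zero (hbig t hq.1 ht), zero_mul]
  have hmain := hdt.two_mul_integral_mul_eq (p := fun i : Fin 3 => V i) (K := K) (K' := K')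
    (N := N) (δ := δ) (G := G) (M := max A (|M| * A)) (hV.memLp 0 (by norm_num)) hvt hNL
    (fun i => hV.memLp i (by omega)) hδ
    (fun t ht x => indicator_apply_eq_zero.2 fun hq => by
      rw [rateCutoff_eq_zero (hbig t hq.1 ht), zero_mul])
    (fun i j => aestronglyMeasurable_indicator_comp_rate hk (D.continuous_cutCoef n i j))
    (fun i j => by
      simp only [K, cutCoef, formPoly, formCoef_symm _ _ _ i j])
    hK0
    (fun i j q => by
      by_cases hq : q ∈ QDom T
      · simp only [K, indicator_of_mem hq]
        exact (hA i j _ (hKpos _ hq.1) _ (Ioo_subset_Icc_self hq.2)).1.trans (le_max_left _ _)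
      · simp only [K, indicator_of_notMem hq, abs_zero]
        exact hA0.trans (le_max_left _ _))
    (fun i j t x => by
      by_cases hx : x ∈ Ioo (0 : ℝ) 1
      · by_cases ht : t ∈ Ioo 0 T
        · have h1 := (hasDerivAt_cutCoef (b := b) (s := s) n i j (k t) x).comp t
            (hk.hasDerivAt t ht)
          have e : K' i j (t, x) = cutCoefDeriv b s n i j (k t) x * k' t := by
            simp only [K', indicator_of_mem (show (t, x) ∈ QDom T from ⟨ht, hx⟩)]
            ring
          rw [e]
          refine h1.congr_of_eventuallyEq ?_
          filter_upwards [Ioo_mem_nhds ht.1 ht.2] with y hy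
          simp only [K, indicator_of_mem (show (y, x) ∈ QDom T from ⟨hy, hx⟩), Function.comp_apply]
        · have e : K' i j (t, x) = 0 :=
            indicator_of_notMem (fun hq : (t, x) ∈ QDom T => ht hq.1) _
          rw [e]
          refine (hasDerivAt_const t (0 : ℝ)).congr_of_eventuallyEq ?_
          -- the coefficients vanish in a neighbourhood of the complement of `(0,T)`
          rw [mem_Ioo, not_and_or, not_lt, not_lt] at ht
          rcases ht with ht | ht
          · filter_upwards [gt_mem_nhds (show t < δ by linarith)] with y hy
            exact hK0 i j y (fun h => by linarith [h.1]) x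
          · filter_upwards [lt_mem_nhds (show T - δ < t by linarith)] with y hy
            exact hK0 i j y (fun h => by linarith [h.2]) x
      · have e : K' i j (t, x) = 0 :=
          indicator_of_notMem (fun hq : (t, x) ∈ QDom T => hx hq.2) _
        rw [e]
        refine (hasDerivAt_const t (0 : ℝ)).congr_of_eventuallyEq (Eventually.of_forall fun y => ?_)
        exact indicator_of_notMem (fun hq : (y, x) ∈ QDom T => hx hq.2) _)
    (fun i j q => by
      by_cases hq : q ∈ QDom T
      · simp only [K', indicator_of_mem hq]
        refine le_trans ?_ (le_max_right _ _)
        rw [abs_mul]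
        have h1 := hk.deriv_le _ hq.1
        have h2 := (hA i j _ (hKpos _ hq.1) _ (Ioo_subset_Icc_self hq.2)).2
        rw [abs_mul, abs_of_nonneg (sq_nonneg _)] at h2
        calc |k' q.1| * |cutCoefDeriv b s n i j (k q.1) q.2|
            ≤ (|M| * k q.1 ^ 2) * |cutCoefDeriv b s n i j (k q.1) q.2| := by
              refine mul_le_mul_of_nonneg_right (h1.trans ?_) (abs_nonneg _)
              exact mul_le_mul_of_nonneg_right (le_abs_self M) (sq_nonneg _)
          _ = |M| * (k q.1 ^ 2 * |cutCoefDeriv b s n i j (k q.1) q.2|) := by ring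
          _ ≤ |M| * A := mul_le_mul_of_nonneg_left h2 (abs_nonneg _)
      · simp only [K', indicator_of_notMem hq, abs_zero]
        exact hA0.trans (le_max_left _ _))
    (by
      filter_upwards [hV.jet, hV.zero, ae_integrableOn_slice (hPr.memLp.integrable one_le_two),
        ae_restrict_mem measurableSet_Ioo] with t h1 h2 h3 h4
      exact ⟨h4, h1, h2, h3⟩)
    (by
      rintro t' ⟨ht', hj', ⟨z0, z1, z2, z3⟩, -⟩ t ⟨ht, hj, -, hPi⟩
      set χ := rateCutoff n (k t)
      have hcφ : ∀ j < 4, ContinuousOn (fun x => V j (t', x)) (Icc 0 1) := fun j hj => hj'.cont j hj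
      have hcv : ∀ j < 4, ContinuousOn (fun x => V j (t, x)) (Icc 0 1) := fun j hj'' =>
        hj.cont j hj''
      have hb0 := D.cont_b 0
      have hexp : Continuous fun x => Real.exp (-k t * b 0 x) := by fun_prop
      have hcw : ContinuousOn (fun x => weightedJet b (k t) (slice V t') x 0) (Icc 0 1) :=
        hexp.continuousOn.mul (hcφ 0 (by norm_num))
      have hint : IntegrableOn (fun x => weightedJet b (k t) (slice V t') x 0 * P (t, x))
          (Ioo 0 1) := by
        obtain ⟨B, hB⟩ := isCompact_Icc.exists_bound_of_continuousOn hcw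
        refine Integrable.bdd_mul (c := B) hPi
          ((hcw.mono Ioo_subset_Icc_self).aestronglyMeasurable measurableSet_Ioo) ?_
        filter_upwards [ae_restrict_mem measurableSet_Ioo] with x hx
          using hB x (Ioo_subset_Icc_self hx)
      have hop := D.integral_mul_op (k t) hj' hj z0 z1 z2 z3 hint
      have e1 : ∫ x in Ioo (0 : ℝ) 1, V 0 (t', x) * N (t, x)
          = χ * ∫ x in Ioo (0 : ℝ) 1, weightedJet b (k t) (slice V t') x 0 * P (t, x) := by
        rw [← integral_const_mul]
        refine setIntegral_congr_fun measurableSet_Ioo fun x hx => ?_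
        simp only [N, indicator_of_mem (show (t, x) ∈ QDom T from ⟨ht, hx⟩), weightedJet, slice, χ]
        ring
      rw [e1, hop, ← integral_const_mul]
      have hi : ∀ i j : Fin 3, IntegrableOn (fun x => V i (t', x) * (K i j (t, x) * V j (t, x)))
          (Ioo 0 1) := by
        intro i j
        have hcK : Continuous fun x => cutCoef b s n i j (k t) x :=
          (D.continuous_cutCoef n i j).comp (continuous_const.prodMk continuous_id)
        have hc : ContinuousOn (fun x => V i (t', x) * (cutCoef b s n i j (k t) x * V j (t, x)))
            (Icc 0 1) :=
          (hcφ i (by omega)).mul (hcK.continuousOn.mul (hcv j (by omega)))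
        refine ((hc.integrableOn_compact isCompact_Icc).mono_set Ioo_subset_Icc_self).congr_fun
          (fun x hx => ?_) measurableSet_Ioo
        simp only [K, indicator_of_mem (show (t, x) ∈ QDom T from ⟨ht, hx⟩)]
      simp_rw [← integral_finsetSum Finset.univ fun j _ => hi _ j]
      rw [← integral_finsetSum Finset.univ fun i _ =>
        integrable_finsetSum Finset.univ fun j _ => hi i j]
      refine setIntegral_congr_fun measurableSet_Ioo fun x hx => ?_
      have hKe : ∀ i j, K i j (t, x)
          = χ * (s 0 x * Real.exp (-2 * k t * b 0 x)) * formPoly b (k t) x i j := fun i j => by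
        simp only [K, indicator_of_mem (show (t, x) ∈ QDom T from ⟨ht, hx⟩), cutCoef, χ]
        ring
      have hsum := sum_formPoly (b := b) (k t) x (fun j x => V j (t', x)) (fun j x => V j (t, x))
        x x (χ * (s 0 x * Real.exp (-2 * k t * b 0 x)))
      simp only [hKe]
      rw [hsum]
      have he : Real.exp (-2 * k t * b 0 x)
          = Real.exp (-k t * b 0 x) * Real.exp (-k t * b 0 x) := by
        rw [← Real.exp_add]; congr 1; ring
      simp only [conjSq, weightedJet, slice, coefA, he]
      ring)
  have e1 : ∫ q in QDom T, vt q * N q = ∫ q in QDom T, vt q * (rateCutoff n (k q.1)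
      * (Real.exp (-k q.1 * b 0 q.2) * P q)) :=
    setIntegral_congr_fun (measurableSet_QDom T) fun q hq => by
      simp only [N, indicator_of_mem hq]
  rw [← e1, hmain]
  congr 1
  refine Finset.sum_congr rfl fun i _ => Finset.sum_congr rfl fun j _ => ?_
  exact setIntegral_congr_fun (measurableSet_QDom T) fun q hq => by
    simp only [K', indicator_of_mem hq]

end Identity

section Limit

open Filter Topology

variable {T M : ℝ} {k k' : ℝ → ℝ} {b s : ℕ → ℝ → ℝ} {V : ℕ → ℝ × ℝ → ℝ} {vt : ℝ × ℝ → ℝ}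

theorem tendsto_integral_rateCutoff_mul (hk : TimeRate T M k k') {f : ℝ × ℝ → ℝ}
    (hf : IntegrableOn f (QDom T)) :
    Tendsto (fun n => ∫ q in QDom T, rateCutoff n (k q.1) * f q) atTop
      (𝓝 (∫ q in QDom T, f q)) := by
  refine tendsto_integral_of_dominated_convergence (fun q => ‖f q‖) (fun n => ?_) hf.norm
    (fun n => Eventually.of_forall fun q => ?_) (Eventually.of_forall fun q => ?_)
  · exact ((contDiff_rateCutoff n).continuous.comp_aestronglyMeasurable
      hk.aestronglyMeasurable).mul hf.aestronglyMeasurable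
  · rw [norm_mul]
    exact mul_le_of_le_one_left (norm_nonneg _) (abs_rateCutoff_le n _)
  · refine tendsto_const_nhds.congr' ?_
    filter_upwards [eventually_ge_atTop ⌈k q.1⌉₊] with n hn
    rw [rateCutoff_eq_one, one_mul]
    exact (Nat.le_ceil _).trans (by exact_mod_cast hn.trans (Nat.le_succ n))

theorem tendsto_integral_deriv_rateCutoff_mul (hk : TimeRate T M k k') {f : ℝ × ℝ → ℝ}
    (hf : IntegrableOn f (QDom T)) :
    Tendsto (fun n => ∫ q in QDom T, deriv (rateCutoff n) (k q.1) * f q) atTop (𝓝 0) := by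
  obtain ⟨B, hB0, hB⟩ := exists_deriv_rateCutoff_bound
  have hlim : Tendsto (fun n : ℕ => B / ((n : ℝ) + 1)) atTop (𝓝 0) :=
    tendsto_const_div_atTop_nhds_zero_nat B |>.comp (tendsto_add_atTop_nat 1) |>.congr
      fun n => by simp
  have h : Tendsto (fun n => ∫ q in QDom T, deriv (rateCutoff n) (k q.1) * f q) atTop
      (𝓝 (∫ _q in QDom T, (0 : ℝ))) := by
    refine tendsto_integral_of_dominated_convergence (fun q => B * ‖f q‖) (fun n => ?_)
      (hf.norm.const_mul B) (fun n => Eventually.of_forall fun q => ?_)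
      (Eventually.of_forall fun q => ?_)
    · exact (((contDiff_rateCutoff n).continuous_deriv (by norm_num)).comp_aestronglyMeasurable
        hk.aestronglyMeasurable).mul hf.aestronglyMeasurable
    · rw [norm_mul]
      refine mul_le_mul_of_nonneg_right ((hB n _).trans ?_) (norm_nonneg _)
      exact div_le_self hB0 (by linarith [(Nat.cast_nonneg n : (0 : ℝ) ≤ n)])
    · have h1 : Tendsto (fun n => deriv (rateCutoff n) (k q.1)) atTop (𝓝 0) :=
        squeeze_zero_norm (fun n => hB n _) hlim
      simpa using h1.mul_const (f q)
  simpa using h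

/-- The energy identity: the pairing of `v_t` with the symmetric operator
`e^{-2kβ} (σ v'')'' + (σ (e^{-2kβ} v)'')''` is, up to sign, half of its form differentiated in
time. -/
theorem CarlemanData.integral_dt_mul_op (D : CarlemanData b s) (hk : TimeRate T M k k')
    (hV : IsL2H4H02 T V) (hvt : MemLp vt 2 (volume.restrict (QDom T)))
    (hdt : HasWeakDt T (V 0) vt) :
    ∫ q in QDom T, vt q * (Real.exp (-k q.1 * b 0 q.2)
      * (opX (fun j => s j q.2) (weightedJet b (k q.1) (slice V q.1) q.2)
        + opY (coefA b (k q.1) q.2) (fun j => s j q.2)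
          (weightedJet b (k q.1) (slice V q.1) q.2)))
    = -∫ q in QDom T, k' q.1 * formH (k q.1) (fun j => b j q.2) (fun j => s j q.2)
      (weightedJet b (k q.1) (slice V q.1) q.2) := by
  set W : ℝ × ℝ → ℝ := fun q => vt q * (Real.exp (-k q.1 * b 0 q.2)
      * (opX (fun j => s j q.2) (weightedJet b (k q.1) (slice V q.1) q.2)
        + opY (coefA b (k q.1) q.2) (fun j => s j q.2)
          (weightedJet b (k q.1) (slice V q.1) q.2))) with hW
  set H : ℝ × ℝ → ℝ := fun q => k' q.1 * formH (k q.1) (fun j => b j q.2) (fun j => s j q.2)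
      (weightedJet b (k q.1) (slice V q.1) q.2) with hH
  let G : ℝ × ℝ → ℝ := fun q => k' q.1 * (s 0 q.2
    * weightedJet b (k q.1) (slice V q.1) q.2 2)
    * conjSq (coefA b (k q.1) q.2) (weightedJet b (k q.1) (slice V q.1) q.2) 0
  have hWi : IntegrableOn W (QDom T) := hvt.integrable_mul (RapidL2.exp_mul hk (D.cont_b 0)
    D.b_zero_pos ((D.rapid_opX hk hV).add (D.rapid_opY hk hV)).memLp).memLp
  have hHi : IntegrableOn H (QDom T) := D.integrableOn_formH hk hV
  have hGi : IntegrableOn G (QDom T) :=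
    ((IsCoef.rateDeriv hk) _ (IsCoef.space (D.cont_s 0) _
      (D.rapid_weightedJet hk hV (by norm_num)))).integrable_mul
      (D.rapid_conjSq hk hV (by norm_num))
  have hkey : ∀ n : ℕ, 2 * ∫ q in QDom T, rateCutoff n (k q.1) * W q
      = -(2 * (∫ q in QDom T, deriv (rateCutoff n) (k q.1) * G q)
        + 2 * ∫ q in QDom T, rateCutoff n (k q.1) * H q) := by
    intro n
    have h0 := D.integral_cutoff hk hV hvt hdt n
    obtain ⟨A, hA0, hA⟩ := D.exists_cutCoef_bound n
    have hi : ∀ i j : Fin 3, IntegrableOn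
        (fun q => k' q.1 * cutCoefDeriv b s n i j (k q.1) q.2 * V i q * V j q) (QDom T) := by
      intro i j
      have h1 : IntegrableOn (fun q => V i q * V j q) (QDom T) :=
        (hV.memLp i (by omega)).integrable_mul (hV.memLp j (by omega))
      have h2 : AEStronglyMeasurable (fun q : ℝ × ℝ => k' q.1 * cutCoefDeriv b s n i j (k q.1) q.2)
          (volume.restrict (QDom T)) :=
        hk.aestronglyMeasurable_deriv.mul
          ((D.continuous_cutCoefDeriv n i j).comp_aestronglyMeasurable
            (hk.aestronglyMeasurable.prodMk continuous_snd.aestronglyMeasurable))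
      refine (Integrable.bdd_mul (c := |M| * A) h1 h2 ?_).congr
        (Eventually.of_forall fun q => by simp only; ring)
      filter_upwards [ae_restrict_mem (measurableSet_QDom T)] with q hq
      have hkp : 0 ≤ k q.1 := zero_le_one.trans (hk.one_le _ hq.1)
      have e1 := hk.deriv_le _ hq.1
      have e2 := (hA i j _ hkp _ (Ioo_subset_Icc_self hq.2)).2
      rw [abs_mul, abs_of_nonneg (sq_nonneg _)] at e2
      rw [norm_mul, Real.norm_eq_abs, Real.norm_eq_abs]
      calc |k' q.1| * |cutCoefDeriv b s n i j (k q.1) q.2|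
          ≤ (|M| * k q.1 ^ 2) * |cutCoefDeriv b s n i j (k q.1) q.2| := by
            refine mul_le_mul_of_nonneg_right (e1.trans ?_) (abs_nonneg _)
            exact mul_le_mul_of_nonneg_right (le_abs_self M) (sq_nonneg _)
        _ = |M| * (k q.1 ^ 2 * |cutCoefDeriv b s n i j (k q.1) q.2|) := by ring
        _ ≤ |M| * A := mul_le_mul_of_nonneg_left e2 (abs_nonneg _)
    have hχG : IntegrableOn (fun q => deriv (rateCutoff n) (k q.1) * G q) (QDom T) := by
      obtain ⟨B, -, hB⟩ := exists_deriv_rateCutoff_bound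
      exact Integrable.bdd_mul hGi (((contDiff_rateCutoff n).continuous_deriv
        (by norm_num)).comp_aestronglyMeasurable hk.aestronglyMeasurable)
        (Eventually.of_forall fun q => hB n _)
    have hχH : IntegrableOn (fun q => rateCutoff n (k q.1) * H q) (QDom T) :=
      Integrable.bdd_mul hHi ((contDiff_rateCutoff n).continuous.comp_aestronglyMeasurable
        hk.aestronglyMeasurable) (Eventually.of_forall fun q => abs_rateCutoff_le n _)
    have e0 : ∫ q in QDom T, rateCutoff n (k q.1) * W q = ∫ q in QDom T,
        vt q * (rateCutoff n (k q.1) * (Real.exp (-k q.1 * b 0 q.2)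
      * (opX (fun j => s j q.2) (weightedJet b (k q.1) (slice V q.1) q.2)
        + opY (coefA b (k q.1) q.2) (fun j => s j q.2)
          (weightedJet b (k q.1) (slice V q.1) q.2)))) := by
      congr 1; funext q; simp only [hW]; ring
    rw [e0, h0]
    simp_rw [← integral_finsetSum Finset.univ fun j _ => hi _ j]
    rw [← integral_finsetSum Finset.univ fun i _ =>
      integrable_finsetSum Finset.univ fun j _ => hi i j, ← integral_const_mul,
      ← integral_const_mul, ← integral_add (hχG.const_mul 2) (hχH.const_mul 2)]
    congr 2
    funext q
    set χ := rateCutoff n (k q.1) with hχ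
    set χ' := deriv (rateCutoff n) (k q.1) with hχ'
    set e := s 0 q.2 * Real.exp (-2 * k q.1 * b 0 q.2) with he
    have h1 := sum_formPoly (b := b) (k q.1) q.2 (fun j _ => V j q) (fun j _ => V j q) 0 0
      (k' q.1 * (χ' * e + χ * e * (-2 * b 0 q.2)))
    have h2 := sum_formPolyDeriv (b := b) (k q.1) q.2 (fun j => V j q) (k' q.1 * (χ * e))
    have h3 : ∑ i : Fin 3, ∑ j : Fin 3, k' q.1 * cutCoefDeriv b s n i j (k q.1) q.2 * V i q * V j q
        = (∑ i : Fin 3, ∑ j : Fin 3, V i q * (k' q.1 * (χ' * e + χ * e * (-2 * b 0 q.2))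
            * formPoly b (k q.1) q.2 i j * V j q))
          + ∑ i : Fin 3, ∑ j : Fin 3, k' q.1 * (χ * e)
            * formPolyDeriv b (k q.1) q.2 i j * V i q * V j q := by
      simp_rw [← Finset.sum_add_distrib]
      refine Finset.sum_congr rfl fun i _ => Finset.sum_congr rfl fun j _ => ?_
      simp only [cutCoefDeriv, ← hχ, ← hχ', he]
      ring
    rw [h3, h1, h2]
    have hee : Real.exp (-2 * k q.1 * b 0 q.2)
        = Real.exp (-k q.1 * b 0 q.2) * Real.exp (-k q.1 * b 0 q.2) := by
      rw [← Real.exp_add]; congr 1; ring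
    simp only [hH, G, formH, conjSq, weightedJet, slice, coefA, he, hee]
    ring
  have l1 := (tendsto_integral_rateCutoff_mul hk hWi).const_mul 2
  have l2 := (((tendsto_integral_deriv_rateCutoff_mul hk hGi).const_mul 2).add
    ((tendsto_integral_rateCutoff_mul hk hHi).const_mul 2)).neg
  simp only [hkey] at l1
  have := tendsto_nhds_unique l1 l2
  linarith

end Limit

/-! ### The time derivative and the principal part of the equation -/

theorem IsTestFun.dx {U : Set (ℝ × ℝ)} {ψ : ℝ × ℝ → ℝ} (h : IsTestFun U ψ) :
    IsTestFun U (dx ψ) := by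
  have hs : Function.support (_root_.dx ψ) ⊆ tsupport ψ := fun p hp =>
    support_fderiv_subset ℝ (fun h0 : fderiv ℝ ψ p = 0 => hp (by simp [_root_.dx, h0]))
  have hs' : tsupport (_root_.dx ψ) ⊆ tsupport ψ := closure_minimal hs (isClosed_tsupport ψ)
  exact ⟨(h.smooth.fderiv_right (by simp)).clm_apply contDiff_const,
    h.compact.of_isClosed_subset (isClosed_tsupport _) hs', hs'.trans h.supp⟩

theorem IsTestFun.hasACDeriv_slice {U : Set (ℝ × ℝ)} {ψ : ℝ × ℝ → ℝ} (h : IsTestFun U ψ) (t : ℝ) :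
    HasACDeriv (fun x => ψ (t, x)) (fun x => _root_.dx ψ (t, x)) := by
  have h0 := h.smooth.continuous
  have h1 := h.dx.smooth.continuous
  refine .of_hasDerivAt (by fun_prop) (by fun_prop) fun x _ => ?_
  have h2 : HasFDerivAt ψ (fderiv ℝ ψ (t, x)) (t, x) :=
    (h.smooth.differentiable (by simp) _).hasFDerivAt
  exact h2.comp_hasDerivAt x ((hasDerivAt_const x t).prodMk (hasDerivAt_id x))

theorem IsTestFun.integrableOn_mul {T : ℝ} {U : Set (ℝ × ℝ)} {ψ f : ℝ × ℝ → ℝ}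
    (h : IsTestFun U ψ) (hf : MemLp f 2 (volume.restrict (QDom T))) :
    IntegrableOn (fun q => f q * ψ q) (QDom T) :=
  hf.integrable_mul ((h.smooth.continuous.memLp_of_hasCompactSupport (p := 2) h.compact).restrict _)

theorem MeasureTheory.MemLp.space_mul {T : ℝ} {a : ℝ → ℝ} {f : ℝ × ℝ → ℝ} (ha : Continuous a)
    (hf : MemLp f 2 (volume.restrict (QDom T))) :
    MemLp (fun q => a q.2 * f q) 2 (volume.restrict (QDom T)) := by
  obtain ⟨A, hA⟩ := isCompact_Icc.exists_bound_of_continuousOn (ha.continuousOn (s := Icc 0 1))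
  refine MemLp.of_le_mul (c := A) hf
    ((ha.comp continuous_snd).aestronglyMeasurable.mul hf.1) ?_
  filter_upwards [ae_restrict_mem (measurableSet_QDom T)] with q hq
  rw [norm_mul]
  exact mul_le_mul_of_nonneg_right (hA q.2 (Ioo_subset_Icc_self hq.2)) (norm_nonneg _)

theorem LinftyBound.ae_le {T m : ℝ} {q : ℝ × ℝ → ℝ} (hm : 0 ≤ m) (h : LinftyBound T m q) :
    ∀ᵐ p ∂volume.restrict (QDom T), |q p| ≤ m := by
  filter_upwards [ae_le_eLpNormEssSup (f := q) (μ := volume.restrict (QDom T))] with p hp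
  have h1 := h.2
  rw [eLpNorm_exponent_top] at h1
  have h2 := hp.trans h1
  rwa [← ofReal_norm, ENNReal.ofReal_le_ofReal_iff hm, Real.norm_eq_abs] at h2

theorem LinftyBound.memLp_mul {T m : ℝ} {q f : ℝ × ℝ → ℝ} (hm : 0 ≤ m) (h : LinftyBound T m q)
    (hf : MemLp f 2 (volume.restrict (QDom T))) :
    MemLp (fun p => q p * f p) 2 (volume.restrict (QDom T)) := by
  refine MemLp.of_le_mul (c := m) hf (h.1.1.mul hf.1) ?_
  filter_upwards [h.ae_le hm] with p hp
  rw [norm_mul]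
  exact mul_le_mul_of_nonneg_right hp (norm_nonneg _)

section Equation

variable {T m : ℝ} {σ : ℝ → ℝ} {b s : ℕ → ℝ → ℝ} {V : ℕ → ℝ × ℝ → ℝ} {F q₀ q₁ q₂ : ℝ × ℝ → ℝ}

/-- The function `(σ v_xx)_xx`, with `s j = σ^{(j)}`. -/
def principalPart (s : ℕ → ℝ → ℝ) (V : ℕ → ℝ × ℝ → ℝ) (q : ℝ × ℝ) : ℝ :=
  opX (fun j => s j q.2) fun j => V j q

/-- `F = L v` without the terms of lower order, that is `v_t + (σ v_xx)_xx`. -/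
def reducedSource (q₀ q₁ q₂ : ℝ × ℝ → ℝ) (V : ℕ → ℝ × ℝ → ℝ) (F : ℝ × ℝ → ℝ) (p : ℝ × ℝ) : ℝ :=
  F p - (q₂ p * V 2 p + q₁ p * V 1 p + q₀ p * V 0 p)

theorem CarlemanData.memLp_principalPart (D : CarlemanData b s) (hV : IsL2H4H02 T V) :
    MemLp (principalPart s V) 2 (volume.restrict (QDom T)) :=
  (((hV.memLp 4 le_rfl).space_mul (D.cont_s 0)).add
    ((hV.memLp 3 (by norm_num)).space_mul (continuous_const.mul (D.cont_s 1)))).add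
    ((hV.memLp 2 (by norm_num)).space_mul (D.cont_s 2))

theorem memLp_reducedSource (hm : 0 ≤ m) (h₀ : LinftyBound T m q₀) (h₁ : LinftyBound T m q₁)
    (h₂ : LinftyBound T m q₂) (hV : MemSpaceV T σ q₀ q₁ q₂ V F) :
    MemLp (reducedSource q₀ q₁ q₂ V F) 2 (volume.restrict (QDom T)) :=
  hV.memLp.sub (((h₂.memLp_mul hm (hV.reg.memLp 2 (by norm_num))).add
    (h₁.memLp_mul hm (hV.reg.memLp 1 (by norm_num)))).add
    (h₀.memLp_mul hm (hV.reg.memLp 0 (by norm_num))))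

theorem CarlemanData.hasWeakDxx (D : CarlemanData b s) (hs : ∀ x ∈ Icc (0 : ℝ) 1, s 0 x = σ x)
    (hV : IsL2H4H02 T V) : HasWeakDxx T (fun p => σ p.2 * V 2 p) (principalPart s V) := by
  intro ψ hψ
  have hA : MemLp (fun p : ℝ × ℝ => s 0 p.2 * V 2 p) 2 (volume.restrict (QDom T)) :=
    (hV.memLp 2 (by norm_num)).space_mul (D.cont_s 0)
  have i1 := hψ.dx.dx.integrableOn_mul hA
  have i2 := hψ.integrableOn_mul (D.memLp_principalPart hV)
  have e1 : ∫ p in QDom T, σ p.2 * V 2 p * dx (dx ψ) p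
      = ∫ p in QDom T, s 0 p.2 * V 2 p * dx (dx ψ) p :=
    setIntegral_congr_fun (measurableSet_QDom T) fun p hp => by
      simp only [hs p.2 (Ioo_subset_Icc_self hp.2)]
  rw [e1, ← sub_eq_zero, ← integral_sub i1 i2, integral_QDom
    (f := fun p => s 0 p.2 * V 2 p * dx (dx ψ) p - principalPart s V p * ψ p) (i1.sub i2)]
  refine integral_eq_zero_of_ae ?_
  filter_upwards [hV.jet] with t ht
  have hz : ∀ x, x = 0 ∨ x = 1 → ((t, x) : ℝ × ℝ) ∉ QDom T := by
    rintro x hx ⟨-, h1⟩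
    rcases hx with rfl | rfl
    · exact lt_irrefl _ h1.1
    · exact lt_irrefl _ h1.2
  have hp := hψ.hasACDeriv_slice t
  have hp' := hψ.dx.hasACDeriv_slice t
  have a0 := (D.hasACDeriv_s (j := 0) (by norm_num)).mul (ht.hasACDeriv (j := 2) (by norm_num))
  have a1 := ((D.hasACDeriv_s (j := 1) (by norm_num)).mul
    (ht.hasACDeriv (j := 2) (by norm_num))).add
    ((D.hasACDeriv_s (j := 0) (by norm_num)).mul (ht.hasACDeriv (j := 3) (by norm_num)))
  have h := ((a0.mul hp').sub (a1.mul hp)).integral_eq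
  simp only [hψ.eq_zero (hz 0 (.inl rfl)), hψ.eq_zero (hz 1 (.inr rfl)),
    hψ.dx.eq_zero (hz 0 (.inl rfl)), hψ.dx.eq_zero (hz 1 (.inr rfl)), mul_zero, sub_zero] at h
  refine Eq.trans ?_ h
  congr 1
  funext x
  simp only [principalPart, opX]
  ring

/-- The equation determines the time derivative. -/
theorem CarlemanData.hasWeakDt (D : CarlemanData b s) (hs : ∀ x ∈ Icc (0 : ℝ) 1, s 0 x = σ x)
    (hm : 0 ≤ m) (h₀ : LinftyBound T m q₀) (h₁ : LinftyBound T m q₁) (h₂ : LinftyBound T m q₂)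
    (hV : MemSpaceV T σ q₀ q₁ q₂ V F) :
    HasWeakDt T (V 0) fun p => reducedSource q₀ q₁ q₂ V F p - principalPart s V p := by
  intro ψ hψ
  have hdt : Continuous (dt ψ) := by
    have := hψ.smooth.continuous_fderiv (by simp)
    unfold dt; fun_prop
  have hdtc : HasCompactSupport (dt ψ) := by
    refine (hψ.compact.fderiv (𝕜 := ℝ)).comp_left (g := fun L : (ℝ × ℝ) →L[ℝ] ℝ => L (1, 0)) ?_
    simp
  have i0 : IntegrableOn (fun p => V 0 p * dt ψ p) (QDom T) :=
    (hV.reg.memLp 0 (by norm_num)).integrable_mul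
      ((hdt.memLp_of_hasCompactSupport (p := 2) hdtc).restrict _)
  have i1 : IntegrableOn (fun p => σ p.2 * V 2 p * dx (dx ψ) p) (QDom T) :=
    (hψ.dx.dx.integrableOn_mul ((hV.reg.memLp 2 (by norm_num)).space_mul (D.cont_s 0))).congr_fun
      (fun p hp => by simp only [hs p.2 (Ioo_subset_Icc_self hp.2)]) (measurableSet_QDom T)
  have hlow := (((h₂.memLp_mul hm (hV.reg.memLp 2 (by norm_num))).add
    (h₁.memLp_mul hm (hV.reg.memLp 1 (by norm_num)))).add
    (h₀.memLp_mul hm (hV.reg.memLp 0 (by norm_num))))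
  have i2 : IntegrableOn (fun p => (q₂ p * V 2 p + q₁ p * V 1 p + q₀ p * V 0 p) * ψ p) (QDom T) :=
    hψ.integrableOn_mul hlow
  have i3 := hψ.integrableOn_mul hV.memLp
  have i4 := hψ.integrableOn_mul (D.memLp_principalPart hV.reg)
  have hxx := D.hasWeakDxx hs hV.reg ψ hψ
  have heq := hV.eq ψ hψ
  have e1 : ∫ p in QDom T, (-(V 0 p * dt ψ p) + σ p.2 * V 2 p * dx (dx ψ) p
        + (q₂ p * V 2 p + q₁ p * V 1 p + q₀ p * V 0 p) * ψ p)
      = -(∫ p in QDom T, V 0 p * dt ψ p) + (∫ p in QDom T, σ p.2 * V 2 p * dx (dx ψ) p)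
        + ∫ p in QDom T, (q₂ p * V 2 p + q₁ p * V 1 p + q₀ p * V 0 p) * ψ p := by
    have j0 : IntegrableOn (fun p => -(V 0 p * dt ψ p)) (QDom T) := i0.neg
    have j1 : IntegrableOn (fun p => -(V 0 p * dt ψ p) + σ p.2 * V 2 p * dx (dx ψ) p) (QDom T) :=
      j0.add i1
    rw [integral_add j1 i2, integral_add j0 i1, integral_neg]
  have e2 : ∫ p in QDom T, (reducedSource q₀ q₁ q₂ V F p - principalPart s V p) * ψ p
      = (∫ p in QDom T, F p * ψ p)
        - (∫ p in QDom T, (q₂ p * V 2 p + q₁ p * V 1 p + q₀ p * V 0 p) * ψ p)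
        - ∫ p in QDom T, principalPart s V p * ψ p := by
    have j0 : IntegrableOn (fun p => F p * ψ p
        - (q₂ p * V 2 p + q₁ p * V 1 p + q₀ p * V 0 p) * ψ p) (QDom T) := i3.sub i2
    rw [← integral_sub i3 i2, ← integral_sub j0 i4]
    congr 1
    funext p
    simp only [reducedSource]
    ring
  rw [e2, ← heq, e1, hxx]
  ring

end Equation

/-! ### Integrability of the energy and of the traces -/

section Energy

variable {T M : ℝ} {k k' : ℝ → ℝ} {b s : ℕ → ℝ → ℝ} {V : ℕ → ℝ × ℝ → ℝ}

theorem CarlemanData.rapid_conjJet (D : CarlemanData b s) (hk : TimeRate T M k k')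
    (hV : IsL2H4H02 T V) {j : ℕ} (hj : j < 4) :
    RapidL2 T k fun q =>
      conjJet (coefA b (k q.1) q.2) (weightedJet b (k q.1) (slice V q.1) q.2) j := by
  have u := fun j (hj : j ≤ 4) => D.rapid_weightedJet hk hV hj
  have u0 := u 0 (by norm_num)
  have u1 := u 1 (by norm_num)
  have u2 := u 2 (by norm_num)
  have u3 := u 3 (by norm_num)
  have a0 := D.isCoef_coefA (T := T) (k := k) 0
  have a1 := D.isCoef_coefA (T := T) (k := k) 1
  have a2 := D.isCoef_coefA (T := T) (k := k) 2
  have c := fun r => IsCoef.const (T := T) (k := k) r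
  interval_cases j
  · exact u0
  · exact u1.sub (a0 _ u0)
  · exact (u2.sub (((c 2).mul a0) _ u1)).add (((a0.pow 2).sub a1) _ u0)
  · refine (((u3.sub (((c 3).mul a0) _ u2)).add
      ((((c 3).mul (a0.pow 2)).sub ((c 3).mul a1)) _ u1)).add
      (((((a0.pow 3).neg).add (((c 3).mul a0).mul a1)).sub a2) _ u0)).congr fun q => ?_
    simp only [conjJet]

theorem CarlemanData.rapid_scaledJet (D : CarlemanData b s) (hk : TimeRate T M k k')
    (hV : IsL2H4H02 T V) (i : Fin 4) :
    RapidL2 T k fun q => scaledJet (k q.1) (fun j => b j q.2)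
      (weightedJet b (k q.1) (slice V q.1) q.2) i := by
  have hinv : IsCoef T k fun q => (k q.1)⁻¹ :=
    IsCoef.of_bound (A := 1) hk.aestronglyMeasurable.inv₀ fun q hq => by
      have h1 := hk.one_le _ hq.1
      rw [abs_of_nonneg (by positivity)]
      exact inv_le_one_of_one_le₀ h1
  refine ((hinv.pow i) _ (D.rapid_conjJet hk hV i.2)).congr fun q => ?_
  simp only [scaledJet, inv_pow, div_eq_inv_mul]
  rfl

theorem CarlemanData.integrableOn_pow_mul_energy (D : CarlemanData b s) (hk : TimeRate T M k k')
    (hV : IsL2H4H02 T V) (n : ℕ) :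
    IntegrableOn (fun q => k q.1 ^ n * CarlemanData.energy b (k q.1) (slice V q.1) q.2)
      (QDom T) := by
  have h := integrable_finsetSum (μ := volume.restrict (QDom T)) Finset.univ fun i (_ : i ∈ _) =>
    (D.rapid_scaledJet hk hV i).integrable_pow_mul (D.rapid_scaledJet hk hV i) n
  refine h.congr (Filter.Eventually.of_forall fun q => ?_)
  simp only [CarlemanData.energy, Finset.mul_sum, sq]

theorem CarlemanData.rapid_symmPart (D : CarlemanData b s) (hk : TimeRate T M k k')
    (hV : IsL2H4H02 T V) :
    RapidL2 T k fun q => CarlemanData.symmPart b s (k q.1) (slice V q.1) q.2 :=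
  ((IsCoef.const (1 / 2)) _ ((D.rapid_opX hk hV).add (D.rapid_opY hk hV))).congr fun q => by
    rw [CarlemanData.symmPart]; ring

theorem CarlemanData.rapid_skewPart (D : CarlemanData b s) (hk : TimeRate T M k k')
    (hV : IsL2H4H02 T V) :
    RapidL2 T k fun q => CarlemanData.skewPart b s (k q.1) (slice V q.1) q.2 :=
  ((IsCoef.const (1 / 2)) _ ((D.rapid_opX hk hV).sub (D.rapid_opY hk hV))).congr fun q => by
    rw [CarlemanData.skewPart]; ring

end Energy

theorem sq_integral_le {f : ℝ → ℝ} (hf : IntegrableOn f (Ioo 0 1))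
    (hf2 : IntegrableOn (fun x => f x ^ 2) (Ioo 0 1)) :
    (∫ x in Ioo (0 : ℝ) 1, f x) ^ 2 ≤ ∫ x in Ioo (0 : ℝ) 1, f x ^ 2 := by
  set c := ∫ x in Ioo (0 : ℝ) 1, f x with hc
  have h0 : 0 ≤ ∫ x in Ioo (0 : ℝ) 1, (f x - c) ^ 2 := integral_nonneg fun x => sq_nonneg _
  have e : ∀ x, (f x - c) ^ 2 = f x ^ 2 + (c ^ 2 - 2 * c * f x) := fun x => by ring
  have hconst : IntegrableOn (fun _ : ℝ => c ^ 2) (Ioo (0 : ℝ) 1) :=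
    integrableOn_const (by simp)
  simp_rw [e] at h0
  have hlin : IntegrableOn (fun x => c ^ 2 - 2 * c * f x) (Ioo 0 1) :=
    hconst.sub (hf.const_mul (2 * c))
  rw [integral_add hf2 hlin, integral_sub hconst (hf.const_mul _),
    integral_const_mul, ← hc] at h0
  simp at h0
  linarith

/-- The trace at `x = 0` as an integral of the derivatives. -/
theorem IsSobolevJet.eq_integral {n : ℕ} {v : ℕ → ℝ → ℝ} (hv : IsSobolevJet n v) {j : ℕ}
    (hj : j < n) : v j 0 = ∫ x in Ioo (0 : ℝ) 1, (v j x + (x - 1) * v (j + 1) x) := by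
  have h1 : HasACDeriv (fun x : ℝ => x - 1) fun _ => 1 :=
    .of_hasDerivAt (by fun_prop) (by fun_prop) fun x _ => (hasDerivAt_id x).sub_const 1
  have h2 := (h1.mul (hv.hasACDeriv hj)).integral_eq
  simp only [sub_self, zero_mul, zero_sub, one_mul, neg_mul, neg_neg] at h2
  exact h2.symm

/-- The traces at `x = 0` are square integrable in time. -/
theorem IsL2H4H02.integrableOn_trace {T A : ℝ} {V : ℕ → ℝ × ℝ → ℝ} (hV : IsL2H4H02 T V) {j : ℕ}
    (hj : j < 4) {w : ℝ → ℝ} (hw : AEStronglyMeasurable w (volume.restrict (Ioo 0 T)))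
    (hA : ∀ t ∈ Ioo 0 T, |w t| ≤ A) :
    IntegrableOn (fun t => w t * V j (t, 0) ^ 2) (Ioo 0 T) := by
  let G : ℝ × ℝ → ℝ := fun q => V j q + (q.2 - 1) * V (j + 1) q
  have hG : MemLp G 2 (volume.restrict (QDom T)) := (hV.memLp j hj.le).add
    ((hV.memLp (j + 1) hj).space_mul (a := fun x => x - 1) (by fun_prop))
  have hG1 : IntegrableOn G (QDom T) := hG.integrable one_le_two
  have hG2 : IntegrableOn (fun q => G q ^ 2) (QDom T) := hG.integrable_sq
  have htr : ∀ᵐ t ∂volume.restrict (Ioo 0 T), V j (t, 0) = ∫ x in Ioo (0 : ℝ) 1, G (t, x) := by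
    filter_upwards [hV.jet] with t ht using ht.eq_integral hj
  have hm : AEStronglyMeasurable (fun t => V j (t, 0)) (volume.restrict (Ioo 0 T)) :=
    (integrableOn_integral_slice hG1).aestronglyMeasurable.congr
      (htr.mono fun t ht => ht.symm)
  refine Integrable.mono' ((integrableOn_integral_slice hG2).const_mul A) (hw.mul (hm.pow 2)) ?_
  filter_upwards [htr, ae_integrableOn_slice hG1, ae_integrableOn_slice hG2,
    ae_restrict_mem measurableSet_Ioo] with t h1 h2 h3 h4
  rw [norm_mul, norm_pow, Real.norm_eq_abs, Real.norm_eq_abs, sq_abs, h1]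
  exact mul_le_mul (hA t h4) (sq_integral_le h2 h3) (sq_nonneg _)
    ((abs_nonneg _).trans (hA t h4))

theorem CarlemanData.integrableOn_trace {T M : ℝ} {k k' : ℝ → ℝ} {b s : ℕ → ℝ → ℝ}
    {V : ℕ → ℝ × ℝ → ℝ} (D : CarlemanData b s) (hk : TimeRate T M k k') (hV : IsL2H4H02 T V)
    (n : ℕ) {j : ℕ} (hj : j < 4) :
    IntegrableOn (fun t => k t ^ n * weightedJet b (k t) (slice V t) 0 j ^ 2) (Ioo 0 T) := by
  have hkm : AEStronglyMeasurable k (volume.restrict (Ioo 0 T)) :=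
    hk.continuousOn.aestronglyMeasurable measurableSet_Ioo
  have hb : 0 < 2 * b 0 0 := by linarith [D.b_zero_pos 0 (by simp)]
  have h := hV.integrableOn_trace hj (w := fun t => k t ^ n * Real.exp (-k t * (2 * b 0 0)))
    (A := n.factorial / (2 * b 0 0) ^ n)
    ((hkm.pow n).mul (Real.continuous_exp.comp_aestronglyMeasurable (hkm.neg.mul_const _)))
    fun t ht => by
      have h0 : 0 ≤ k t := zero_le_one.trans (hk.one_le t ht)
      rw [abs_of_nonneg (by positivity)]
      exact pow_mul_exp_neg_le h0 hb n
  refine h.congr (Filter.Eventually.of_forall fun t => ?_)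
  have e : Real.exp (-k t * (2 * b 0 0)) = Real.exp (-k t * b 0 0) ^ 2 := by
    rw [← Real.exp_nat_mul]; congr 1; push_cast; ring
  simp only [e, weightedJet, slice]
  ring

/-! ### The Carleman inequality for the weighted functions -/

section Estimate

variable {T M m : ℝ} {k k' σ : ℝ → ℝ} {b s : ℕ → ℝ → ℝ} {V : ℕ → ℝ × ℝ → ℝ}
  {F q₀ q₁ q₂ : ℝ × ℝ → ℝ}

namespace CarlemanData

/-- The density of the boundary terms at `x = 0`. -/
def traceEnergy (b : ℕ → ℝ → ℝ) (k : ℝ) (v : ℕ → ℝ → ℝ) : ℝ :=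
  k ^ 3 * weightedJet b k v 0 2 ^ 2 + k * weightedJet b k v 0 3 ^ 2

theorem energy_nonneg (b : ℕ → ℝ → ℝ) (k : ℝ) (v : ℕ → ℝ → ℝ) (x : ℝ) : 0 ≤ energy b k v x :=
  Finset.sum_nonneg fun _ _ => sq_nonneg _

theorem weightedJet_sq_le {B κ x : ℝ} (hk : 1 ≤ κ)
    (hB : ∀ ε ∈ Icc (0 : ℝ) 1, ∀ z : Fin 4 → ℝ, ∀ j < 4,
      uForm (fun j => b j x) ε z j ^ 2 ≤ B * ∑ i, z i ^ 2) (v : ℕ → ℝ → ℝ) {j : ℕ} (hj : j < 4) :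
    weightedJet b κ v x j ^ 2 ≤ κ ^ (2 * j) * (B * energy b κ v x) := by
  have hk0 : κ ≠ 0 := by positivity
  rw [eq_pow_mul_uForm (fun j => b j x) (weightedJet b κ v x) hk0 hj, mul_pow, ← pow_mul,
    mul_comm j 2]
  exact mul_le_mul_of_nonneg_left
    (hB _ ⟨by positivity, inv_le_one_of_one_le₀ hk⟩ _ j hj) (by positivity)

/-- The energy identity applied to the equation `v_t + (σ v_xx)_xx = R`. -/
theorem integral_symmPart_le (D : CarlemanData b s) (hk : TimeRate T M k k')
    (hV : IsL2H4H02 T V) {R : ℝ × ℝ → ℝ} (hR : MemLp R 2 (volume.restrict (QDom T)))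
    (hdt : HasWeakDt T (V 0) fun q => R q - principalPart s V q) :
    ∫ q in QDom T, (symmPart b s (k q.1) (slice V q.1) q.2 ^ 2
        + 2 * symmPart b s (k q.1) (slice V q.1) q.2 * skewPart b s (k q.1) (slice V q.1) q.2)
      ≤ ∫ q in QDom T, ((Real.exp (-k q.1 * b 0 q.2) * R q) ^ 2
        + k' q.1 * formH (k q.1) (fun j => b j q.2) (fun j => s j q.2)
          (weightedJet b (k q.1) (slice V q.1) q.2)) := by
  have h := D.integral_dt_mul_op (vt := fun q => R q - principalPart s V q) hk hV
    (hR.sub (D.memLp_principalPart hV)) hdt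
  have r1 := D.rapid_symmPart hk hV
  have r2 := D.rapid_skewPart hk hV
  have rf := RapidL2.exp_mul hk (D.cont_b 0) D.b_zero_pos hR
  have iH := D.integrableOn_formH hk hV
  set f : ℝ × ℝ → ℝ := fun q => Real.exp (-k q.1 * b 0 q.2) * R q with hf
  set P₁ : ℝ × ℝ → ℝ := fun q => symmPart b s (k q.1) (slice V q.1) q.2 with hP₁
  set P₂ : ℝ × ℝ → ℝ := fun q => skewPart b s (k q.1) (slice V q.1) q.2 with hP₂
  set H : ℝ × ℝ → ℝ := fun q => k' q.1 * formH (k q.1) (fun j => b j q.2) (fun j => s j q.2)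
    (weightedJet b (k q.1) (slice V q.1) q.2) with hH
  have i11 : IntegrableOn (fun q => P₁ q ^ 2) (QDom T) := r1.memLp.integrable_sq
  have iff : IntegrableOn (fun q => f q ^ 2) (QDom T) := rf.memLp.integrable_sq
  have i12 := r1.integrable_mul r2
  have if1 := rf.integrable_mul r1
  have hI : IntegrableOn (fun q => P₁ q ^ 2 + 2 * P₁ q * P₂ q) (QDom T) :=
    (i11.add (i12.const_mul 2)).congr (Filter.Eventually.of_forall fun q => by simp; ring)
  have hJ : IntegrableOn (fun q => 2 * (f q * P₁ q) - P₁ q ^ 2) (QDom T) :=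
    (if1.const_mul 2).sub i11
  have e : ∀ q, (R q - principalPart s V q) * (Real.exp (-k q.1 * b 0 q.2)
      * (opX (fun j => s j q.2) (weightedJet b (k q.1) (slice V q.1) q.2)
        + opY (coefA b (k q.1) q.2) (fun j => s j q.2)
          (weightedJet b (k q.1) (slice V q.1) q.2)))
      = (2 * (f q * P₁ q) - P₁ q ^ 2) - (P₁ q ^ 2 + 2 * P₁ q * P₂ q) := by
    intro q
    have e1 : Real.exp (-k q.1 * b 0 q.2) * principalPart s V q = P₁ q + P₂ q := by
      simp only [hP₁, hP₂, symmPart, skewPart, principalPart, opX, weightedJet, slice]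
      ring
    have e2 : opX (fun j => s j q.2) (weightedJet b (k q.1) (slice V q.1) q.2)
        + opY (coefA b (k q.1) q.2) (fun j => s j q.2)
          (weightedJet b (k q.1) (slice V q.1) q.2) = 2 * P₁ q := by
      simp only [hP₁, symmPart]
      ring
    rw [e2]
    linear_combination (2 * P₁ q) * (-e1)
  simp only [e] at h
  rw [integral_sub hJ hI] at h
  have h2 : ∫ q in QDom T, (2 * (f q * P₁ q) - P₁ q ^ 2) ≤ ∫ q in QDom T, f q ^ 2 :=
    integral_mono hJ iff fun q => by nlinarith [sq_nonneg (f q - P₁ q)]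
  rw [integral_add iff iH]
  linarith

/-- The terms of lower order in `L` are bounded by the energy `e`. -/
theorem exp_mul_reducedSource_sq_le {B κ : ℝ} {q : ℝ × ℝ} (hκ : 1 ≤ κ)
    (h₀ : |q₀ q| ≤ m) (h₁ : |q₁ q| ≤ m) (h₂ : |q₂ q| ≤ m) {e : ℝ} (he : 0 ≤ e)
    (hu : ∀ j < 4, weightedJet b κ (slice V q.1) q.2 j ^ 2 ≤ κ ^ (2 * j) * (B * e)) (hB : 0 ≤ B) :
    (Real.exp (-κ * b 0 q.2) * reducedSource q₀ q₁ q₂ V F q) ^ 2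
      ≤ 2 * (Real.exp (-κ * b 0 q.2) * F q) ^ 2 + 18 * m ^ 2 * B * (κ ^ 4 * e) := by
  set E := Real.exp (-κ * b 0 q.2) with hE
  have hsq : ∀ (a : ℝ) (j : ℕ), |a| ≤ m → j ≤ 2 →
      (a * (E * V j q)) ^ 2 ≤ m ^ 2 * (κ ^ 4 * (B * e)) := by
    intro a j ha hj
    rw [mul_pow]
    refine mul_le_mul (sq_le_sq' (by linarith [(abs_le.1 ha).1]) (abs_le.1 ha).2)
      ((hu j (by omega)).trans ?_) (sq_nonneg _) (sq_nonneg _)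
    exact mul_le_mul_of_nonneg_right (pow_le_pow_right₀ hκ (by omega)) (by positivity)
  have a0 := hsq _ 0 h₀ (by norm_num)
  have a1 := hsq _ 1 h₁ (by norm_num)
  have a2 := hsq _ 2 h₂ (by norm_num)
  have e1 : E * reducedSource q₀ q₁ q₂ V F q
      = E * F q - (q₂ q * (E * V 2 q) + q₁ q * (E * V 1 q) + q₀ q * (E * V 0 q)) := by
    rw [reducedSource]; ring
  rw [e1]
  set A := E * F q
  set x := q₂ q * (E * V 2 q)
  set y := q₁ q * (E * V 1 q)
  set z := q₀ q * (E * V 0 q)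
  nlinarith [sq_nonneg (A + (x + y + z)), sq_nonneg (x - y), sq_nonneg (x - z), sq_nonneg (y - z)]

/-- The Carleman inequality in terms of the functions `e^{-kβ} ∂_x^j v`. -/
theorem exists_weighted_bound (D : CarlemanData b s) (hs : ∀ x ∈ Icc (0 : ℝ) 1, s 0 x = σ x)
    (hm : 0 ≤ m) (hM : 0 ≤ M) : ∃ c, 0 < c ∧ ∃ k₀, 1 ≤ k₀ ∧ ∃ C, 0 < C ∧
      ∀ (T : ℝ) (k k' : ℝ → ℝ), TimeRate T M k k' → (∀ t ∈ Ioo 0 T, k₀ ≤ k t) →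
      ∀ (q₀ q₁ q₂ : ℝ × ℝ → ℝ), LinftyBound T m q₀ → LinftyBound T m q₁ → LinftyBound T m q₂ →
      ∀ (V : ℕ → ℝ × ℝ → ℝ) (F : ℝ × ℝ → ℝ), MemSpaceV T σ q₀ q₁ q₂ V F →
        ∫ q in QDom T, (symmPart b s (k q.1) (slice V q.1) q.2 ^ 2 / 2
          + c * (k q.1 ^ 7 * energy b (k q.1) (slice V q.1) q.2))
        ≤ C * ((∫ q in QDom T, (Real.exp (-k q.1 * b 0 q.2) * F q) ^ 2)
          + ∫ t in Ioo 0 T, traceEnergy b (k t) (slice V t)) := by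
  obtain ⟨c, hc, k₀, hk₀, C, hC, hslice⟩ := D.exists_slice_bound
  obtain ⟨B, hB, hforms⟩ := D.exists_forms_bound
  set N := 18 * m ^ 2 * B + M * B with hN
  have hN0 : 0 ≤ N := by positivity
  -- for `2 * N / c ≤ k` half of the energy absorbs the terms of order `k ^ 6`
  refine ⟨c / 2, by positivity, max k₀ (2 * N / c), hk₀.trans (le_max_left _ _), 2 + C,
    by positivity, ?_⟩
  intro T k k' hk hkk q₀ q₁ q₂ h₀ h₁ h₂ V F hV
  have hR := memLp_reducedSource hm h₀ h₁ h₂ hV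
  have hdt := D.hasWeakDt hs hm h₀ h₁ h₂ hV
  have hVr := hV.reg
  have hle := D.integral_symmPart_le hk hVr hR hdt
  have r1 := D.rapid_symmPart hk hVr
  have r2 := D.rapid_skewPart hk hVr
  have rf := RapidL2.exp_mul hk (D.cont_b 0) D.b_zero_pos hR
  have rF := RapidL2.exp_mul hk (D.cont_b 0) D.b_zero_pos hV.memLp
  have iH := D.integrableOn_formH hk hVr
  have i7 := D.integrableOn_pow_mul_energy hk hVr 7
  have iL : IntegrableOn (fun q => symmPart b s (k q.1) (slice V q.1) q.2 ^ 2 / 2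
      + c * (k q.1 ^ 7 * energy b (k q.1) (slice V q.1) q.2)) (QDom T) :=
    (r1.memLp.integrable_sq.div_const 2).add (i7.const_mul c)
  have iI : IntegrableOn (fun q => symmPart b s (k q.1) (slice V q.1) q.2 ^ 2
      + 2 * symmPart b s (k q.1) (slice V q.1) q.2 * skewPart b s (k q.1) (slice V q.1) q.2)
      (QDom T) :=
    (r1.memLp.integrable_sq.add ((r1.integrable_mul r2).const_mul 2)).congr
      (Filter.Eventually.of_forall fun q => by simp; ring)
  have itr : IntegrableOn (fun t => traceEnergy b (k t) (slice V t)) (Ioo 0 T) :=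
    ((D.integrableOn_trace hk hVr 3 (j := 2) (by norm_num)).add
      (D.integrableOn_trace hk hVr 1 (j := 3) (by norm_num))).congr
      (Filter.Eventually.of_forall fun t => by simp [traceEnergy])
  have iF : IntegrableOn (fun q => (Real.exp (-k q.1 * b 0 q.2) * F q) ^ 2) (QDom T) :=
    rF.memLp.integrable_sq
  have htr0 : 0 ≤ ∫ t in Ioo 0 T, traceEnergy b (k t) (slice V t) :=
    setIntegral_nonneg measurableSet_Ioo fun t ht => by
      have : 0 ≤ k t := zero_le_one.trans (hk.one_le t ht)
      simp only [traceEnergy]; positivity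
  have hF0 : 0 ≤ ∫ q in QDom T, (Real.exp (-k q.1 * b 0 q.2) * F q) ^ 2 :=
    integral_nonneg fun q => sq_nonneg _
  -- integration in time of the inequality on the slices
  have hint : ∫ q in QDom T, (symmPart b s (k q.1) (slice V q.1) q.2 ^ 2 / 2
        + c * (k q.1 ^ 7 * energy b (k q.1) (slice V q.1) q.2))
      ≤ (∫ q in QDom T, (symmPart b s (k q.1) (slice V q.1) q.2 ^ 2
        + 2 * symmPart b s (k q.1) (slice V q.1) q.2 * skewPart b s (k q.1) (slice V q.1) q.2))
        + C * ∫ t in Ioo 0 T, traceEnergy b (k t) (slice V t) := by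
    rw [integral_QDom iL, integral_QDom iI, ← integral_const_mul,
      ← integral_add (integrableOn_integral_slice iI) (itr.const_mul C)]
    refine integral_mono_ae (integrableOn_integral_slice iL)
      ((integrableOn_integral_slice iI).add (itr.const_mul C)) ?_
    filter_upwards [hVr.jet, hVr.zero, ae_integrableOn_slice iL, ae_integrableOn_slice iI,
      ae_restrict_mem measurableSet_Ioo] with t hj hz h1 h2 ht
    exact hslice (k t) ((le_max_left _ _).trans (hkk t ht)) (slice V t) hj hz.1 hz.2.1 hz.2.2.1
      hz.2.2.2 h1 h2
  -- the lower order terms are absorbed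
  have hsrc : ∫ q in QDom T, ((Real.exp (-k q.1 * b 0 q.2) * reducedSource q₀ q₁ q₂ V F q) ^ 2
        + k' q.1 * formH (k q.1) (fun j => b j q.2) (fun j => s j q.2)
          (weightedJet b (k q.1) (slice V q.1) q.2))
      ≤ ∫ q in QDom T, (2 * (Real.exp (-k q.1 * b 0 q.2) * F q) ^ 2
        + c / 2 * (k q.1 ^ 7 * energy b (k q.1) (slice V q.1) q.2)) := by
    refine integral_mono_ae (rf.memLp.integrable_sq.add iH)
      ((iF.const_mul 2).add (i7.const_mul (c / 2))) ?_
    filter_upwards [h₀.ae_le hm, h₁.ae_le hm, h₂.ae_le hm,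
      ae_restrict_mem (measurableSet_QDom T)] with q a0 a1 a2 hq
    have hk1 := hk.one_le _ hq.1
    have hx := Ioo_subset_Icc_self hq.2
    have hkN := (le_max_right _ _).trans (hkk _ hq.1)
    rw [div_le_iff₀ hc] at hkN
    set κ := k q.1
    set e := energy b κ (slice V q.1) q.2 with he
    have he0 : 0 ≤ e := energy_nonneg _ _ _ _
    have hκ0 : κ ≠ 0 := by positivity
    have hε : κ⁻¹ ∈ Icc (0 : ℝ) 1 := ⟨by positivity, inv_le_one_of_one_le₀ hk1⟩
    have h1 := exp_mul_reducedSource_sq_le (F := F) (V := V) (b := b) (B := B) (e := e) hk1 a0 a1 a2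
      he0 (fun j hj => weightedJet_sq_le hk1
        (fun ε hε z => (hforms q.2 hx ε hε z).1) (slice V q.1) hj) hB.le
    have h2 : |formH κ (fun j => b j q.2) (fun j => s j q.2) (weightedJet b κ (slice V q.1) q.2)|
        ≤ κ ^ 4 * (B * e) := by
      rw [formH_eq _ _ _ hκ0, abs_mul, abs_of_nonneg (by positivity)]
      exact mul_le_mul_of_nonneg_left (hforms q.2 hx _ hε _).2.2 (by positivity)
    have h3 : k' q.1 * formH κ (fun j => b j q.2) (fun j => s j q.2)
        (weightedJet b κ (slice V q.1) q.2) ≤ (M * κ ^ 2) * (κ ^ 4 * (B * e)) := by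
      refine (le_abs_self _).trans ?_
      rw [abs_mul]
      exact mul_le_mul (hk.deriv_le _ hq.1) h2 (abs_nonneg _) (by positivity)
    have h4 : κ ^ 4 * e ≤ κ ^ 6 * e :=
      mul_le_mul_of_nonneg_right (pow_le_pow_right₀ hk1 (by norm_num)) he0
    have h5 : N * (κ ^ 6 * e) ≤ c / 2 * (κ ^ 7 * e) := by
      have : N * (κ ^ 6 * e) ≤ (c / 2 * κ) * (κ ^ 6 * e) :=
        mul_le_mul_of_nonneg_right (by linarith) (by positivity)
      calc _ ≤ _ := this
        _ = c / 2 * (κ ^ 7 * e) := by ring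
    have h6 : 18 * m ^ 2 * B * (κ ^ 4 * e) ≤ 18 * m ^ 2 * B * (κ ^ 6 * e) :=
      mul_le_mul_of_nonneg_left h4 (by positivity)
    have h7 : (M * κ ^ 2) * (κ ^ 4 * (B * e)) = M * B * (κ ^ 6 * e) := by ring
    have h8 : N * (κ ^ 6 * e) = 18 * m ^ 2 * B * (κ ^ 6 * e) + M * B * (κ ^ 6 * e) := by
      rw [hN]; ring
    linarith
  have i7c := i7.const_mul (c / 2)
  have i1 : IntegrableOn (fun q => symmPart b s (k q.1) (slice V q.1) q.2 ^ 2 / 2) (QDom T) :=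
    r1.memLp.integrable_sq.div_const 2
  rw [integral_add (iF.const_mul 2) i7c, integral_const_mul] at hsrc
  rw [integral_add i1 (i7.const_mul c), integral_const_mul] at hint
  rw [integral_add i1 i7c, integral_const_mul]
  rw [integral_const_mul] at hsrc
  nlinarith

end CarlemanData

end Estimate

/-! ### The weighted integrals of the Carleman inequality -/

section Conclusion

variable {T T₀ M m lam : ℝ} {k k' σ β φ₀ : ℝ → ℝ} {b s : ℕ → ℝ → ℝ} {V : ℕ → ℝ × ℝ → ℝ}
  {F q₀ q₁ q₂ : ℝ × ℝ → ℝ}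

theorem exp_weight_eq {t x : ℝ} (h : b 0 x = β x) :
    Real.exp (-2 * lam * weight β φ₀ t x) = Real.exp (-(lam / φ₀ t) * b 0 x) ^ 2 := by
  rw [← Real.exp_nat_mul, weight, h]
  congr 1
  push_cast
  ring

theorem lam_mul_weight_eq {t x : ℝ} (h : b 0 x = β x) :
    lam * weight β φ₀ t x = lam / φ₀ t * b 0 x := by
  rw [weight, h]; ring

theorem CarlemanData.carlemanSource_eq (D : CarlemanData b s)
    (hb : ∀ x ∈ Icc (0 : ℝ) 1, b 0 x = β x) (hk : TimeRate T M (fun t => lam / φ₀ t) k')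
    (hF : MemLp F 2 (volume.restrict (QDom T))) :
    carlemanSource T lam β φ₀ F = ENNReal.ofReal
      (∫ q in QDom T, (Real.exp (-(lam / φ₀ q.1) * b 0 q.2) * F q) ^ 2) := by
  rw [ofReal_integral_eq_lintegral_ofReal
    (RapidL2.exp_mul hk (D.cont_b 0) D.b_zero_pos hF).memLp.integrable_sq
    (Filter.Eventually.of_forall fun q => sq_nonneg _), carlemanSource]
  refine setLIntegral_congr_fun (measurableSet_QDom T) fun q hq => ?_
  simp only [exp_weight_eq (hb q.2 (Ioo_subset_Icc_self hq.2)), sq_abs, mul_pow]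

/-- The boundary integral controls the trace terms that come out of the integrations by parts. -/
theorem CarlemanData.exists_carlemanBoundary_bound (D : CarlemanData b s)
    (hb : ∀ x ∈ Icc (0 : ℝ) 1, b 0 x = β x) (hb1 : b 1 0 = derivWithin β (Icc 0 1) 0)
    (hs : ∀ x ∈ Icc (0 : ℝ) 1, s 0 x = σ x) :
    ∃ K, 1 ≤ K ∧ ∀ (T M lam : ℝ) (φ₀ k' : ℝ → ℝ), TimeRate T M (fun t => lam / φ₀ t) k' →
      ∀ V : ℕ → ℝ × ℝ → ℝ, IsL2H4H02 T V → ∃ I : ℝ, 0 ≤ I ∧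
        carlemanBoundary T lam σ β φ₀ V = ENNReal.ofReal I ∧
        ∫ t in Ioo 0 T, CarlemanData.traceEnergy b (lam / φ₀ t) (slice V t) ≤ K * I := by
  have m0 : (0 : ℝ) ∈ Icc (0 : ℝ) 1 := by simp
  have hp1 := D.b_one_pos 0 m0
  have hs0 := D.s_pos 0 m0
  set c₂ := b 1 0 ^ 3 * s 0 0 ^ 2 with hc₂
  set c₃ := b 1 0 * s 0 0 ^ 2 with hc₃
  have h2 : 0 < c₂ := by positivity
  have h3 : 0 < c₃ := by positivity
  refine ⟨1 + c₂⁻¹ + c₃⁻¹, by linarith [inv_pos.2 h2, inv_pos.2 h3], ?_⟩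
  intro T M lam φ₀ k' hk V hV
  have i2 := D.integrableOn_trace hk hV 3 (j := 2) (by norm_num)
  have i3 := D.integrableOn_trace hk hV 1 (j := 3) (by norm_num)
  let g : ℝ → ℝ := fun t =>
    c₂ * ((lam / φ₀ t) ^ 3 * weightedJet b (lam / φ₀ t) (slice V t) 0 2 ^ 2)
    + c₃ * ((lam / φ₀ t) ^ 1 * weightedJet b (lam / φ₀ t) (slice V t) 0 3 ^ 2)
  have hg : IntegrableOn g (Ioo 0 T) := (i2.const_mul c₂).add (i3.const_mul c₃)
  have hκ : ∀ t ∈ Ioo 0 T, 0 ≤ lam / φ₀ t := fun t ht => zero_le_one.trans (hk.one_le t ht)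
  have hg0 : ∀ t ∈ Ioo 0 T, 0 ≤ g t := fun t ht => by
    have := hκ t ht
    simp only [g]; positivity
  refine ⟨∫ t in Ioo 0 T, g t, setIntegral_nonneg measurableSet_Ioo hg0, ?_, ?_⟩
  · rw [ofReal_integral_eq_lintegral_ofReal hg
      ((ae_restrict_mem measurableSet_Ioo).mono hg0), carlemanBoundary]
    refine setLIntegral_congr_fun measurableSet_Ioo fun t _ => ?_
    have hx : weightX β φ₀ t 0 = b 1 0 / φ₀ t := by
      simp only [weightX, weight]
      rw [derivWithin_div_const, hb1]
    simp only [exp_weight_eq (hb 0 m0), hx, g, weightedJet, slice, sq_abs, ← hs 0 m0, hc₂, hc₃]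
    congr 1
    ring
  · rw [← integral_const_mul]
    refine setIntegral_mono_on ?_ (hg.const_mul _) measurableSet_Ioo fun t ht => ?_
    · exact (i2.add i3).congr (Filter.Eventually.of_forall fun t => by
        simp [CarlemanData.traceEnergy])
    · have h0 := hκ t ht
      set κ := lam / φ₀ t
      simp only [CarlemanData.traceEnergy, g, pow_one]
      set X := κ ^ 3 * weightedJet b κ (slice V t) 0 2 ^ 2
      set Y := κ * weightedJet b κ (slice V t) 0 3 ^ 2
      have hX : 0 ≤ X := by positivity
      have hY : 0 ≤ Y := by positivity
      have e1 : c₂⁻¹ * (c₂ * X) = X := by field_simp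
      have e2 : c₃⁻¹ * (c₃ * Y) = Y := by field_simp
      have e3 : 0 ≤ c₂⁻¹ * (c₃ * Y) := by positivity
      have e4 : 0 ≤ c₃⁻¹ * (c₂ * X) := by positivity
      have e5 : 0 ≤ c₂ * X := by positivity
      have e6 : 0 ≤ c₃ * Y := by positivity
      linarith

/-- The density on the left of the Carleman inequality at a point, with `E = e^{-kβ}`,
`y = β(x)` and `X = P₁ + P₂ = E (σ v_xx)_xx`. -/
theorem density_le {κ y E P₁ P₂ S R A e B B' c : ℝ} {v : ℕ → ℝ} (hκ : 1 ≤ κ) (hB : 0 ≤ B)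
    (hB' : 1 ≤ B') (hc : 0 < c) (he : 0 ≤ e) (hy : 0 < y) (hyB : y ≤ B') (hyB' : y⁻¹ ≤ B')
    (hX : E * S = P₁ + P₂) (hP₂ : P₂ ^ 2 ≤ κ ^ 8 * (B * e))
    (hR : (E * R) ^ 2 ≤ 2 * A + 18 * m ^ 2 * B * (κ ^ 4 * e)) (hA : 0 ≤ A)
    (hv : ∀ j < 4, (E * v j) ^ 2 ≤ κ ^ (2 * j) * (B * e)) :
    E ^ 2 * ((|R - S| ^ 2 + |S| ^ 2) / (κ * y) + (κ * y) ^ 7 * |v 0| ^ 2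
        + (κ * y) ^ 5 * |v 1| ^ 2 + (κ * y) ^ 3 * |v 2| ^ 2 + κ * y * |v 3| ^ 2)
      ≤ (12 * B' + (B' * (36 * m ^ 2 * B + 6 * B) + 4 * B' ^ 7 * B) / c)
        * (P₁ ^ 2 / 2 + c * (κ ^ 7 * e) + A) := by
  have hκ0 : 0 < κ := by linarith
  set Z := κ ^ 7 * e with hZ
  have hZ0 : 0 ≤ Z := by positivity
  have hBZ : 0 ≤ B * Z := by positivity
  have hterm : ∀ j ≤ 3, (κ * y) ^ (7 - 2 * j) * (E * v j) ^ 2 ≤ B' ^ 7 * (B * Z) := by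
    intro j hj
    calc (κ * y) ^ (7 - 2 * j) * (E * v j) ^ 2
        ≤ (κ * B') ^ (7 - 2 * j) * (κ ^ (2 * j) * (B * e)) := by
          refine mul_le_mul ?_ (hv j (by omega)) (sq_nonneg _) (by positivity)
          gcongr
      _ = B' ^ (7 - 2 * j) * (B * (κ ^ (7 - 2 * j + 2 * j) * e)) := by
          rw [mul_pow, pow_add]; ring
      _ = B' ^ (7 - 2 * j) * (B * Z) := by rw [show 7 - 2 * j + 2 * j = 7 by omega]
      _ ≤ B' ^ 7 * (B * Z) :=
          mul_le_mul_of_nonneg_right (pow_le_pow_right₀ hB' (by omega)) hBZ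
  have t0 := hterm 0 (by norm_num)
  have t1 := hterm 1 (by norm_num)
  have t2 := hterm 2 (by norm_num)
  have t3 := hterm 3 (by norm_num)
  norm_num at t0 t1 t2 t3
  have hnum : E ^ 2 * (|R - S| ^ 2 + |S| ^ 2)
      ≤ κ * (4 * A + 6 * P₁ ^ 2 + (36 * m ^ 2 * B + 6 * B) * Z) := by
    have h4 : κ ^ 4 * e ≤ κ * Z := by
      rw [hZ, ← mul_assoc, ← pow_succ']
      exact mul_le_mul_of_nonneg_right (pow_le_pow_right₀ hκ (by norm_num)) he
    have h8 : κ ^ 8 * (B * e) = κ * (B * Z) := by rw [hZ]; ring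
    have hA1 : A ≤ κ * A := by nlinarith
    have hP1 : P₁ ^ 2 ≤ κ * P₁ ^ 2 := by nlinarith [sq_nonneg P₁]
    have hm4 : 18 * m ^ 2 * B * (κ ^ 4 * e) ≤ 18 * m ^ 2 * B * (κ * Z) :=
      mul_le_mul_of_nonneg_left h4 (by positivity)
    have e1 : E ^ 2 * (|R - S| ^ 2 + |S| ^ 2) = (E * R - (P₁ + P₂)) ^ 2 + (P₁ + P₂) ^ 2 := by
      rw [sq_abs, sq_abs, ← hX]; ring
    rw [e1]
    have e2 : (E * R - (P₁ + P₂)) ^ 2 + (P₁ + P₂) ^ 2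
        ≤ 2 * (E * R) ^ 2 + 6 * P₁ ^ 2 + 6 * P₂ ^ 2 := by
      nlinarith [sq_nonneg (E * R + (P₁ + P₂)), sq_nonneg (P₁ - P₂)]
    have e3 : 18 * m ^ 2 * B * (κ * Z) = κ * (18 * m ^ 2 * B * Z) := by ring
    have e4 : κ * (4 * A + 6 * P₁ ^ 2 + (36 * m ^ 2 * B + 6 * B) * Z)
        = 4 * (κ * A) + 6 * (κ * P₁ ^ 2) + 2 * (κ * (18 * m ^ 2 * B * Z)) + 6 * (κ * (B * Z)) := by
      ring
    rw [e4]
    linarith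
  have hdiv : E ^ 2 * ((|R - S| ^ 2 + |S| ^ 2) / (κ * y))
      ≤ B' * (4 * A + 6 * P₁ ^ 2 + (36 * m ^ 2 * B + 6 * B) * Z) := by
    rw [← mul_div_assoc, div_le_iff₀ (by positivity)]
    have h1 : 1 ≤ B' * y := by
      rwa [inv_le_iff_one_le_mul₀ hy] at hyB'
    have h2 : 0 ≤ κ * (4 * A + 6 * P₁ ^ 2 + (36 * m ^ 2 * B + 6 * B) * Z) := by positivity
    calc _ ≤ _ := hnum
      _ ≤ (B' * y) * (κ * (4 * A + 6 * P₁ ^ 2 + (36 * m ^ 2 * B + 6 * B) * Z)) :=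
        le_mul_of_one_le_left h2 h1
      _ = _ := by ring
  have hsplit : E ^ 2 * ((|R - S| ^ 2 + |S| ^ 2) / (κ * y) + (κ * y) ^ 7 * |v 0| ^ 2
        + (κ * y) ^ 5 * |v 1| ^ 2 + (κ * y) ^ 3 * |v 2| ^ 2 + κ * y * |v 3| ^ 2)
      = E ^ 2 * ((|R - S| ^ 2 + |S| ^ 2) / (κ * y)) + (κ * y) ^ 7 * (E * v 0) ^ 2
        + (κ * y) ^ 5 * (E * v 1) ^ 2 + (κ * y) ^ 3 * (E * v 2) ^ 2 + κ * y * (E * v 3) ^ 2 := by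
    simp only [sq_abs]; ring
  rw [hsplit]
  set N := B' * (36 * m ^ 2 * B + 6 * B) + 4 * B' ^ 7 * B with hN
  have hN0 : 0 ≤ N := by positivity
  have hNc : N / c * (c * Z) = N * Z := by field_simp
  have r1 : 0 ≤ N / c * (P₁ ^ 2 / 2 + A) := by positivity
  have r2 : 0 ≤ 12 * B' * (c * Z) := by positivity
  have r3 : 0 ≤ B' * A := by positivity
  have r4 : N * Z = B' * ((36 * m ^ 2 * B + 6 * B) * Z) + 4 * (B' ^ 7 * (B * Z)) := by
    rw [hN]; ring
  have r5 : (12 * B' + N / c) * (P₁ ^ 2 / 2 + c * Z + A) = 6 * (B' * P₁ ^ 2) + 12 * B' * (c * Z)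
      + 12 * (B' * A) + N / c * (P₁ ^ 2 / 2 + A) + N / c * (c * Z) := by ring
  have r6 : B' * (4 * A + 6 * P₁ ^ 2 + (36 * m ^ 2 * B + 6 * B) * Z)
      = 4 * (B' * A) + 6 * (B' * P₁ ^ 2) + B' * ((36 * m ^ 2 * B + 6 * B) * Z) := by ring
  rw [r5, hNc, r4]
  rw [r6] at hdiv
  linarith

/-- The Carleman inequality, with constants `k₀` and `C` that depend on `β`, `σ`, `m` and on the
constant `M` of the time weight. -/
theorem CarlemanData.exists_carleman_bound (D : CarlemanData b s) (hm : 0 ≤ m) (hM : 0 ≤ M)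
    (hb : ∀ x ∈ Icc (0 : ℝ) 1, b 0 x = β x) (hb1 : b 1 0 = derivWithin β (Icc 0 1) 0)
    (hs : ∀ x ∈ Icc (0 : ℝ) 1, s 0 x = σ x) :
    ∃ k₀, 1 ≤ k₀ ∧ ∃ C, 0 < C ∧ ∀ (T lam : ℝ) (φ₀ k' : ℝ → ℝ),
      TimeRate T M (fun t => lam / φ₀ t) k' → (∀ t ∈ Ioo 0 T, k₀ ≤ lam / φ₀ t) →
      ∀ (q₀ q₁ q₂ : ℝ × ℝ → ℝ), LinftyBound T m q₀ → LinftyBound T m q₁ → LinftyBound T m q₂ →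
      ∀ (V : ℕ → ℝ × ℝ → ℝ) (F : ℝ × ℝ → ℝ), MemSpaceV T σ q₀ q₁ q₂ V F →
        carlemanSource T lam β φ₀ F + carlemanBoundary T lam σ β φ₀ V < ∞ ∧
        carlemanLHS T lam β φ₀ V
            (fun q => reducedSource q₀ q₁ q₂ V F q - principalPart s V q) (principalPart s V)
          ≤ ENNReal.ofReal C *
            (carlemanSource T lam β φ₀ F + carlemanBoundary T lam σ β φ₀ V) := by
  obtain ⟨c, hc, k₀, hk₀, C, hC, hmain⟩ := D.exists_weighted_bound hs hm hM
  obtain ⟨B, hB, hforms⟩ := D.exists_forms_bound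
  obtain ⟨K, hK, hbd⟩ := D.exists_carlemanBoundary_bound hb hb1 hs
  have hcb : ContinuousOn (b 0) (Icc 0 1) := (D.cont_b 0).continuousOn
  obtain ⟨B₁, hB₁⟩ := isCompact_Icc.exists_bound_of_continuousOn hcb
  obtain ⟨B₂, hB₂⟩ := isCompact_Icc.exists_bound_of_continuousOn
    (hcb.inv₀ fun x hx => (D.b_zero_pos x hx).ne')
  set B' := max 1 (max B₁ B₂) with hB'
  have hB1 : 1 ≤ B' := le_max_left _ _
  set N := 12 * B' + (B' * (36 * m ^ 2 * B + 6 * B) + 4 * B' ^ 7 * B) / c with hN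
  have hN0 : 0 < N := by positivity
  refine ⟨k₀, hk₀, N * (C + 1) * K, by positivity, ?_⟩
  intro T lam φ₀ k' hk hkk q₀ q₁ q₂ h₀ h₁ h₂ V F hV
  obtain ⟨I, hI0, hIeq, hIle⟩ := hbd T M lam φ₀ k' hk V hV.reg
  have hsrc := D.carlemanSource_eq hb hk hV.memLp
  have hw := hmain T _ k' hk hkk q₀ q₁ q₂ h₀ h₁ h₂ V F hV
  have iA : IntegrableOn (fun q => (Real.exp (-(lam / φ₀ q.1) * b 0 q.2) * F q) ^ 2) (QDom T) :=
    (RapidL2.exp_mul hk (D.cont_b 0) D.b_zero_pos hV.memLp).memLp.integrable_sq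
  have iL : IntegrableOn (fun q => symmPart b s (lam / φ₀ q.1) (slice V q.1) q.2 ^ 2 / 2
      + c * ((lam / φ₀ q.1) ^ 7 * energy b (lam / φ₀ q.1) (slice V q.1) q.2)) (QDom T) :=
    ((D.rapid_symmPart hk hV.reg).memLp.integrable_sq.div_const 2).add
      ((D.integrableOn_pow_mul_energy hk hV.reg 7).const_mul c)
  set A := ∫ q in QDom T, (Real.exp (-(lam / φ₀ q.1) * b 0 q.2) * F q) ^ 2 with hA
  have hA0 : 0 ≤ A := integral_nonneg fun q => sq_nonneg _
  rw [hsrc, hIeq, ← ENNReal.ofReal_add hA0 hI0, ← ENNReal.ofReal_mul (by positivity)]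
  refine ⟨ENNReal.ofReal_lt_top, ?_⟩
  have hpt : ∀ᵐ q ∂volume.restrict (QDom T),
      ENNReal.ofReal (Real.exp (-2 * lam * weight β φ₀ q.1 q.2) *
        ((|reducedSource q₀ q₁ q₂ V F q - principalPart s V q| ^ 2
            + |principalPart s V q| ^ 2) / (lam * weight β φ₀ q.1 q.2)
          + lam ^ 7 * weight β φ₀ q.1 q.2 ^ 7 * |V 0 q| ^ 2
          + lam ^ 5 * weight β φ₀ q.1 q.2 ^ 5 * |V 1 q| ^ 2
          + lam ^ 3 * weight β φ₀ q.1 q.2 ^ 3 * |V 2 q| ^ 2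
          + lam * weight β φ₀ q.1 q.2 * |V 3 q| ^ 2))
      ≤ ENNReal.ofReal (N * (symmPart b s (lam / φ₀ q.1) (slice V q.1) q.2 ^ 2 / 2
        + c * ((lam / φ₀ q.1) ^ 7 * energy b (lam / φ₀ q.1) (slice V q.1) q.2)
        + (Real.exp (-(lam / φ₀ q.1) * b 0 q.2) * F q) ^ 2)) := by
    filter_upwards [h₀.ae_le hm, h₁.ae_le hm, h₂.ae_le hm,
      ae_restrict_mem (measurableSet_QDom T)] with q a0 a1 a2 hq
    have hx := Ioo_subset_Icc_self hq.2
    have hκ : 1 ≤ lam / φ₀ q.1 := hk.one_le _ hq.1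
    simp only [exp_weight_eq (hb q.2 hx), ← mul_pow]
    simp only [lam_mul_weight_eq (hb q.2 hx)]
    refine ENNReal.ofReal_le_ofReal ?_
    set κ := lam / φ₀ q.1
    have hε : κ⁻¹ ∈ Icc (0 : ℝ) 1 := ⟨by positivity, inv_le_one_of_one_le₀ hκ⟩
    have hκ0 : κ ≠ 0 := by positivity
    have he := energy_nonneg b κ (slice V q.1) q.2
    have hu : ∀ j < 4, weightedJet b κ (slice V q.1) q.2 j ^ 2
        ≤ κ ^ (2 * j) * (B * energy b κ (slice V q.1) q.2) := fun j hj =>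
      weightedJet_sq_le hκ (fun ε hε z => (hforms q.2 hx ε hε z).1) (slice V q.1) hj
    refine density_le (v := fun j => V j q) hκ hB.le hB1 hc he (D.b_zero_pos _ hx)
      (((le_abs_self _).trans (hB₁ _ hx)).trans ((le_max_left _ _).trans (le_max_right _ _)))
      (((le_abs_self _).trans (hB₂ _ hx)).trans ((le_max_right _ _).trans (le_max_right _ _)))
      (P₂ := skewPart b s κ (slice V q.1) q.2) ?_ ?_
      (exp_mul_reducedSource_sq_le hκ a0 a1 a2 he hu hB.le) (sq_nonneg _) hu
    · simp only [symmPart, skewPart, principalPart, opX, weightedJet, slice]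
      ring
    · have e1 : skewPart b s κ (slice V q.1) q.2 = κ ^ 4 * _ :=
        skew_eq (fun j => b j q.2) (fun j => s j q.2) (weightedJet b κ (slice V q.1) q.2) hκ0
      rw [e1, mul_pow, ← pow_mul]
      exact mul_le_mul_of_nonneg_left (hforms q.2 hx _ hε _).2.1 (by positivity)
  refine (lintegral_mono_ae hpt).trans ?_
  have iR : IntegrableOn (fun q => N * (symmPart b s (lam / φ₀ q.1) (slice V q.1) q.2 ^ 2 / 2
      + c * ((lam / φ₀ q.1) ^ 7 * energy b (lam / φ₀ q.1) (slice V q.1) q.2)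
      + (Real.exp (-(lam / φ₀ q.1) * b 0 q.2) * F q) ^ 2)) (QDom T) := (iL.add iA).const_mul N
  rw [← ofReal_integral_eq_lintegral_ofReal iR]
  · refine ENNReal.ofReal_le_ofReal ?_
    rw [integral_const_mul, integral_add iL iA, ← hA]
    have h1 : A + ∫ t in Ioo 0 T, traceEnergy b (lam / φ₀ t) (slice V t) ≤ K * (A + I) := by
      nlinarith
    have h2 := mul_le_mul_of_nonneg_left h1 hC.le
    have h3 : A ≤ K * (A + I) := by nlinarith [mul_nonneg (zero_le_one.trans hK) hI0]
    calc N * _ ≤ N * (C * (K * (A + I)) + K * (A + I)) := by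
          refine mul_le_mul_of_nonneg_left ?_ hN0.le
          exact add_le_add (hw.trans h2) h3
      _ = N * (C + 1) * K * (A + I) := by ring
  · filter_upwards [ae_restrict_mem (measurableSet_QDom T)] with q hq
    have hκ : 0 ≤ lam / φ₀ q.1 := zero_le_one.trans (hk.one_le _ hq.1)
    have he := energy_nonneg b (lam / φ₀ q.1) (slice V q.1) q.2
    simp only [Pi.zero_apply]
    positivity

end Conclusion

end

theorem theorem3p1 :
    ∃ C : ℝ → ℝ → ℝ → ℝ → ℝ, (∀ T lam₀ r m : ℝ, 0 < C T lam₀ r m) ∧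
      ∀ (T T₀ r m : ℝ) (σ β φ₀ : ℝ → ℝ),
        IsDiffusion σ → IsSpaceWeight σ r β → IsTimeWeight T T₀ φ₀ → 0 < m →
        ∃ lam₀ : ℝ, 0 < lam₀ ∧
          ∀ q₀ q₁ q₂ : ℝ × ℝ → ℝ,
            LinftyBound T m q₀ → LinftyBound T m q₁ → LinftyBound T m q₂ →
            ∀ (V : ℕ → ℝ × ℝ → ℝ) (F : ℝ × ℝ → ℝ), MemSpaceV T σ q₀ q₁ q₂ V F →
              ∃ vt S : ℝ × ℝ → ℝ,
                MemLp vt 2 (volume.restrict (QDom T)) ∧ HasWeakDt T (V 0) vt ∧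
                MemLp S 2 (volume.restrict (QDom T)) ∧
                HasWeakDxx T (fun p => σ p.2 * V 2 p) S ∧
                ∀ lam : ℝ, lam₀ ≤ lam →
                  carlemanSource T lam β φ₀ F + carlemanBoundary T lam σ β φ₀ V < ∞ ∧
                  carlemanLHS T lam β φ₀ V vt S ≤
                    ENNReal.ofReal (C T lam₀ r m) *
                      (carlemanSource T lam β φ₀ F + carlemanBoundary T lam σ β φ₀ V) := by
  refine ⟨fun _ lam₀ _ _ => |lam₀| + 1, fun _ _ _ _ => by positivity, ?_⟩
  intro T T₀ r m σ β φ₀ hσ hβ hφ hm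
  obtain ⟨b, s, D, hb, hb1, hs⟩ := exists_carlemanData hσ hβ
  obtain ⟨M, hM, hrate⟩ := hφ.exists_timeRate
  obtain ⟨k₀, hk₀, C, hC, hmain⟩ := D.exists_carleman_bound hm.le hM.le hb hb1 hs
  have hφ0 : 0 < φ₀ T₀ := hφ.pos T₀ hφ.mem
  -- the threshold is taken larger than the constant, so that it determines an admissible constant
  refine ⟨max (max 1 (k₀ * φ₀ T₀)) C, by positivity, ?_⟩
  intro q₀ q₁ q₂ h₀ h₁ h₂ V F hV
  refine ⟨fun q => reducedSource q₀ q₁ q₂ V F q - principalPart s V q, principalPart s V,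
    (memLp_reducedSource hm.le h₀ h₁ h₂ hV).sub (D.memLp_principalPart hV.reg),
    D.hasWeakDt hs hm.le h₀ h₁ h₂ hV, D.memLp_principalPart hV.reg, D.hasWeakDxx hs hV.reg, ?_⟩
  intro lam hlam
  have hl1 : 1 ≤ lam := ((le_max_left _ _).trans (le_max_left _ _)).trans hlam
  have hlk : k₀ * φ₀ T₀ ≤ lam := ((le_max_right _ _).trans (le_max_left _ _)).trans hlam
  obtain ⟨k', hk⟩ := hrate lam hl1 ((le_mul_of_one_le_left hφ0.le hk₀).trans hlk)
  obtain ⟨hfin, hle⟩ := hmain T lam φ₀ k' hk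
    (fun t ht => by
      rw [le_div_iff₀ (hφ.pos t ht)]
      exact (mul_le_mul_of_nonneg_left (hφ.le_max t ht) (by linarith)).trans hlk)
    q₀ q₁ q₂ h₀ h₁ h₂ V F hV
  refine ⟨hfin, hle.trans (mul_le_mul_left (ENNReal.ofReal_le_ofReal ?_) _)⟩
  exact (le_max_right _ _).trans ((le_abs_self _).trans (le_add_of_nonneg_right zero_le_one))
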